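/- Let $M$ be a connected (Hausdorff, second countable) smooth manifold of dimension $m>2$ and $g$ a smooth symmetric $(0,2)$-tensor field on $M$, also written $\langle\cdot,\cdot\rangle$, such that: - the set $\Sigma$ of points where $g$ is degenerate is non-empty, and in every local coordinate system $\det(g_{ab})$ has non-zero differential at the points of $\Sigma$ (so $\Sigma$ is a smooth hypersurface and the radical $Rad_p=\{v\in T_pM:\langle v,\cdot\rangle=0\}$, $p\in\Sigma$, is a line); - $Rad_p\subset T_p\Sigma$ for all $p\in\Sigma$; - the signature of $g$ changes from Riemannian to Lorentzian, of type $(m-1,1)$, upon crossing $\Sigma$. Notation. Let $\nabla$ be the Levi-Civita connection of $g$ on $M\setminus\Sigma$, with $R(\mathcal A,\mathcal B)\mathcal C=\nabla_{\mathcal A}\nabla_{\mathcal B}\mathcal C-\nabla_{\mathcal B}\nabla_{\mathcal A}\mathcal C-\nabla_{[\mathcal A,\mathcal B]}\mathcal C$. Let $\square_{\mathcal A}\mathcal B(\mathcal C)$ be the dual connection, defined on all of $M$ by the Koszul formula $$2\square_{\mathcal A}\mathcal B(\mathcal C)=\mathcal A\langle\mathcal B,\mathcal C\rangle+\mathcal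 B\langle\mathcal C,\mathcal A\rangle-\mathcal C\langle\mathcal A,\mathcal B\rangle+\langle[\mathcal A,\mathcal B],\mathcal C\rangle-\langle[\mathcal B,\mathcal C],\mathcal A\rangle+\langle[\mathcal C,\mathcal A],\mathcal B\rangle .$$ Locally along $\Sigma$ let $N$ (the main normal) and $R$ (the main radical field) be the smooth vector fields along $\Sigma$, with $N$ unique and $R$ unique up to sign, such that $\langle N,T\Sigma\rangle=0$, $\langle N,N\rangle=1$, $R\in Rad$, $\square_NN(R)=0$ and $\mathcal H(R,R)=-1$, where $\mathcal H(X,Y):=-\square_XN(Y)$ for $X,Y$ tangent to $\Sigma$. Put $II(A,B):=\square_AB(R)$ for vector fields $A,B$ along $\Sigma$ (this is tensorial), let $S_p:=\{v\in T_p\Sigma:\mathcal H(v,R(p))=0\}$ be the screen, and decompose vectors along $\Sigma$ as $A=\nu(A)N+A^S+\rho(A)R$ with $\nu(A)=\langle A,N\rangle$, $\rho(A)=-\mathcal H(A-\nu(A)N,R)$ and $A^S\in S$. $\Sigma$ is *$II$-flat* if $II(V,W)=0$ for all $V,W$ in $S$. It is *$III$-flat* if it is $II$-flat and $III(V,W,R):=II(\nabla_{\mathcal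 V}\mathcal W|_\Sigma,R)=0$ for all local vector fields $\mathcal V,\mathcal W$ on $M$ that lie in $S$ along $\Sigma$; here $\nabla_{\mathcal V}\mathcal W$ denotes its smooth extension across $\Sigma$, which exists if $\Sigma$ is $II$-flat. Let $U\subset M$ be open. A function on $U\setminus\Sigma$ *extends* if it has a smooth extension to $U$ (unique, since $\Sigma$ has empty interior). For vector fields $A,B,C,D$ along $\Sigma\cap U$ (restrictions of smooth fields on $U$), $\langle R(A,B)C,D\rangle$ is *well-defined* if for all smooth extensions $\mathcal A,\mathcal B,\mathcal C,\mathcal D$ of $A,B,C,D$ to $U$ the function $\langle R(\mathcal A,\mathcal B)\mathcal C,\mathcal D\rangle$ extends and the restriction to $\Sigma\cap U$ of its extension does not depend on the choice of $\mathcal A,\mathcal B,\mathcal C,\mathcal D$; this restriction is then denoted $\langle R(A,B)C,D\rangle$. Say that $(A,B)$ is *degenerate* if at every point of $\Sigma\cap U$ the Gram matrix of $g$ on $(A,B)$ has rank $1$ and $R\in\mathrm{Span}(A,B)$. **Proposition.** (a) Let $U\subset M$ be open and let $\mathcal A,\mathcal B$ be smooth vector fields on $U$ whose restriction $(A,B)$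 to $\Sigma\cap U$ is degenerate and whose Gram matrix has rank $2$ at every point of $U\setminus\Sigma$. Then the sectional curvature $$K_{\mathcal A\wedge\mathcal B}=\frac{\langle R(\mathcal A,\mathcal B)\mathcal A,\mathcal B\rangle}{\langle\mathcal A,\mathcal A\rangle\langle\mathcal B,\mathcal B\rangle-\langle\mathcal A,\mathcal B\rangle^2}$$ on $U\setminus\Sigma$ extends if and only if $\langle R(\mathcal A,\mathcal B)\mathcal A,\mathcal B\rangle$ extends with restriction $0$ to $\Sigma\cap U$. In that case $\nu(A)=\nu(B)=0$ on $\Sigma\cap U$. (b) Consider the assertions: 1. for every open $U$ and all degenerate $(A,B)$ along $\Sigma\cap U$ with $\nu(A)=\nu(B)=0$, $\langle R(A,B)A,B\rangle$ is well-defined and equal to $0$; 2. $\Sigma$ is $III$-flat; 3. $\Sigma$ is $II$-flat; 4. for every open $U$ and all degenerate $(A,B)$ along $\Sigma\cap U$ with $\nu(A)=\nu(B)=0$, $\langle R(A,B)A,B\rangle$ is well-defined. Then (1) $\Leftrightarrow$ (2) $\Rightarrow$ (3) $\Leftrightarrow$ (4). Moreover, for every degenerate $(A,B)$ with $\nu(A)=\nu(B)=0$,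 $\dim\mathrm{Span}(A^S,B^S)=1$ at every point of $\Sigma\cap U$. -/

import Mathlib

open scoped Manifold ContDiff Topology Bundle
open Bundle

namespace SingularMetric

variable {m : ℕ} {M : Type*} [TopologicalSpace M] [ChartedSpace (EuclideanSpace ℝ (Fin m)) M]

/-- A (not necessarily continuous) vector field on the `m`-dimensional manifold `M`. -/
abbrev Field (m : ℕ) (M : Type*) [TopologicalSpace M]
    [ChartedSpace (EuclideanSpace ℝ (Fin m)) M] : Type _ :=
  (p : M) → TangentSpace (𝓡 m) p

/-- The vector field `A` is smooth on the set `U`. -/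
def SmoothOn [IsManifold (𝓡 m) ∞ M] (U : Set M) (A : Field m M) : Prop :=
  ContMDiffOn (𝓡 m) (𝓡 m).tangent ∞
    (fun p ↦ (⟨p, A p⟩ : TangentBundle (𝓡 m) M)) U

variable (m M) in
/-- A smooth symmetric `(0,2)`-tensor field; it may degenerate. -/
structure SymTensor [IsManifold (𝓡 m) ∞ M] where
  val (p : M) : TangentSpace (𝓡 m) p →L[ℝ] TangentSpace (𝓡 m) p →L[ℝ] ℝ
  symm (p : M) (v w : TangentSpace (𝓡 m) p) : val p v w = val p w v
  smooth : ContMDiff (𝓡 m)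
    ((𝓡 m).prod 𝓘(ℝ, EuclideanSpace ℝ (Fin m) →L[ℝ] EuclideanSpace ℝ (Fin m) →L[ℝ] ℝ)) ∞
    (fun p ↦ TotalSpace.mk' (EuclideanSpace ℝ (Fin m) →L[ℝ] EuclideanSpace ℝ (Fin m) →L[ℝ] ℝ)
      p (val p))

variable [IsManifold (𝓡 m) ∞ M]

/-! ### The singular hypersurface -/

/-- The radical of `g` at `p`: the vectors orthogonal to all of `T_p M`. -/
noncomputable def rad (g : SymTensor m M) (p : M) : Submodule ℝ (TangentSpace (𝓡 m) p) :=
  LinearMap.ker (g.val p).toLinearMap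

/-- The set `Σ` of points where `g` degenerates. -/
def sing (g : SymTensor m M) : Set M := {p | rad g p ≠ ⊥}

/-- The function `x ↦ det (g (∂_a, ∂_b))` in the local coordinates given by `e`. -/
noncomputable def gramDet (g : SymTensor m M)
    (e : OpenPartialHomeomorph M (EuclideanSpace ℝ (Fin m)))
    (x : EuclideanSpace ℝ (Fin m)) : ℝ :=
  Matrix.det (Matrix.of fun a b : Fin m ↦
    g.val (e.symm x)
      (mfderiv (𝓡 m) (𝓡 m) e.symm x (EuclideanSpace.single a (1 : ℝ)))
      (mfderiv (𝓡 m) (𝓡 m) e.symm x (EuclideanSpace.single b (1 : ℝ))))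

/-- `v` is tangent to the hypersurface `Σ` at `p`: it annihilates every function that is smooth
near `p` and vanishes on `Σ` near `p`. -/
def IsTangent (g : SymTensor m M) (p : M) (v : TangentSpace (𝓡 m) p) : Prop :=
  ∀ f : M → ℝ, ContMDiffAt (𝓡 m) 𝓘(ℝ, ℝ) ∞ f p → (∀ᶠ q in 𝓝 p, q ∈ sing g → f q = 0) →
    mvfderiv (𝓡 m) f p v = 0

/-- `g` is positive definite at `p`. -/
def IsRiemannAt (g : SymTensor m M) (p : M) : Prop :=
  ∀ v : TangentSpace (𝓡 m) p, v ≠ 0 → 0 < g.val p v v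

/-- `g` is a Lorentz scalar product, of signature `(m - 1, 1)`, at `p`: it is positive definite on
the orthogonal complement of some timelike vector. -/
def IsLorentzAt (g : SymTensor m M) (p : M) : Prop :=
  ∃ t : TangentSpace (𝓡 m) p, g.val p t t < 0 ∧
    ∀ v : TangentSpace (𝓡 m) p, g.val p t v = 0 → v ≠ 0 → 0 < g.val p v v

/-- `(M, g)` is a transverse Riemann-Lorentz space with tangent radical. -/
structure IsTransverseRiemannLorentz (g : SymTensor m M) : Prop where
  nonempty : (sing g).Nonempty
  /-- In every local coordinate system the determinant of the coefficients of `g` has nonzero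
  differential at the points of `Σ`. -/
  transverse : ∀ e ∈ IsManifold.maximalAtlas (𝓡 m) ∞ M, ∀ p ∈ e.source, p ∈ sing g →
    fderiv ℝ (gramDet g e) (e p) ≠ 0
  tangent : ∀ p ∈ sing g, ∀ v ∈ rad g p, IsTangent g p v
  riemann_or_lorentz : ∀ p ∉ sing g, IsRiemannAt g p ∨ IsLorentzAt g p
  /-- The signature changes from Riemann to Lorentz upon crossing `Σ`. -/
  crossing : ∀ p ∈ sing g,
    p ∈ closure {q | IsRiemannAt g q} ∧ p ∈ closure {q | IsLorentzAt g q}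

/-! ### The dual connection, the Levi-Civita connection and the curvature -/

/-- The derivative `A ⟨B, C⟩` at `p`. -/
noncomputable def dInner (g : SymTensor m M) (A B C : Field m M) (p : M) : ℝ :=
  mvfderiv (𝓡 m) (fun q ↦ g.val q (B q) (C q)) p (A p)

/-- The dual connection `□_A B (C)`, through the Koszul formula. -/
noncomputable def dual (g : SymTensor m M) (A B C : Field m M) (p : M) : ℝ :=
  (1 / 2) * (dInner g A B C p + dInner g B C A p - dInner g C A B p
    + g.val p (VectorField.mlieBracket (𝓡 m) A B p) (C p)
    - g.val p (VectorField.mlieBracket (𝓡 m) B C p) (A p)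
    + g.val p (VectorField.mlieBracket (𝓡 m) C A p) (B p))

/-- A local extension of a tangent vector to a vector field that is smooth near its base point. -/
noncomputable def localExt {p : M} (v : TangentSpace (𝓡 m) p) : Field m M :=
  FiberBundle.extend (EuclideanSpace ℝ (Fin m)) v

open Classical in
/-- The Levi-Civita covariant derivative `∇_A B` at a point `p` outside `Σ`: the vector that
represents the linear form `c ↦ □_A B (c)` on `T_p M`. (It is not used at points of `Σ`.) -/
noncomputable def nabla (g : SymTensor m M) (A B : Field m M) : Field m M := fun p ↦
  if h : ∃ v : TangentSpace (𝓡 m) p,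
      ∀ c : TangentSpace (𝓡 m) p, g.val p v c = dual g A B (localExt c) p
  then h.choose else 0

/-- The covariant curvature `⟨R(A, B) C, D⟩`, where
`R(A, B) C = ∇_A ∇_B C - ∇_B ∇_A C - ∇_[A, B] C`; to be used outside `Σ`. -/
noncomputable def curv (g : SymTensor m M) (A B C D : Field m M) (p : M) : ℝ :=
  g.val p (nabla g A (nabla g B C) p - nabla g B (nabla g A C) p
    - nabla g (VectorField.mlieBracket (𝓡 m) A B) C p) (D p)

/-- The matrix of the restriction `g_{A ∧ B}` of `g` to the plane spanned by `A` and `B`. -/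
noncomputable def planeGram (g : SymTensor m M) (A B : Field m M) (p : M) : Matrix (Fin 2) (Fin 2) ℝ :=
  !![g.val p (A p) (A p), g.val p (A p) (B p); g.val p (B p) (A p), g.val p (B p) (B p)]

/-- The sectional curvature `K_{A ∧ B} = ⟨R(A, B) A, B⟩ / det g_{A ∧ B}`; to be used outside `Σ`. -/
noncomputable def sec (g : SymTensor m M) (A B : Field m M) (p : M) : ℝ :=
  curv g A B A B p / (planeGram g A B p).det

/-! ### Main normal, main radical field, fundamental forms, screen -/

/-- The restrictions to `Σ ∩ U` of the smooth fields `N` and `R` are a main normal and a main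
radical vector field: `N` is orthogonal to `Σ`, unitary and `II`-isotropic, and `R` is radical
with `H (R, R) = - □_R N (R) = -1`. -/
structure IsMainPair (g : SymTensor m M) (U : Set M) (N R : Field m M) : Prop where
  smooth_normal : SmoothOn U N
  smooth_radical : SmoothOn U R
  normal : ∀ p ∈ U ∩ sing g, ∀ v : TangentSpace (𝓡 m) p, IsTangent g p v → g.val p (N p) v = 0
  unit : ∀ p ∈ U ∩ sing g, g.val p (N p) (N p) = 1
  radical : ∀ p ∈ U ∩ sing g, R p ∈ rad g p
  isotropic : ∀ p ∈ U ∩ sing g, dual g N N R p = 0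
  normalized : ∀ p ∈ U ∩ sing g, -dual g R N R p = -1

open Classical in
/-- A choice of fields, smooth near `p`, that restrict to a main normal and a main radical field.
On `Σ` the first one is unique and the second one is unique up to sign. -/
noncomputable def mainPair (g : SymTensor m M) (p : M) : Field m M × Field m M :=
  if h : ∃ F : Field m M × Field m M, ∃ U : Set M, IsOpen U ∧ p ∈ U ∧ IsMainPair g U F.1 F.2
  then h.choose else 0

/-- The main normal `N` at a point of `Σ`. -/
noncomputable def mainNormal (g : SymTensor m M) (p : M) : TangentSpace (𝓡 m) p :=
  (mainPair g p).1 p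

/-- The main radical vector `R` at a point of `Σ`, determined up to sign. All the conditions below
are insensitive to this sign. -/
noncomputable def mainRadical (g : SymTensor m M) (p : M) : TangentSpace (𝓡 m) p :=
  (mainPair g p).2 p

/-- The form `II (a, b) = □_A B (R)` at a point of `Σ`, for `a b ∈ T_p M`. -/
noncomputable def formII (g : SymTensor m M) (p : M) (a b : TangentSpace (𝓡 m) p) : ℝ :=
  dual g (localExt a) (localExt b) (mainPair g p).2 p

/-- The second fundamental form `H (x, y) = - □_X N (Y)` at a point of `Σ`, for `x y ∈ T_p Σ`. -/
noncomputable def formH (g : SymTensor m M) (p : M) (x y : TangentSpace (𝓡 m) p) : ℝ :=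
  -dual g (localExt x) (mainPair g p).1 (localExt y) p

/-- The canonical screen `S_p = {v ∈ T_p Σ : H (v, R) = 0}`. -/
def IsScreen (g : SymTensor m M) (p : M) (v : TangentSpace (𝓡 m) p) : Prop :=
  IsTangent g p v ∧ formH g p v (mainRadical g p) = 0

/-- The normal component `ν (a) = ⟨a, N⟩`. -/
noncomputable def nu (g : SymTensor m M) (p : M) (a : TangentSpace (𝓡 m) p) : ℝ :=
  g.val p a (mainNormal g p)

/-- The radical component `ρ (a) = - H (a - ν (a) N, R)`. -/
noncomputable def rho (g : SymTensor m M) (p : M) (a : TangentSpace (𝓡 m) p) : ℝ :=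
  -formH g p (a - nu g p a • mainNormal g p) (mainRadical g p)

/-- The screen component of `a`, from the decomposition `a = ν (a) N + a^S + ρ (a) R`. -/
noncomputable def screenPart (g : SymTensor m M) (p : M) (a : TangentSpace (𝓡 m) p) :
    TangentSpace (𝓡 m) p :=
  a - nu g p a • mainNormal g p - rho g p a • mainRadical g p

/-- `Σ` is `II`-flat: `II` vanishes on the screen. -/
def IsIIFlat (g : SymTensor m M) : Prop :=
  ∀ p ∈ sing g, ∀ v w : TangentSpace (𝓡 m) p, IsScreen g p v → IsScreen g p w →
    formII g p v w = 0

/-- `Z` is the smooth extension to `U` of the covariant derivative `∇_X Y` on `U \ Σ`. -/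
def IsNablaExt (g : SymTensor m M) (U : Set M) (X Y Z : Field m M) : Prop :=
  SmoothOn U Z ∧ ∀ p ∈ U \ sing g, Z p = nabla g X Y p

/-- `Σ` is `III`-flat: it is `II`-flat and `III (V, W, R) = II (∇_V W, R)` vanishes on `Σ` for all
local fields `V`, `W` that are tangent to the screen along `Σ`. (If `Σ` is `II`-flat, then `∇_V W`
has a smooth extension `Z` across `Σ`, which is unique because `Σ` has empty interior.) -/
def IsIIIFlat (g : SymTensor m M) : Prop :=
  IsIIFlat g ∧
    ∀ (U : Set M) (V W Z : Field m M), IsOpen U → SmoothOn U V → SmoothOn U W →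
      (∀ p ∈ U ∩ sing g, IsScreen g p (V p) ∧ IsScreen g p (W p)) → IsNablaExt g U V W Z →
      ∀ p ∈ U ∩ sing g, formII g p (Z p) (mainRadical g p) = 0

/-! ### Extensions across `Σ` -/

/-- `F` is a smooth function on `U` that extends the function `f`, given outside `Σ`. -/
def IsSmoothExt (g : SymTensor m M) (U : Set M) (f F : M → ℝ) : Prop :=
  ContMDiffOn (𝓡 m) 𝓘(ℝ, ℝ) ∞ F U ∧ ∀ p ∈ U \ sing g, F p = f p

/-- `f ≅ 0`: the function `f`, given outside `Σ`, has a smooth extension to `U`. -/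
def HasGoodLimit (g : SymTensor m M) (U : Set M) (f : M → ℝ) : Prop :=
  ∃ F : M → ℝ, IsSmoothExt g U f F

/-- `⟨R(A, B) C, D⟩` has a smooth extension to `U` which vanishes on `Σ`. -/
def CurvVanishes (g : SymTensor m M) (U : Set M) (A B C D : Field m M) : Prop :=
  ∃ F : M → ℝ, IsSmoothExt g U (curv g A B C D) F ∧ ∀ p ∈ U ∩ sing g, F p = 0

/-- For the vector fields along `Σ ∩ U` given by the restrictions of `A`, `B`, `C`, `D`, the
expression `⟨R(A, B) C, D⟩` is well-defined and equal to `f`: for all smooth extensions to `U` of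
these fields along `Σ`, the curvature function extends smoothly to `U`, with values on `Σ` given
by `f`. -/
def CurvAlongEq (g : SymTensor m M) (U : Set M) (A B C D : Field m M) (f : M → ℝ) : Prop :=
  ∀ A' B' C' D' : Field m M,
    SmoothOn U A' → SmoothOn U B' → SmoothOn U C' → SmoothOn U D' →
    (∀ p ∈ U ∩ sing g, A' p = A p ∧ B' p = B p ∧ C' p = C p ∧ D' p = D p) →
    ∃ F : M → ℝ, IsSmoothExt g U (curv g A' B' C' D') F ∧ ∀ p ∈ U ∩ sing g, F p = f p

/-- `⟨R(A, B) C, D⟩` is well-defined, for vector fields along `Σ ∩ U`: the extended curvature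
functions exist and their restriction to `Σ` does not depend on the extensions. -/
def CurvAlongWellDefined (g : SymTensor m M) (U : Set M) (A B C D : Field m M) : Prop :=
  ∃ f : M → ℝ, CurvAlongEq g U A B C D f

/-- `A` and `B` are smooth on `U`, and along `Σ ∩ U` one has `rank g_{A ∧ B} = 1` and
`R ∈ A ∧ B`. -/
structure DegenerateAlong (g : SymTensor m M) (U : Set M) (A B : Field m M) : Prop where
  smooth_left : SmoothOn U A
  smooth_right : SmoothOn U B
  rank_one : ∀ p ∈ U ∩ sing g, (planeGram g A B p).rank = 1
  radical_mem : ∀ p ∈ U ∩ sing g, mainRadical g p ∈ Submodule.span ℝ {A p, B p}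

/-- `ν (A) = 0 = ν (B)` on `Σ ∩ U`. -/
def NuVanish (g : SymTensor m M) (U : Set M) (A B : Field m M) : Prop :=
  ∀ p ∈ U ∩ sing g, nu g p (A p) = 0 ∧ nu g p (B p) = 0

end SingularMetric

/-! In a chart let G be the matrix of g, τ = det G and K the adjugate, so that GK = KG = τ, and let
Γ denote the Christoffel symbols of the first kind, which are smooth across Σ. Off Σ one has ∇_A B =
D_A B + τ⁻¹ K Γ(A, B), and τ⟨R(A,B)C,D⟩ equals the smooth expression `curvNum` (`curvature_formula`,
`curv_coord`). By Hadamard's lemma (`exists_eq_smul_of_regular`) the curvature extends exactly when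
this numerator vanishes on Σ. Transversality makes the radical a line, spanned by r, with K = κ r ⊗
r on Σ and κ ≠ 0 (`radical_structure`). Since II(a, b) = Γ(a, b, r), the numerator on Σ is, up to a
nonzero factor, II(A,C) II(B,D) − II(B,C) II(A,D) (`curvNum_eq`).

The identity behind most steps is II(v, R) = ν(v) (`christ_radical_radical`): the left side is half
the derivative of G(r, r) along v, which is proportional to dτ(v).

Part (a). The Gram determinant of a degenerate plane vanishes on Σ with nonzero differential
(`fderiv_planeDet_ne_zero`), so the sectional curvature extends if and only if the curvature extends
and is divisible by this determinant, that is, vanishes on Σ. If the curvature extends, II has zero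
determinant on the plane. The plane contains R, with II(R, R) = 0 and II(·, R) = ν, so that
determinant is a nonzero multiple of −ν², and ν vanishes on the plane.

Part (b). II-flatness makes II vanish on all of TΣ, so the numerator vanishes for tangent planes.
Differentiating it transversally gives the value of the curvature on Σ
(`IsSingularMetric.curv_value`), in which only the values of the fields on Σ occur: (3) ⇒ (4).
Conversely, adding τN to the last argument of ⟨R(S,R)S,R⟩ changes the value on Σ by a nonzero
multiple of II(S, S): (4) ⇒ (3). A tangent degenerate plane lies in the span of a screen vector S
and R, because αA + βB = R has no screen part; its value is −H(S, S) times a squared determinant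
(`curv_screen`, `plane_value`). On the other side III(V, W, R) = ⟨∇_V W, N⟩ = H(V, W)
(`formII_nablaExt`). So both (1) and (2) say that Σ is II-flat and H vanishes on the screen. -/

namespace SingularMetric

variable {m : ℕ} {M : Type*} [TopologicalSpace M] [ChartedSpace (EuclideanSpace ℝ (Fin m)) M]

/-! ### Passage to coordinates -/

section Coordinates

local notation "𝔼" => EuclideanSpace ℝ (Fin m)

/-- The coordinate frame of the chart `e`. -/
noncomputable def frame (e : OpenPartialHomeomorph M (EuclideanSpace ℝ (Fin m)))
    (x : EuclideanSpace ℝ (Fin m)) :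
    EuclideanSpace ℝ (Fin m) →L[ℝ] TangentSpace (𝓡 m) (e.symm x) :=
  mfderiv (𝓡 m) (𝓡 m) e.symm x

/-- The coordinate representation of a vector field in the chart `e`. -/
noncomputable def coordField (e : OpenPartialHomeomorph M (EuclideanSpace ℝ (Fin m)))
    (A : Field m M) (x : EuclideanSpace ℝ (Fin m)) : EuclideanSpace ℝ (Fin m) :=
  (frame e x).inverse (A (e.symm x))

/-- The vector field with prescribed components in the chart `e`. -/
noncomputable def ofCoord (e : OpenPartialHomeomorph M (EuclideanSpace ℝ (Fin m)))
    (a : EuclideanSpace ℝ (Fin m) → EuclideanSpace ℝ (Fin m)) : Field m M :=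
  fun p ↦ (mfderiv (𝓡 m) (𝓡 m) e p).inverse (a (e p))

set_option linter.unusedSectionVars false
variable [IsManifold (𝓡 m) ∞ M] {e : OpenPartialHomeomorph M (EuclideanSpace ℝ (Fin m))}

/-- The metric in the chart `e`. -/
noncomputable def coordMetric (g : SymTensor m M)
    (e : OpenPartialHomeomorph M (EuclideanSpace ℝ (Fin m)))
    (x : EuclideanSpace ℝ (Fin m)) :
    EuclideanSpace ℝ (Fin m) →L[ℝ] EuclideanSpace ℝ (Fin m) →L[ℝ] ℝ :=
  let B : EuclideanSpace ℝ (Fin m) →L[ℝ] EuclideanSpace ℝ (Fin m) →L[ℝ] ℝ := g.val (e.symm x)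
  let L : EuclideanSpace ℝ (Fin m) →L[ℝ] EuclideanSpace ℝ (Fin m) := frame e x
  B.bilinearComp L L

lemma coordMetric_apply (g : SymTensor m M)
    (e : OpenPartialHomeomorph M (EuclideanSpace ℝ (Fin m)))
    (x a b : EuclideanSpace ℝ (Fin m)) :
    coordMetric g e x a b = g.val (e.symm x) (frame e x a) (frame e x b) := rfl

lemma coordMetric_symm (g : SymTensor m M)
    (e : OpenPartialHomeomorph M (EuclideanSpace ℝ (Fin m)))
    (x a b : EuclideanSpace ℝ (Fin m)) :
    coordMetric g e x a b = coordMetric g e x b a := g.symm _ _ _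

lemma chart_mdifferentiable (he : e ∈ IsManifold.maximalAtlas (𝓡 m) ∞ M) :
    e.MDifferentiable (𝓡 m) (𝓡 m) :=
  ⟨(contMDiffOn_of_mem_maximalAtlas he).mdifferentiableOn (by simp),
    (contMDiffOn_symm_of_mem_maximalAtlas he).mdifferentiableOn (by simp)⟩

lemma isInvertible_frame (he : e ∈ IsManifold.maximalAtlas (𝓡 m) ∞ M) {x : 𝔼}
    (hx : x ∈ e.target) : (frame e x).IsInvertible := by
  exact ⟨(chart_mdifferentiable he).symm.mfderiv hx, rfl⟩

lemma isInvertible_mfderiv_chart (he : e ∈ IsManifold.maximalAtlas (𝓡 m) ∞ M) {p : M}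
    (hp : p ∈ e.source) : (mfderiv (𝓡 m) (𝓡 m) e p).IsInvertible :=
  ⟨(chart_mdifferentiable he).mfderiv hp, rfl⟩

lemma frame_coordField (he : e ∈ IsManifold.maximalAtlas (𝓡 m) ∞ M) (A : Field m M) {x : 𝔼}
    (hx : x ∈ e.target) : frame e x (coordField e A x) = A (e.symm x) :=
  (isInvertible_frame he hx).self_apply_inverse _

lemma frame_injective (he : e ∈ IsManifold.maximalAtlas (𝓡 m) ∞ M) {x : 𝔼}
    (hx : x ∈ e.target) : Function.Injective (frame e x) :=
  (chart_mdifferentiable he).symm.mfderiv_injective hx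

lemma frame_surjective (he : e ∈ IsManifold.maximalAtlas (𝓡 m) ∞ M) {x : 𝔼}
    (hx : x ∈ e.target) : Function.Surjective (frame e x) :=
  (chart_mdifferentiable he).symm.mfderiv_surjective hx

lemma coordMetric_coordField (g : SymTensor m M) (he : e ∈ IsManifold.maximalAtlas (𝓡 m) ∞ M)
    (A B : Field m M) {x : 𝔼} (hx : x ∈ e.target) :
    coordMetric g e x (coordField e A x) (coordField e B x) =
      g.val (e.symm x) (A (e.symm x)) (B (e.symm x)) := by
  rw [coordMetric_apply, frame_coordField he A hx, frame_coordField he B hx]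

lemma mfderiv_chart_frame (he : e ∈ IsManifold.maximalAtlas (𝓡 m) ∞ M) {x : 𝔼}
    (hx : x ∈ e.target) (a : 𝔼) :
    mfderiv (𝓡 m) (𝓡 m) e (e.symm x) (frame e x a) = a := by
  have h := (chart_mdifferentiable he).comp_symm_deriv hx
  have := congrArg (fun L ↦ L a) h
  simpa [frame] using! this

lemma coordField_ofCoord (he : e ∈ IsManifold.maximalAtlas (𝓡 m) ∞ M) (a : 𝔼 → 𝔼) {x : 𝔼}
    (hx : x ∈ e.target) : coordField e (ofCoord e a) x = a x := by
  apply frame_injective he hx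
  rw [frame_coordField he _ hx]
  have hp : e.symm x ∈ e.source := e.map_target hx
  apply (chart_mdifferentiable he).mfderiv_injective hp
  rw [mfderiv_chart_frame he hx, ofCoord]
  have := (isInvertible_mfderiv_chart he hp).self_apply_inverse (a (e (e.symm x)))
  rw [e.right_inv hx] at this
  simpa [e.right_inv hx] using! this

lemma coordField_congr {A B : Field m M} {x : 𝔼} (h : A (e.symm x) = B (e.symm x)) :
    coordField e A x = coordField e B x := by
  simp only [coordField, h]

lemma coordField_smoothAt (he : e ∈ IsManifold.maximalAtlas (𝓡 m) ∞ M) {A : Field m M} {x : 𝔼}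
    (hx : x ∈ e.target)
    (hA : ContMDiffAt (𝓡 m) (𝓡 m).tangent ∞
      (fun p ↦ (⟨p, A p⟩ : TangentBundle (𝓡 m) M)) (e.symm x)) :
    ContDiffAt ℝ ∞ (coordField e A) x := by
  have : IsManifold (𝓡 m) 1 M := IsManifold.of_le (n := ∞) (by simp)
  refine contMDiffAt_vectorSpace_iff_contDiffAt.1 ?_
  exact hA.mpullback_vectorField_preimage
    ((contMDiffOn_symm_of_mem_maximalAtlas he).contMDiffAt (e.open_target.mem_nhds hx))
    (isInvertible_frame he hx) (by simp)

lemma ofCoord_smoothAt (he : e ∈ IsManifold.maximalAtlas (𝓡 m) ∞ M) {a : 𝔼 → 𝔼} {p : M}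
    (hp : p ∈ e.source) (ha : ContDiffAt ℝ ∞ a (e p)) :
    ContMDiffAt (𝓡 m) (𝓡 m).tangent ∞
      (fun p ↦ (⟨p, ofCoord e a p⟩ : TangentBundle (𝓡 m) M)) p := by
  have : IsManifold (𝓡 m) 1 M := IsManifold.of_le (n := ∞) (by simp)
  exact (contMDiffAt_vectorSpace_iff_contDiffAt.2 ha).mpullback_vectorField_preimage
    ((contMDiffOn_of_mem_maximalAtlas he).contMDiffAt (e.open_source.mem_nhds hp))
    (isInvertible_mfderiv_chart he hp) (by simp)

/-- `coordField e` is the pullback of vector fields along `e.symm`, and pullback commutes with the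
Lie bracket. -/
lemma coordField_mlieBracket (he : e ∈ IsManifold.maximalAtlas (𝓡 m) ∞ M) {A B : Field m M}
    {x : 𝔼} (hx : x ∈ e.target)
    (hA : ContMDiffAt (𝓡 m) (𝓡 m).tangent ∞
      (fun p ↦ (⟨p, A p⟩ : TangentBundle (𝓡 m) M)) (e.symm x))
    (hB : ContMDiffAt (𝓡 m) (𝓡 m).tangent ∞
      (fun p ↦ (⟨p, B p⟩ : TangentBundle (𝓡 m) M)) (e.symm x)) :
    coordField e (VectorField.mlieBracket (𝓡 m) A B) x =
      fderiv ℝ (coordField e B) x (coordField e A x) -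
        fderiv ℝ (coordField e A) x (coordField e B x) := by
  have h2 : minSmoothness ℝ 2 ≤ ∞ := by
    rw [minSmoothness_of_isRCLikeNormedField]
    exact WithTop.coe_le_coe.2 (le_top : (2 : ℕ∞) ≤ ⊤)
  have : IsManifold (𝓡 m) (minSmoothness ℝ 2) M := IsManifold.of_le (n := ∞) h2
  have h := VectorField.mpullback_mlieBracket (I := 𝓡 m) (I' := 𝓡 m) (f := e.symm) (x₀ := x)
    (n := ∞) (hA.mdifferentiableAt (by simp)) (hB.mdifferentiableAt (by simp))
    ((contMDiffOn_symm_of_mem_maximalAtlas he).contMDiffAt (e.open_target.mem_nhds hx)) h2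
  refine h.trans ?_
  rw [← VectorField.mlieBracketWithin_univ, VectorField.mlieBracketWithin_eq_lieBracketWithin]
  exact congrFun (VectorField.lieBracketWithin_univ (𝕜 := ℝ) (V := coordField e A)
    (W := coordField e B)) x

/-- In finite dimension it suffices to test on constant vectors. These are the components of the
smooth fields `ofCoord`, so the bundle smoothness of `g` applies. -/
lemma coordMetric_smoothOn (g : SymTensor m M) (he : e ∈ IsManifold.maximalAtlas (𝓡 m) ∞ M) :
    ContDiffOn ℝ ∞ (coordMetric g e) e.target := by
  refine contDiffOn_clm_apply.2 fun a ↦ contDiffOn_clm_apply.2 fun b ↦ fun x hx ↦ ?_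
  apply ContDiffAt.contDiffWithinAt
  rw [← contMDiffAt_iff_contDiffAt]
  have hp : e.symm x ∈ e.source := e.map_target hx
  have ha := ofCoord_smoothAt he hp (a := fun _ ↦ a) contDiffAt_const
  have hb := ofCoord_smoothAt he hp (a := fun _ ↦ b) contDiffAt_const
  have hg := g.smooth (e.symm x)
  have H : ContMDiffAt (𝓡 m) 𝓘(ℝ, ℝ) ∞
      (fun q ↦ g.val q (ofCoord e (fun _ ↦ a) q) (ofCoord e (fun _ ↦ b) q)) (e.symm x) := by
    have := ContMDiffAt.clm_bundle_apply₂ (F₁ := 𝔼) (F₂ := 𝔼) (F₃ := ℝ)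
      (E₁ := TangentSpace (𝓡 m)) (E₂ := TangentSpace (𝓡 m)) (E₃ := Bundle.Trivial M ℝ)
      (b := fun q : M ↦ q) (ψ := g.val) hg ha hb
    rw [Bundle.contMDiffAt_totalSpace] at this
    simpa using! this.2
  have hs := (contMDiffOn_symm_of_mem_maximalAtlas he).contMDiffAt (e.open_target.mem_nhds hx)
  refine (H.comp x hs).congr_of_eventuallyEq ?_
  filter_upwards [e.open_target.mem_nhds hx] with y hy
  rw [Function.comp_apply, ← coordMetric_coordField g he _ _ hy, coordField_ofCoord he _ hy,
    coordField_ofCoord he _ hy]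

lemma mvfderiv_frame (he : e ∈ IsManifold.maximalAtlas (𝓡 m) ∞ M) {f : M → ℝ} {x : 𝔼}
    (hx : x ∈ e.target) (hf : MDifferentiableAt (𝓡 m) 𝓘(ℝ, ℝ) f (e.symm x)) (a : 𝔼) :
    mvfderiv (𝓡 m) f (e.symm x) (frame e x a) = fderiv ℝ (f ∘ e.symm) x a := by
  have := mvfderiv_comp_apply (I := 𝓡 m) (I' := 𝓡 m) (f := e.symm) (g := f) x hf
    ((chart_mdifferentiable he).mdifferentiableAt_symm hx) a
  refine this.symm.trans ?_
  simp only [mvfderiv, mfderiv_eq_fderiv]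
  rfl

end Coordinates

end SingularMetric

namespace SingularMetric

/-! ### Smooth division -/

section Division

open MeasureTheory

universe u

/-- Induction on the order, by differentiation under the integral sign. The target `F` varies in the
induction, since the derivative takes values in `E →L[ℝ] F`; this is why `E` and `F` share a
universe. -/
lemma contDiff_nat_intervalIntegral {E : Type u} [NormedAddCommGroup E] [NormedSpace ℝ E]
    [FiniteDimensional ℝ E] (n : ℕ) : ∀ {F : Type u} [NormedAddCommGroup F] [NormedSpace ℝ F]
    [CompleteSpace F] {f : E → ℝ → F}, ContDiff ℝ ∞ (fun z : E × ℝ ↦ f z.1 z.2) →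
    ContDiff ℝ n (fun y ↦ ∫ t in (0 : ℝ)..1, f y t) := by
  have := FiniteDimensional.proper_real E
  have key : ∀ {F : Type u} [NormedAddCommGroup F] [NormedSpace ℝ F] [CompleteSpace F]
      {f : E → ℝ → F}, ContDiff ℝ ∞ (fun z : E × ℝ ↦ f z.1 z.2) →
      ContDiff ℝ ∞ (fun z : E × ℝ ↦ fderiv ℝ (fun y ↦ f y z.2) z.1) ∧ ∀ x,
      HasFDerivAt (fun y ↦ ∫ t in (0 : ℝ)..1, f y t)
        (∫ t in (0 : ℝ)..1, fderiv ℝ (fun y ↦ f y t) x) x := by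
    intro F _ _ _ f hf
    have hd : ∀ z : E × ℝ, HasFDerivAt (fun y ↦ f y z.2)
        ((fderiv ℝ (fun z : E × ℝ ↦ f z.1 z.2) z).comp (ContinuousLinearMap.inl ℝ E ℝ)) z.1 := by
      intro z
      have h1 := (hf.differentiable (by simp) z).hasFDerivAt
      exact HasFDerivAt.comp (f := fun y ↦ (y, z.2)) z.1 h1 (hasFDerivAt_prodMk_left z.1 z.2)
    have hs : ContDiff ℝ ∞ (fun z : E × ℝ ↦ fderiv ℝ (fun y ↦ f y z.2) z.1) := by
      have : (fun z : E × ℝ ↦ fderiv ℝ (fun y ↦ f y z.2) z.1) = fun z ↦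
          (fderiv ℝ (fun z : E × ℝ ↦ f z.1 z.2) z).comp (ContinuousLinearMap.inl ℝ E ℝ) :=
        funext fun z ↦ (hd z).fderiv
      rw [this]
      exact (hf.fderiv_right (by simp)).clm_comp contDiff_const
    refine ⟨hs, fun x ↦ ?_⟩
    -- The maximum over the compact set `closedBall x 1 × [0, 1]` serves as the dominating constant.
    obtain ⟨C, hC⟩ := ((isCompact_closedBall x 1).prod (isCompact_Icc (a := (0 : ℝ)) (b := 1))
      ).exists_bound_of_continuousOn hs.continuous.continuousOn
    have hc : ∀ y, Continuous (f y) := fun y ↦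
      hf.continuous.comp (Continuous.prodMk_right y)
    have hc' : ∀ y, Continuous fun t ↦ fderiv ℝ (fun y ↦ f y t) y := fun y ↦
      hs.continuous.comp (Continuous.prodMk_right y)
    refine intervalIntegral.hasFDerivAt_integral_of_dominated_of_fderiv_le
      (F := f) (F' := fun y t ↦ fderiv ℝ (fun y ↦ f y t) y) (bound := fun _ ↦ C)
      (Metric.closedBall_mem_nhds x one_pos) (.of_forall fun y ↦ (hc y).aestronglyMeasurable)
      ((hc x).intervalIntegrable _ _) (hc' x).aestronglyMeasurable
      (.of_forall fun t ht y hy ↦ hC (y, t) ⟨hy, ?_⟩) (by simp)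
      (.of_forall fun t _ y _ ↦ (hd (y, t)).differentiableAt.hasFDerivAt)
    rw [Set.uIoc_of_le zero_le_one] at ht
    exact ⟨ht.1.le, ht.2⟩
  induction n with
  | zero =>
    intro F _ _ _ f hf
    rw [Nat.cast_zero, contDiff_zero]
    exact continuous_iff_continuousAt.2 fun x ↦ ((key hf).2 x).continuousAt
  | succ n ih =>
    intro F _ _ _ f hf
    rw [Nat.cast_succ, contDiff_succ_iff_hasFDerivAt]
    exact ⟨_, ih (key hf).1, (key hf).2⟩

/-- Smooth dependence of an integral on parameters. -/
lemma contDiff_intervalIntegral {E F : Type u} [NormedAddCommGroup E] [NormedSpace ℝ E]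
    [FiniteDimensional ℝ E] [NormedAddCommGroup F] [NormedSpace ℝ F]
    [CompleteSpace F] {f : E → ℝ → F} (hf : ContDiff ℝ ∞ (fun z : E × ℝ ↦ f z.1 z.2)) :
    ContDiff ℝ ∞ (fun y ↦ ∫ t in (0 : ℝ)..1, f y t) :=
  contDiff_infty.2 fun n ↦ contDiff_nat_intervalIntegral n hf

/-- Hadamard's lemma for a linear form. -/
lemma exists_eq_smul_of_linear {E F : Type u} [NormedAddCommGroup E] [NormedSpace ℝ E]
    [FiniteDimensional ℝ E] [NormedAddCommGroup F] [NormedSpace ℝ F] [CompleteSpace F]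
    {f : E → F} (hf : ContDiff ℝ ∞ f) (l : E →L[ℝ] ℝ) (hl : l ≠ 0)
    (h0 : ∀ y, l y = 0 → f y = 0) :
    ∃ h : E → F, ContDiff ℝ ∞ h ∧ ∀ y, f y = l y • h y := by
  obtain ⟨v, hv⟩ : ∃ v, l v = 1 := by
    obtain ⟨w, hw⟩ : ∃ w, l w ≠ 0 := by
      by_contra! h
      exact hl (ContinuousLinearMap.ext h)
    exact ⟨(l w)⁻¹ • w, by simp [hw]⟩
  -- The segment from the projection of `y` to the kernel of `l` along `v`, where `f` vanishes, to
  -- `y`. Integrating the derivative of `f` along it produces the factor `l y`.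
  let γ : E → ℝ → E := fun y t ↦ y - l y • v + t • l y • v
  have hγ : ContDiff ℝ ∞ (fun z : E × ℝ ↦ γ z.1 z.2) := by fun_prop
  have hfd : ContDiff ℝ ∞ (fun z : E × ℝ ↦ fderiv ℝ f (γ z.1 z.2) v) :=
    (((hf.fderiv_right (m := ∞) (by simp)).comp hγ)).clm_apply contDiff_const
  refine ⟨fun y ↦ ∫ t in (0 : ℝ)..1, fderiv ℝ f (γ y t) v, contDiff_intervalIntegral hfd,
    fun y ↦ ?_⟩
  have hd : ∀ t ∈ Set.uIcc (0 : ℝ) 1, HasDerivAt (fun t ↦ f (γ y t))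
      (l y • fderiv ℝ f (γ y t) v) t := by
    intro t _
    have h1 : HasDerivAt (γ y) (l y • v) t := by
      simpa [γ] using ((hasDerivAt_id t).smul_const (l y • v)).const_add (y - l y • v)
    rw [← map_smul]
    exact (hf.differentiable (by simp) (γ y t)).hasFDerivAt.comp_hasDerivAt t h1
  have hc : Continuous fun t ↦ fderiv ℝ f (γ y t) v :=
    hfd.continuous.comp (Continuous.prodMk_right y)
  have := intervalIntegral.integral_eq_sub_of_hasDerivAt hd
    ((hc.const_smul (l y)).intervalIntegrable _ _)
  rw [intervalIntegral.integral_smul] at this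
  rw [this, h0 (γ y 0) (by simp [γ, hv]), sub_zero]
  simp [γ]

/-- Hadamard's lemma: a smooth function that vanishes on a regular hypersurface `{τ = 0}` is
locally a smooth multiple of `τ`. -/
lemma exists_eq_smul_of_regular {E F : Type u} [NormedAddCommGroup E] [NormedSpace ℝ E]
    [FiniteDimensional ℝ E] [NormedAddCommGroup F] [NormedSpace ℝ F] [CompleteSpace F]
    {U : Set E} (hU : IsOpen U) {x₀ : E} (hx₀ : x₀ ∈ U) {f : E → F} (hf : ContDiffOn ℝ ∞ f U)
    {τ : E → ℝ} (hτ : ContDiffOn ℝ ∞ τ U) (hτ0 : τ x₀ = 0) (hdτ : fderiv ℝ τ x₀ ≠ 0)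
    (h0 : ∀ y ∈ U, τ y = 0 → f y = 0) :
    ∃ W ⊆ U, IsOpen W ∧ x₀ ∈ W ∧ ∃ h : E → F, ContDiffOn ℝ ∞ h W ∧ ∀ y ∈ W, f y = τ y • h y := by
  have := FiniteDimensional.complete ℝ E
  set l := fderiv ℝ τ x₀ with hl
  obtain ⟨v, hv⟩ : ∃ v, l v = 1 := by
    obtain ⟨w, hw⟩ : ∃ w, l w ≠ 0 := by
      by_contra! h
      exact hdτ (ContinuousLinearMap.ext h)
    exact ⟨(l w)⁻¹ • w, by simp [hw]⟩
  -- A straightening map: `l ∘ Ψ = τ` and the derivative at `x₀` is the identity, so locally `Ψ`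
  -- carries `{τ = 0}` to the hyperplane `l = 0`.
  let Ψ : E → E := fun x ↦ x - x₀ + (τ x - l (x - x₀)) • v
  have hlΨ : ∀ x, l (Ψ x) = τ x := fun x ↦ by simp [Ψ, hv]
  have hΨ : ContDiffOn ℝ ∞ Ψ U := by
    have : ContDiff ℝ ∞ (fun x ↦ l (x - x₀)) := by fun_prop
    exact (contDiffOn_id.sub contDiffOn_const).add
      ((hτ.sub this.contDiffOn).smul contDiffOn_const)
  have hΨ' : ∀ x ∈ U, ContDiffAt ℝ ∞ Ψ x := fun x hx ↦ hΨ.contDiffAt (hU.mem_nhds hx)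
  have hder : HasFDerivAt Ψ ((ContinuousLinearEquiv.refl ℝ E : E ≃L[ℝ] E) : E →L[ℝ] E) x₀ := by
    have h1 : HasFDerivAt τ l x₀ :=
      ((hτ.contDiffAt (hU.mem_nhds hx₀)).differentiableAt (by simp)).hasFDerivAt
    have h2 : HasFDerivAt (fun x ↦ l (x - x₀)) l x₀ :=
      l.hasFDerivAt.comp x₀ ((hasFDerivAt_id x₀).sub_const x₀)
    refine (((hasFDerivAt_id x₀).sub_const x₀).add ((h1.sub h2).smul_const v)).congr_fderiv ?_
    ext; simp
  let Φ := (hΨ' x₀ hx₀).toOpenPartialHomeomorph Ψ hder (by simp)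
  have hΦ : (Φ : E → E) = Ψ := rfl
  have hxΦ : x₀ ∈ Φ.source := (hΨ' x₀ hx₀).mem_toOpenPartialHomeomorph_source hder (by simp)
  have hΨ0 : Ψ x₀ = 0 := by simp [Ψ, hτ0]
  -- near the base point the derivative is invertible
  have hinv : ∀ᶠ x in 𝓝 x₀, fderiv ℝ Ψ x ∈
      Set.range ((↑) : (E ≃L[ℝ] E) → E →L[ℝ] E) := by
    have hc : ContinuousAt (fderiv ℝ Ψ) x₀ :=
      ((hΨ' x₀ hx₀).fderiv_right (m := ∞) (by simp)).continuousAt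
    apply hc.eventually
    rw [hder.fderiv]
    exact ContinuousLinearEquiv.nhds _
  obtain ⟨W₁, hW₁, hW₁o, hxW₁⟩ := eventually_nhds_iff.1
    (hinv.and ((hU.eventually_mem hx₀).and (Φ.open_source.eventually_mem hxΦ)))
  have hW₁U : W₁ ⊆ U := fun x hx ↦ (hW₁ x hx).2.1
  -- the image of this neighborhood
  have hVo : IsOpen (Φ.symm.source ∩ Φ.symm ⁻¹' W₁) := Φ.symm.isOpen_inter_preimage hW₁o
  set V := Φ.symm.source ∩ Φ.symm ⁻¹' W₁ with hV
  have hsymm : ContDiffOn ℝ ∞ Φ.symm V := by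
    intro y hy
    obtain ⟨L, hL⟩ := (hW₁ _ hy.2).1
    refine (Φ.contDiffAt_symm hy.1 (f₀' := L) ?_ (hΨ' _ (hW₁U hy.2))).contDiffWithinAt
    rw [hL]
    exact ((hΨ' _ (hW₁U hy.2)).differentiableAt (by simp)).hasFDerivAt
  have h0V : (0 : E) ∈ V := by
    have h1 : Φ x₀ = 0 := hΨ0
    have h2 : Φ.symm 0 = x₀ := by rw [← h1, Φ.left_inv hxΦ]
    refine ⟨?_, ?_⟩
    · rw [← h1]; exact Φ.map_source hxΦ
    · rw [Set.mem_preimage, h2]; exact hxW₁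
  obtain ⟨ε, hε, hεV⟩ := Metric.isOpen_iff.1 hVo 0 h0V
  -- The cutoff makes the transported function smooth on all of `E`, as the linear case requires; it
  -- equals 1 near 0, so nothing changes there.
  let χ : ContDiffBump (0 : E) := ⟨ε / 4, ε / 2, by positivity, by linarith⟩
  have hχs : tsupport χ ⊆ V := by
    rw [χ.tsupport_eq]
    exact (Metric.closedBall_subset_ball (by simp only [χ]; linarith)).trans hεV
  have hfs : ContDiffOn ℝ ∞ (fun y ↦ f (Φ.symm y)) V :=
    hf.comp hsymm fun y hy ↦ hW₁U hy.2
  have hF : ContDiff ℝ ∞ (fun y ↦ χ y • f (Φ.symm y)) := by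
    rw [contDiff_iff_contDiffAt]
    intro y
    by_cases hy : y ∈ V
    · exact (χ.contDiff.contDiffAt).smul (hfs.contDiffAt (hVo.mem_nhds hy))
    · have : (fun y ↦ χ y • f (Φ.symm y)) =ᶠ[𝓝 y] fun _ ↦ 0 := by
        have := notMem_tsupport_iff_eventuallyEq.1 (fun h ↦ hy (hχs h))
        filter_upwards [this] with z hz
        simp [hz]
      exact contDiffAt_const.congr_of_eventuallyEq this
  obtain ⟨h, hh, hfh⟩ := exists_eq_smul_of_linear hF l hdτ (by
    intro y hy
    by_cases hyV : y ∈ V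
    · have : f (Φ.symm y) = 0 := by
        apply h0 _ (hW₁U hyV.2)
        rw [← hlΨ, ← hΦ, Φ.right_inv hyV.1, hy]
      simp [this]
    · have : χ y = 0 := image_eq_zero_of_notMem_tsupport fun h ↦ hyV (hχs h)
      simp [this])
  refine ⟨W₁ ∩ Ψ ⁻¹' Metric.ball 0 (ε / 4), fun x hx ↦ hW₁U hx.1,
    (hΨ.mono hW₁U).continuousOn.isOpen_inter_preimage hW₁o Metric.isOpen_ball,
    ⟨hxW₁, by simp [hΨ0, hε]⟩, fun x ↦ h (Ψ x), ?_, ?_⟩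
  · exact hh.comp_contDiffOn (hΨ.mono fun x hx ↦ hW₁U hx.1)
  · intro x hx
    have h1 : χ (Ψ x) = 1 := χ.one_of_mem_closedBall (Metric.ball_subset_closedBall hx.2)
    have h2 : Φ.symm (Ψ x) = x := by
      rw [← hΦ]; exact Φ.left_inv (hW₁ x hx.1).2.2
    have := hfh (Ψ x)
    simpa [h1, h2, hlΨ] using this

end Division

end SingularMetric

namespace SingularMetric

/-! ### Determinants and cofactors -/

section Determinant

variable {m : ℕ}

/-- Jacobi's formula. The determinant is multilinear in the rows, so its derivative is a sum of
determinants with one row replaced, each expanded along that row. -/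
lemma hasFDerivAt_det {n : Type*} [Fintype n] [DecidableEq n] (A : Matrix n n ℝ) :
    ∃ L : (n → n → ℝ) →L[ℝ] ℝ, HasFDerivAt (fun B : n → n → ℝ ↦ Matrix.det (Matrix.of B)) L A ∧
      ∀ H : n → n → ℝ, L H = ∑ i, ∑ j, H i j * A.adjugate j i := by
  let f : ContinuousMultilinearMap ℝ (fun _ : n ↦ n → ℝ) ℝ :=
    ⟨Matrix.detRowAlternating.toMultilinearMap, Continuous.matrix_det continuous_id⟩
  refine ⟨f.linearDeriv A, f.hasFDerivAt A, fun H ↦ ?_⟩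
  refine (ContinuousMultilinearMap.linearDeriv_apply f (show n → n → ℝ from A) H).trans ?_
  refine Finset.sum_congr rfl fun i _ ↦ ?_
  have h := Matrix.det_eq_sum_mul_adjugate_row (A.updateRow i (H i)) i
  refine Eq.trans (b := (A.updateRow i (H i)).det) rfl (h.trans ?_)
  refine Finset.sum_congr rfl fun j _ ↦ ?_
  rw [Matrix.adjugate_apply, Matrix.adjugate_apply, Matrix.updateRow_idem, Matrix.updateRow_self]

/-- The Gram matrix of a bilinear form in the standard basis. -/
noncomputable def gram
    (G : EuclideanSpace ℝ (Fin m) →L[ℝ] EuclideanSpace ℝ (Fin m) →L[ℝ] ℝ) :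
    Matrix (Fin m) (Fin m) ℝ :=
  Matrix.of fun a b ↦ G (EuclideanSpace.single a 1) (EuclideanSpace.single b 1)

/-- The cofactor map of a bilinear form `G`: it is `det G` times the inverse of `G`. -/
noncomputable def cof
    (G : EuclideanSpace ℝ (Fin m) →L[ℝ] EuclideanSpace ℝ (Fin m) →L[ℝ] ℝ) :
    (EuclideanSpace ℝ (Fin m) →L[ℝ] ℝ) →L[ℝ] EuclideanSpace ℝ (Fin m) :=
  ∑ k, ∑ l, (gram G).adjugate k l • (ContinuousLinearMap.apply ℝ ℝ
    (EuclideanSpace.single l (1 : ℝ))).smulRight (EuclideanSpace.single k (1 : ℝ))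

local notation "𝔼" => EuclideanSpace ℝ (Fin m)

lemma eq_sum_single (v : 𝔼) : v = ∑ k, v k • EuclideanSpace.single k (1 : ℝ) := by
  have := (EuclideanSpace.basisFun (Fin m) ℝ).sum_repr v
  simpa using this.symm

lemma form_eq_sum (B : 𝔼 →L[ℝ] 𝔼 →L[ℝ] ℝ) (v w : 𝔼) :
    B v w = ∑ k, ∑ l, v k * w l * gram B k l := by
  conv_lhs => rw [eq_sum_single v, eq_sum_single w]
  simp only [map_sum, map_smul, FunLike.coe_sum, Finset.sum_apply,
    FunLike.coe_smul, Pi.smul_apply, smul_eq_mul, Finset.mul_sum, gram,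
    Matrix.of_apply]
  rw [Finset.sum_comm]
  exact Finset.sum_congr rfl fun k _ ↦ Finset.sum_congr rfl fun l _ ↦ by ring

lemma cof_apply (G : 𝔼 →L[ℝ] 𝔼 →L[ℝ] ℝ) (α : 𝔼 →L[ℝ] ℝ) (k : Fin m) :
    cof G α k = ∑ l, (gram G).adjugate k l * α (EuclideanSpace.single l 1) := by
  simp [cof, Finset.sum_apply, Pi.single_apply]

lemma gram_transpose {G : 𝔼 →L[ℝ] 𝔼 →L[ℝ] ℝ} (hG : ∀ v w, G v w = G w v) :
    (gram G).transpose = gram G := by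
  ext a b
  simp [gram, hG (EuclideanSpace.single b 1)]

lemma clm_ext_single {α β : 𝔼 →L[ℝ] ℝ}
    (h : ∀ k, α (EuclideanSpace.single k 1) = β (EuclideanSpace.single k 1)) : α = β := by
  ext v
  rw [eq_sum_single v]
  simp [h]

lemma clm_eq_sum (α : 𝔼 →L[ℝ] ℝ) (v : 𝔼) : α v = ∑ k, v k * α (EuclideanSpace.single k 1) := by
  conv_lhs => rw [eq_sum_single v]
  simp

lemma adjugate_symm {G : 𝔼 →L[ℝ] 𝔼 →L[ℝ] ℝ} (hG : ∀ v w, G v w = G w v) (k l : Fin m) :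
    (gram G).adjugate k l = (gram G).adjugate l k := by
  have := Matrix.adjugate_transpose (gram G)
  rw [gram_transpose hG] at this
  exact (congrFun (congrFun this k) l).symm.trans rfl

lemma apply_cof_comm {G : 𝔼 →L[ℝ] 𝔼 →L[ℝ] ℝ} (hG : ∀ v w, G v w = G w v) (α β : 𝔼 →L[ℝ] ℝ) :
    β (cof G α) = α (cof G β) := by
  rw [clm_eq_sum β, clm_eq_sum α]
  simp only [cof_apply, Finset.sum_mul]
  rw [Finset.sum_comm]
  refine Finset.sum_congr rfl fun k _ ↦ Finset.sum_congr rfl fun l _ ↦ ?_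
  rw [adjugate_symm hG]
  ring

lemma cof_self (G : 𝔼 →L[ℝ] 𝔼 →L[ℝ] ℝ) (hG : ∀ v w, G v w = G w v) (v : 𝔼) :
    cof G (G v) = (gram G).det • v := by
  ext k
  rw [cof_apply]
  have h := Matrix.adjugate_mul (gram G)
  calc ∑ l, (gram G).adjugate k l * G v (EuclideanSpace.single l 1)
      = ∑ l, (gram G).adjugate k l * ∑ a, gram G l a * v a := by
        refine Finset.sum_congr rfl fun l _ ↦ ?_
        rw [hG, clm_eq_sum (G (EuclideanSpace.single l 1)) v]
        simp [gram, mul_comm]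
    _ = (((gram G).adjugate * gram G).mulVec v) k := by
        rw [← Matrix.mulVec_mulVec]
        rfl
    _ = _ := by
        rw [h, Matrix.smul_mulVec, Matrix.one_mulVec]
        rfl

lemma self_cof (G : 𝔼 →L[ℝ] 𝔼 →L[ℝ] ℝ) (hG : ∀ v w, G v w = G w v) (α : 𝔼 →L[ℝ] ℝ) :
    G (cof G α) = (gram G).det • α := by
  ext v
  rw [hG, apply_cof_comm hG α (G v), cof_self G hG]
  simp

lemma det_gram_ne_zero_iff {G : 𝔼 →L[ℝ] 𝔼 →L[ℝ] ℝ} (hG : ∀ v w, G v w = G w v) :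
    (gram G).det ≠ 0 ↔ ∀ v, G v = 0 → v = 0 := by
  constructor
  · intro h v hv
    have := cof_self G hG v
    rw [hv, map_zero] at this
    exact (smul_eq_zero.1 this.symm).resolve_left h
  · intro h h0
    obtain ⟨v, hv, hv0⟩ := Matrix.exists_mulVec_eq_zero_iff.2 h0
    refine hv (congrArg WithLp.ofLp (h (WithLp.toLp 2 v) (clm_ext_single fun k ↦ ?_)))
    rw [hG, clm_eq_sum]
    have := congrFun hv0 k
    simp only [Matrix.mulVec, dotProduct, Pi.zero_apply] at this
    simpa [gram, mul_comm] using this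

/-- The structure of a bilinear form at a regular zero of its determinant. -/
lemma radical_structure {G : 𝔼 → 𝔼 →L[ℝ] 𝔼 →L[ℝ] ℝ} {x : 𝔼} (hG : ∀ v w, G x v w = G x w v)
    (hd : DifferentiableAt ℝ G x) (h0 : (gram (G x)).det = 0)
    (hτ : fderiv ℝ (fun y ↦ (gram (G y)).det) x ≠ 0) {r : 𝔼} (hr : r ≠ 0) (hGr : G x r = 0) :
    ∃ κ ≠ 0, (∀ α, cof (G x) α = (κ * α r) • r) ∧
      (∀ v, fderiv ℝ (fun y ↦ (gram (G y)).det) x v = κ * fderiv ℝ G x v r r) ∧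
      ∀ s, G x s = 0 → ∃ c : ℝ, s = c • r := by
  obtain ⟨L, hL, hLH⟩ := hasFDerivAt_det (gram (G x))
  have hJ : ∀ v, fderiv ℝ (fun y ↦ (gram (G y)).det) x v =
      ∑ i, ∑ j, gram (fderiv ℝ G x v) i j * (gram (G x)).adjugate j i := by
    intro v
    have h1 : HasFDerivAt (fun y ↦ (fun i j ↦ gram (G y) i j : Fin m → Fin m → ℝ))
        (ContinuousLinearMap.pi fun i ↦ ContinuousLinearMap.pi fun j ↦
          ((fderiv ℝ G x).flip (EuclideanSpace.single i 1)).flip (EuclideanSpace.single j 1)) x := by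
      refine hasFDerivAt_pi.2 fun i ↦ hasFDerivAt_pi.2 fun j ↦ ?_
      have := (hd.hasFDerivAt.clm_apply (hasFDerivAt_const (EuclideanSpace.single i (1 : ℝ)) x)
        ).clm_apply (hasFDerivAt_const (EuclideanSpace.single j (1 : ℝ)) x)
      refine this.congr_fderiv ?_
      ext w
      simp
    have h2 := HasFDerivAt.comp (g := fun B : Fin m → Fin m → ℝ ↦ Matrix.det (Matrix.of B)) x hL h1
    have h3 : fderiv ℝ (fun y ↦ (gram (G y)).det) x = _ := h2.fderiv
    rw [h3, ContinuousLinearMap.comp_apply, hLH]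
    rfl
  -- By Jacobi's formula a vanishing adjugate would give a vanishing differential of the
  -- determinant.
  obtain ⟨i, j, hij⟩ : ∃ i j, (gram (G x)).adjugate i j ≠ 0 := by
    by_contra! h
    exact hτ (ContinuousLinearMap.ext fun v ↦ by simp [hJ, h])
  -- The adjugate entry at `(i, j)` is the determinant of the Gram matrix with row `j` replaced by
  -- the `i`-th basis vector. This invertible matrix annihilates every radical vector whose `i`-th
  -- coordinate is 0; hence the radical is a line.
  have hker : ∀ s : 𝔼, G x s = 0 → s i = 0 → s = 0 := by
    intro s hs hsi
    rw [Matrix.adjugate_apply] at hij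
    have := Matrix.eq_zero_of_mulVec_eq_zero hij (v := s.ofLp) (by
      ext k
      rw [Matrix.mulVec, Pi.zero_apply]
      by_cases hk : k = j
      · subst hk
        rw [Matrix.updateRow_self, single_dotProduct, one_mul]
        exact hsi
      · rw [Matrix.updateRow_ne hk]
        have h : G x (EuclideanSpace.single k 1) s = 0 := by rw [hG, hs]; rfl
        rw [clm_eq_sum] at h
        rw [← h]
        exact Finset.sum_congr rfl fun l _ ↦ mul_comm _ _)
    exact congrArg (WithLp.toLp 2) this
  have hri : r i ≠ 0 := fun h ↦ hr (hker r hGr h)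
  have hspan : ∀ s, G x s = 0 → s = (s i / r i) • r := by
    intro s hs
    rw [← sub_eq_zero]
    apply hker
    · rw [map_sub, map_smul, hs, hGr]; simp
    · simp [hri]
  let β : 𝔼 →L[ℝ] ℝ := EuclideanSpace.proj i
  -- Since the determinant is 0, `cof` maps into the radical line; being symmetric as well, it is a
  -- multiple of `r ⊗ r`.
  have hcof : ∀ α, cof (G x) α = ((cof (G x) β i / r i / r i) * α r) • r := by
    intro α
    have hc : ∀ γ, cof (G x) γ = (cof (G x) γ i / r i) • r := fun γ ↦ by
      apply hspan
      rw [self_cof _ hG, h0, zero_smul]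
    have h := apply_cof_comm hG α β
    rw [hc β, map_smul, smul_eq_mul] at h
    rw [hc α]
    congr 1
    have h' : cof (G x) α i = cof (G x) β i / r i * α r := h
    rw [h']
    ring
  have hadj : ∀ k l, (gram (G x)).adjugate k l =
      cof (G x) β i / r i / r i * r l * r k := by
    intro k l
    have h1 : cof (G x) (EuclideanSpace.proj l : 𝔼 →L[ℝ] ℝ) k = (gram (G x)).adjugate k l := by
      rw [cof_apply]
      simp
    rw [← h1, hcof]
    simp
  refine ⟨cof (G x) β i / r i / r i, ?_, hcof, fun v ↦ ?_, fun s hs ↦ ⟨_, hspan s hs⟩⟩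
  · intro h
    apply hij
    rw [hadj, h]
    simp
  · rw [hJ, form_eq_sum (fderiv ℝ G x v), Finset.mul_sum]
    refine Finset.sum_congr rfl fun k _ ↦ ?_
    rw [Finset.mul_sum]
    refine Finset.sum_congr rfl fun l _ ↦ ?_
    rw [hadj]
    ring

lemma contDiffOn_gram {G : 𝔼 → 𝔼 →L[ℝ] 𝔼 →L[ℝ] ℝ} {U : Set 𝔼} (hG : ContDiffOn ℝ ∞ G U)
    (k l : Fin m) : ContDiffOn ℝ ∞ (fun y ↦ gram (G y) k l) U :=
  (hG.clm_apply contDiffOn_const).clm_apply contDiffOn_const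

lemma contDiffOn_det {n : Type*} [Fintype n] [DecidableEq n] {A : 𝔼 → Matrix n n ℝ} {U : Set 𝔼}
    (hA : ∀ k l, ContDiffOn ℝ ∞ (fun y ↦ A y k l) U) :
    ContDiffOn ℝ ∞ (fun y ↦ (A y).det) U := by
  simp only [Matrix.det_apply']
  exact ContDiffOn.sum fun σ _ ↦ contDiffOn_const.mul (contDiffOn_prod fun i _ ↦ hA _ _)

lemma contDiffOn_cof {G : 𝔼 → 𝔼 →L[ℝ] 𝔼 →L[ℝ] ℝ} {U : Set 𝔼} (hG : ContDiffOn ℝ ∞ G U) :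
    ContDiffOn ℝ ∞ (fun y ↦ cof (G y)) U := by
  refine contDiffOn_clm_apply.2 fun α ↦ contDiffOn_euclidean.2 fun k ↦ ?_
  simp only [cof_apply]
  refine ContDiffOn.sum fun l _ ↦ ContDiffOn.mul ?_ contDiffOn_const
  simp only [Matrix.adjugate_apply]
  refine contDiffOn_det fun a b ↦ ?_
  by_cases ha : a = l
  · subst ha
    simp only [Matrix.updateRow_self]
    exact contDiffOn_const
  · simp only [Matrix.updateRow_ne ha]
    exact contDiffOn_gram hG a b

end Determinant

end SingularMetric

namespace SingularMetric

/-! ### Christoffel symbols and curvature in coordinates -/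

section Christoffel

set_option synthInstance.maxHeartbeats 400000
set_option maxHeartbeats 1000000

variable {E : Type} [NormedAddCommGroup E] [NormedSpace ℝ E]

noncomputable instance : NormedAddCommGroup (E →L[ℝ] ℝ) := inferInstance
noncomputable instance : NormedAddCommGroup (E →L[ℝ] E →L[ℝ] ℝ) := inferInstance
noncomputable instance : NormedSpace ℝ (E →L[ℝ] E →L[ℝ] ℝ) := inferInstance
noncomputable instance : AddCommGroup (E →L[ℝ] E →L[ℝ] ℝ) := inferInstance
noncomputable instance : Module ℝ (E →L[ℝ] E →L[ℝ] ℝ) := inferInstance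
noncomputable instance : TopologicalSpace (E →L[ℝ] E →L[ℝ] ℝ) := inferInstance
noncomputable instance : AddCommMonoid (E →L[ℝ] E →L[ℝ] ℝ) := inferInstance
noncomputable instance : NormedAddCommGroup (E →L[ℝ] E →L[ℝ] E →L[ℝ] ℝ) := inferInstance
noncomputable instance : NormedSpace ℝ (E →L[ℝ] E →L[ℝ] E →L[ℝ] ℝ) := inferInstance
noncomputable instance : AddCommMonoid (E →L[ℝ] E →L[ℝ] E →L[ℝ] ℝ) := inferInstance

variable (E) in
/-- The linear map that takes the first derivatives of a metric to its Christoffel symbols of the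
first kind. -/
noncomputable def koszulMap :
    (E →L[ℝ] E →L[ℝ] E →L[ℝ] ℝ) →L[ℝ] (E →L[ℝ] E →L[ℝ] E →L[ℝ] ℝ) :=
  let F : (E →L[ℝ] E →L[ℝ] E →L[ℝ] ℝ) →L[ℝ] (E →L[ℝ] E →L[ℝ] E →L[ℝ] ℝ) :=
    (ContinuousLinearMap.flipₗᵢ ℝ E E (E →L[ℝ] ℝ)).toContinuousLinearEquiv.toContinuousLinearMap
  let F' : (E →L[ℝ] E →L[ℝ] ℝ) →L[ℝ] (E →L[ℝ] E →L[ℝ] ℝ) :=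
    (ContinuousLinearMap.flipₗᵢ ℝ E E ℝ).toContinuousLinearEquiv.toContinuousLinearMap
  (1 / 2 : ℝ) • (ContinuousLinearMap.id ℝ _ + F -
    (ContinuousLinearMap.compL ℝ E (E →L[ℝ] E →L[ℝ] ℝ) (E →L[ℝ] E →L[ℝ] ℝ) F').comp F)

lemma koszulMap_apply (D : E →L[ℝ] E →L[ℝ] E →L[ℝ] ℝ) (a b c : E) :
    koszulMap E D a b c = (1 / 2) * (D a b c + D b a c - D c a b) := rfl

/-- The Christoffel symbols of the first kind of the metric `G`. -/
noncomputable def christ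
    (G : E → E →L[ℝ] E →L[ℝ] ℝ) (x : E) : E →L[ℝ] E →L[ℝ] E →L[ℝ] ℝ :=
  koszulMap E (fderiv ℝ G x)

/-- The part of the curvature of `G` that is linear in the derivatives of the Christoffel
symbols. -/
noncomputable def curvLin
    (G : E → E →L[ℝ] E →L[ℝ] ℝ) (x a b c d : E) : ℝ :=
  koszulMap E (fderiv ℝ (fderiv ℝ G) x a) b c d - koszulMap E (fderiv ℝ (fderiv ℝ G) x b) a c d

/-- The curvature of `G` in terms of a function `τ` and a map `K` with `G ∘ K = τ`: it is `τ` times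
the covariant curvature tensor. -/
noncomputable def curvNum (G : E → E →L[ℝ] E →L[ℝ] ℝ) (τ : E → ℝ) (K : E → (E →L[ℝ] ℝ) →L[ℝ] E)
    (x a b c d : E) : ℝ :=
  τ x * curvLin G x a b c d - christ G x a d (K x (christ G x b c))
    + christ G x b d (K x (christ G x a c))

variable {G : E → E →L[ℝ] E →L[ℝ] ℝ} {x : E}

lemma christ_apply (a b c : E) : christ G x a b c =
    (1 / 2) * (fderiv ℝ G x a b c + fderiv ℝ G x b a c - fderiv ℝ G x c a b) := rfl

lemma fderiv_form_symm (hG : ∀ y v w, G y v w = G y w v) (hd : DifferentiableAt ℝ G x)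
    (v a b : E) : fderiv ℝ G x v a b = fderiv ℝ G x v b a := by
  have h : ∀ a b, HasFDerivAt (fun y ↦ G y a b) (((fderiv ℝ G x).flip a).flip b) x := by
    intro a b
    refine ((hd.hasFDerivAt.clm_apply (hasFDerivAt_const a x)).clm_apply
      (hasFDerivAt_const b x)).congr_fderiv ?_
    ext w
    simp
  have h1 := h a b
  simp only [hG _ a b] at h1
  exact congrArg (fun L ↦ L v) (h1.unique (h b a))

lemma christ_symm (hG : ∀ y v w, G y v w = G y w v) (hd : DifferentiableAt ℝ G x) (a b c : E) :
    christ G x a b c = christ G x b a c := by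
  rw [christ_apply, christ_apply, fderiv_form_symm hG hd c a b]
  ring

lemma christ_add (hG : ∀ y v w, G y v w = G y w v) (hd : DifferentiableAt ℝ G x) (a b c : E) :
    christ G x a b c + christ G x a c b = fderiv ℝ G x a b c := by
  rw [christ_apply, christ_apply, fderiv_form_symm hG hd c a b, fderiv_form_symm hG hd b a c,
    fderiv_form_symm hG hd a b c]
  ring

lemma hasFDerivAt_christ (hG : ContDiffAt ℝ ∞ G x) :
    HasFDerivAt (christ G) ((koszulMap E).comp (fderiv ℝ (fderiv ℝ G) x)) x :=
  (koszulMap E).hasFDerivAt.comp x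
    ((hG.fderiv_right (m := ∞) (by simp)).differentiableAt (by simp)).hasFDerivAt

lemma contDiffOn_christ {U : Set E} (hU : IsOpen U) (hG : ContDiffOn ℝ ∞ G U) :
    ContDiffOn ℝ ∞ (christ G) U :=
  (koszulMap E).contDiff.comp_contDiffOn (hG.fderiv_of_isOpen hU (by simp))

end Christoffel

end SingularMetric

namespace SingularMetric

section LocalTheory

set_option synthInstance.maxHeartbeats 400000
set_option maxHeartbeats 1000000

variable {E : Type} [NormedAddCommGroup E] [NormedSpace ℝ E]

/-! ### Singular metrics on an open subset of a vector space -/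

/-- `G` is a metric on the open set `Ω`, with discriminant `τ` and cofactor map `K`, which
degenerates transversally on the hypersurface `{τ = 0}`, with tangent radical. -/
structure IsSingularMetric (G : E → E →L[ℝ] E →L[ℝ] ℝ) (τ : E → ℝ)
    (K : E → (E →L[ℝ] ℝ) →L[ℝ] E) (Ω : Set E) : Prop where
  isOpen : IsOpen Ω
  smooth : ContDiffOn ℝ ∞ G Ω
  smooth_disc : ContDiffOn ℝ ∞ τ Ω
  smooth_cof : ContDiffOn ℝ ∞ K Ω
  symm : ∀ x v w, G x v w = G x w v
  cof_self : ∀ x v, K x (G x v) = τ x • v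
  self_cof : ∀ x α, G x (K x α) = τ x • α
  exists_radical : ∀ x ∈ Ω, τ x = 0 → ∃ r ≠ 0, G x r = 0
  radical : ∀ x ∈ Ω, τ x = 0 → ∀ r ≠ 0, G x r = 0 → ∃ κ : ℝ, κ ≠ 0 ∧
    (∀ α, K x α = (κ * α r) • r) ∧ (∀ v, fderiv ℝ τ x v = κ * fderiv ℝ G x v r r) ∧
    ∀ s, G x s = 0 → ∃ c : ℝ, s = c • r
  regular : ∀ x ∈ Ω, τ x = 0 → fderiv ℝ τ x ≠ 0
  nonneg : ∀ x ∈ Ω, τ x = 0 → ∀ v, 0 ≤ G x v v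
  tangent : ∀ x ∈ Ω, τ x = 0 → ∀ r, G x r = 0 → fderiv ℝ τ x r = 0

/-- `n` and `r` are the main normal and a main radical vector at `x`. -/
structure IsMainAt (G : E → E →L[ℝ] E →L[ℝ] ℝ) (τ : E → ℝ) (x n r : E) : Prop where
  radical : G x r = 0
  unit : G x n n = 1
  normal : ∀ v, fderiv ℝ τ x v = 0 → G x n v = 0
  isotropic : christ G x n n r = 0
  normalized : christ G x r n r = 1

variable {G : E → E →L[ℝ] E →L[ℝ] ℝ} {τ : E → ℝ} {K : E → (E →L[ℝ] ℝ) →L[ℝ] E} {Ω : Set E}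

namespace IsSingularMetric

variable (h : IsSingularMetric G τ K Ω) {x : E} (hx : x ∈ Ω)

include h hx

lemma contDiffAt : ContDiffAt ℝ ∞ G x := h.smooth.contDiffAt (h.isOpen.mem_nhds hx)

lemma differentiableAt : DifferentiableAt ℝ G x := (h.contDiffAt hx).differentiableAt (by simp)

lemma contDiffAt_disc : ContDiffAt ℝ ∞ τ x := h.smooth_disc.contDiffAt (h.isOpen.mem_nhds hx)

lemma contDiffAt_cof : ContDiffAt ℝ ∞ K x := h.smooth_cof.contDiffAt (h.isOpen.mem_nhds hx)

lemma christ_comm (a b c : E) : christ G x a b c = christ G x b a c :=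
  christ_symm h.symm (h.differentiableAt hx) a b c

lemma christ_add_flip (a b c : E) :
    christ G x a b c + christ G x a c b = fderiv ℝ G x a b c :=
  christ_add h.symm (h.differentiableAt hx) a b c

lemma christ_right_right (v r : E) : christ G x v r r = (1 / 2) * fderiv ℝ G x v r r := by
  rw [← h.christ_add_flip hx]; ring

lemma christ_right_left (v r : E) : christ G x r v r = (1 / 2) * fderiv ℝ G x v r r := by
  rw [h.christ_comm hx, h.christ_right_right hx]

variable (h0 : τ x = 0)

include h0

lemma exists_deriv_disc_eq_one : ∃ v, fderiv ℝ τ x v = 1 := by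
  obtain ⟨w, hw⟩ : ∃ w, fderiv ℝ τ x w ≠ 0 := by
    by_contra! h'
    exact h.regular x hx h0 (ContinuousLinearMap.ext h')
  exact ⟨(fderiv ℝ τ x w)⁻¹ • w, by simp [hw]⟩

/-- A covector that annihilates the radical is represented by a vector. -/
lemma exists_repr {α : E →L[ℝ] ℝ} (hα : ∀ r, G x r = 0 → α r = 0) : ∃ z, G x z = α := by
  obtain ⟨v, hv⟩ := h.exists_deriv_disc_eq_one hx h0
  obtain ⟨r, hr0, hr⟩ := h.exists_radical x hx h0
  obtain ⟨κ, -, hK, -⟩ := h.radical x hx h0 r hr0 hr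
  -- The identity `G (K α) = τ α` is differentiated along `v`. As `α` kills the radical, `K α = 0`
  -- at `x`, so only the derivative of `K` survives on the left, and the right side is `α`.
  have h1 : HasFDerivAt (fun y ↦ K y α) ((fderiv ℝ K x).flip α) x := by
    refine ((h.contDiffAt_cof hx).differentiableAt (by simp)).hasFDerivAt.clm_apply
      (hasFDerivAt_const α x) |>.congr_fderiv ?_
    ext; simp
  have h2 := (h.differentiableAt hx).hasFDerivAt.clm_apply h1
  have h3 := ((h.contDiffAt_disc hx).differentiableAt (by simp)).hasFDerivAt.smul_const α
  have h4 : (fun y ↦ G y (K y α)) = fun y ↦ τ y • α := funext fun y ↦ h.self_cof y α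
  rw [h4] at h2
  have h5 := congrArg (fun L ↦ L v) (h2.unique h3)
  have h6 : K x α = 0 := by rw [hK, hα r hr]; simp
  refine ⟨(fderiv ℝ K x v) α, ?_⟩
  simpa [hv, h6] using h5

/-- The form is positive semidefinite on the hypersurface. If `s` were isotropic with `⟨s, w⟩ ≠ 0`,
then `w` could be moved along `s` until the form takes the value −1, which is how the coefficient in
the proof is chosen. -/
lemma nonneg_eq_zero {s : E} (hs : G x s s = 0) : G x s = 0 := by
  ext w
  by_contra hw
  have hw' : G x s w ≠ 0 := hw
  have := h.nonneg x hx h0 (w - ((G x w w + 1) / (2 * G x s w)) • s)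
  simp only [map_sub, map_smul, sub_apply, smul_apply,
    smul_eq_mul, h.symm x w s, hs] at this
  have e : (G x w w + 1) / (2 * G x s w) * G x s w = (G x w w + 1) / 2 := by field_simp
  nlinarith

variable {n r : E} (hm : IsMainAt G τ x n r)

include hm

omit h0 h hx in
lemma _root_.SingularMetric.IsMainAt.radical_ne_zero : r ≠ 0 := by
  rintro rfl
  simpa using hm.normalized

lemma radical_span {s : E} (hs : G x s = 0) : ∃ c : ℝ, s = c • r :=
  (h.radical x hx h0 r hm.radical_ne_zero hm.radical).choose_spec.2.2.2 s hs

omit h0 h hx in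
lemma _root_.SingularMetric.IsMainAt.deriv_disc_normal_ne_zero : fderiv ℝ τ x n ≠ 0 := fun hn ↦ by
  simpa [hm.unit] using hm.normal n hn

omit hx h0 in
lemma normal_eq_div (v : E) : G x v n = fderiv ℝ τ x v / fderiv ℝ τ x n := by
  have hn := hm.deriv_disc_normal_ne_zero
  have := hm.normal (v - (fderiv ℝ τ x v / fderiv ℝ τ x n) • n) (by simp [hn])
  rw [map_sub, map_smul, hm.unit, smul_eq_mul, mul_one, sub_eq_zero] at this
  rw [h.symm, this]

omit hx h0 in
lemma tangent_iff {v : E} : fderiv ℝ τ x v = 0 ↔ G x v n = 0 := by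
  rw [h.normal_eq_div hm, div_eq_zero_iff]
  simp [hm.deriv_disc_normal_ne_zero]

/-- In terms of the second form this is `II (v, r) = ν (v)`. Half the derivative of `G` along `v` on
`(r, r)` is proportional to `dτ (v)`, hence to `⟨v, n⟩`, and the normalization of `r` makes the
factor 1. -/
lemma christ_radical_radical (v : E) : christ G x v r r = G x v n := by
  obtain ⟨κ, hκ, -, hd, -⟩ := h.radical x hx h0 r hm.radical_ne_zero hm.radical
  have hn := hm.deriv_disc_normal_ne_zero
  have h1 := hm.normalized
  rw [h.christ_right_left hx] at h1
  have h2 : fderiv ℝ G x n r r = 2 := by linarith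
  rw [h.christ_right_right hx, h.normal_eq_div hm, hd, hd, h2]
  field_simp

lemma christ_radical_radical' (v : E) : christ G x r v r = G x v n := by
  rw [h.christ_comm hx, h.christ_radical_radical hx h0 hm]

lemma radical_tangent : fderiv ℝ τ x r = 0 := h.tangent x hx h0 r hm.radical

omit h hx h0 in
/-- A covector is determined by its values on the tangent vectors and the main normal. -/
lemma _root_.SingularMetric.IsMainAt.clm_ext {α β : E →L[ℝ] ℝ}
    (ht : ∀ v, fderiv ℝ τ x v = 0 → α v = β v) (hn : α n = β n) : α = β := by
  have hn0 := hm.deriv_disc_normal_ne_zero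
  ext v
  have := ht (v - (fderiv ℝ τ x v / fderiv ℝ τ x n) • n) (by simp [hn0])
  rw [map_sub, map_sub, map_smul, map_smul, hn] at this
  linarith

/-- Uniqueness of the main normal, and of the main radical vector up to sign. -/
lemma main_unique {n' r' : E} (hm' : IsMainAt G τ x n' r') : n' = n ∧ (r' = r ∨ r' = -r) := by
  obtain ⟨c, rfl⟩ := h.radical_span hx h0 hm hm'.radical
  -- This vector is orthogonal to the tangent vectors and to `n`, hence radical, so `n' = a n + b r`
  -- and `r' = c r`.
  have h1 : G x (n' - G x n' n • n) = 0 := by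
    refine hm.clm_ext (fun v hv ↦ ?_) ?_
    · simp [hm.normal v hv, hm'.normal v hv]
    · simp [hm.unit]
  obtain ⟨b, hb⟩ := h.radical_span hx h0 hm h1
  set a := G x n' n
  have hn' : n' = a • n + b • r := by rw [← hb]; abel
  have hrn : G x r n = 0 := by rw [hm.radical]; rfl
  have hnr : G x n r = 0 := by rw [h.symm, hrn]
  have hrr : G x r r = 0 := by rw [hm.radical]; rfl
  have e1 := hm'.unit
  have e2 := hm'.normalized
  have e3 := hm'.isotropic
  have c1 : christ G x r r r = 0 := by rw [h.christ_radical_radical hx h0 hm, hrn]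
  have c2 : christ G x n r r = 1 := by rw [h.christ_radical_radical hx h0 hm, hm.unit]
  rw [hn'] at e1 e2 e3
  simp only [map_add, map_smul, add_apply, smul_apply,
    smul_eq_mul, hm.unit, hrn, hnr, hrr, hm.normalized, hm.isotropic, c1, c2] at e1 e2 e3
  -- The unit condition gives `a² = 1`, and the normalization `a c² = 1` excludes the negative sign
  -- and gives `c = ±1`. The isotropy condition then reads `2 b c = 0`.
  have ha : a = 1 := by
    have : (a - 1) * (a + 1) = 0 := by linarith
    rcases mul_eq_zero.1 this with h' | h'
    · linarith
    · exfalso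
      have : a = -1 := by linarith
      rw [this] at e2
      nlinarith [sq_nonneg c]
  rw [ha] at e2 e3
  have hc : (c - 1) * (c + 1) = 0 := by linarith
  have hb0 : b = 0 := by
    have hc0 : c ≠ 0 := by rintro rfl; simp at e2
    have : c * (2 * b) = 0 := by linarith
    have := (mul_eq_zero.1 this).resolve_left hc0
    linarith
  refine ⟨by rw [hn', ha, hb0]; simp, ?_⟩
  rcases mul_eq_zero.1 hc with h' | h'
  · left; rw [show c = 1 by linarith, one_smul]
  · right; rw [show c = -1 by linarith, neg_one_smul]

/-- The screen component is spacelike. -/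
lemma screen_eq_zero {s : E} (hs : christ G x s n r = 0) (hss : G x s s = 0) : s = 0 := by
  obtain ⟨c, rfl⟩ := h.radical_span hx h0 hm (h.nonneg_eq_zero hx h0 hss)
  simp only [map_smul, smul_apply, smul_eq_mul, hm.normalized] at hs
  simp [show c = 0 by linarith]

omit hm in
/-- The numerator of the curvature on the singular hypersurface. -/
lemma curvNum_eq {r : E} (hr : r ≠ 0) (hGr : G x r = 0) : ∃ κ : ℝ, κ ≠ 0 ∧ ∀ a b c d,
    curvNum G τ K x a b c d = κ * (christ G x a c r * christ G x b d r -
      christ G x b c r * christ G x a d r) := by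
  obtain ⟨κ, hκ, hK, -⟩ := h.radical x hx h0 r hr hGr
  refine ⟨κ, hκ, fun a b c d ↦ ?_⟩
  simp only [curvNum, h0, hK, map_smul, smul_eq_mul]
  ring

omit hm in
/-- The derivative of `K (α, β)` at a point of the singular hypersurface. -/
lemma fderiv_apply_cof {α β : E → E →L[ℝ] ℝ} (hα : DifferentiableAt ℝ α x)
    (hβ : DifferentiableAt ℝ β x) {z : E} (hz : G x z = α x) (hβr : ∀ r, G x r = 0 → β x r = 0)
    (v : E) :
    HasFDerivAt (fun y ↦ β y (K y (α y))) (fderiv ℝ (fun y ↦ β y (K y (α y))) x) x ∧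
    fderiv ℝ (fun y ↦ β y (K y (α y))) x v = fderiv ℝ τ x v * β x z := by
  obtain ⟨r, hr0, hr⟩ := h.exists_radical x hx h0
  obtain ⟨κ, -, hK, -⟩ := h.radical x hx h0 r hr0 hr
  have hKd := ((h.contDiffAt_cof hx).differentiableAt (by simp)).hasFDerivAt
  have hd := hβ.hasFDerivAt.clm_apply (hKd.clm_apply hα.hasFDerivAt)
  have hαr : α x r = 0 := by rw [← hz, h.symm, hr]; rfl
  refine ⟨hd.differentiableAt.hasFDerivAt, ?_⟩
  -- Differentiating `K (G z) = τ z` produces the derivative of `K` on `α = G z`. The remaining term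
  -- lies in the image of `K x`, the radical line, where `β x` vanishes.
  have h1 := hKd.clm_apply ((h.differentiableAt hx).hasFDerivAt.clm_apply (hasFDerivAt_const z x))
  have h2 := ((h.contDiffAt_disc hx).differentiableAt (by simp)).hasFDerivAt.smul_const z
  have h3 : (fun y ↦ K y (G y z)) = fun y ↦ τ y • z := funext fun y ↦ h.cof_self y z
  rw [h3] at h1
  have h4 := congrArg (fun L ↦ β x (L v)) (h1.unique h2)
  rw [hd.fderiv]
  simp [hK, hβr r hr, hαr, hz] at h4 ⊢
  exact h4

end IsSingularMetric
end LocalTheory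
end SingularMetric

namespace SingularMetric

/-! ### Calculus along the hypersurface, and existence of the main normal and the main radical field
-/

section LocalFields

set_option synthInstance.maxHeartbeats 400000
set_option maxHeartbeats 1000000

variable {E : Type} [NormedAddCommGroup E] [NormedSpace ℝ E]

variable {G : E → E →L[ℝ] E →L[ℝ] ℝ} {τ : E → ℝ} {K : E → (E →L[ℝ] ℝ) →L[ℝ] E} {Ω : Set E}

/-- The smooth fields `N` and `R` on `W` are a main normal and a main radical field. -/
structure IsMainOn (G : E → E →L[ℝ] E →L[ℝ] ℝ) (τ : E → ℝ) (W : Set E) (N R : E → E) : Prop where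
  isOpen : IsOpen W
  smooth_normal : ContDiffOn ℝ ∞ N W
  smooth_radical : ContDiffOn ℝ ∞ R W
  main : ∀ y ∈ W, τ y = 0 → IsMainAt G τ y (N y) (R y)

namespace IsSingularMetric

variable (h : IsSingularMetric G τ K Ω) {x : E} (hx : x ∈ Ω) (h0 : τ x = 0)

include h hx h0

/-- The regular points accumulate at every point of the singular hypersurface. -/
lemma frequently_ne : ∃ᶠ y in 𝓝 x, τ y ≠ 0 := by
  intro hev
  have : τ =ᶠ[𝓝 x] fun _ ↦ 0 := hev.mono fun y hy ↦ not_not.1 hy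
  exact h.regular x hx h0 (by rw [this.fderiv_eq]; simp)

/-- Density of the regular points: identities proved off the hypersurface pass to it by continuity.
-/
lemma eq_of_eventually {F : Type*} [TopologicalSpace F] [T2Space F] {f g : E → F}
    (hf : ContinuousAt f x) (hg : ContinuousAt g x) (hfg : ∀ᶠ y in 𝓝 x, τ y ≠ 0 → f y = g y) :
    f x = g x := by
  have hne : (𝓝 x ⊓ Filter.principal {y | τ y ≠ 0}).NeBot :=
    Filter.frequently_mem_iff_neBot.1 (h.frequently_ne hx h0)
  refine tendsto_nhds_unique_of_eventuallyEq (l := 𝓝 x ⊓ Filter.principal {y | τ y ≠ 0})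
    (hf.mono_left inf_le_left) (hg.mono_left inf_le_left) ?_
  rw [Filter.EventuallyEq, Filter.eventually_inf_principal]
  exact hfg

variable [FiniteDimensional ℝ E]

/-- A function that vanishes on the singular hypersurface has vanishing tangential derivatives. -/
lemma fderiv_eq_zero_of_tangent {φ : E → ℝ} (hφ : ContDiffAt ℝ 1 φ x)
    (hφ0 : ∀ᶠ y in 𝓝 x, τ y = 0 → φ y = 0) {v : E} (hv : fderiv ℝ τ x v = 0) :
    fderiv ℝ φ x v = 0 := by
  have := FiniteDimensional.complete ℝ E
  -- Lagrange multipliers: `x` is a minimum of `φ` on the level set of `τ`, so `dφ` is proportional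
  -- to `dτ`.
  have hext : IsLocalExtrOn φ {y | τ y = τ x} x := by
    left
    have : ∀ᶠ y in 𝓝 x, y ∈ {y | τ y = τ x} → φ x ≤ φ y := by
      filter_upwards [hφ0] with y hy hyτ
      rw [hφ0.self_of_nhds h0, hy (hyτ.trans h0)]
    exact eventually_nhdsWithin_iff.2 this
  obtain ⟨a, b, hab, hsum⟩ := hext.exists_multipliers_of_hasStrictFDerivAt_1d
    ((h.contDiffAt_disc hx).hasStrictFDerivAt (by simp)) (hφ.hasStrictFDerivAt (by simp))
  have hb : b ≠ 0 := by
    rintro rfl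
    have ha : a ≠ 0 := fun ha ↦ hab (by simp [ha])
    rw [zero_smul, add_zero] at hsum
    exact h.regular x hx h0 ((smul_eq_zero.1 hsum).resolve_left ha)
  have := congrArg (fun L ↦ L v) hsum
  simpa [hv, hb] using this

/-- The Lie bracket of two tangent fields is tangent. -/
lemma bracket_tangent {A B : E → E} (hA : ContDiffAt ℝ ∞ A x) (hB : ContDiffAt ℝ ∞ B x)
    (hAt : ∀ᶠ y in 𝓝 x, τ y = 0 → fderiv ℝ τ y (A y) = 0)
    (hBt : ∀ᶠ y in 𝓝 x, τ y = 0 → fderiv ℝ τ y (B y) = 0) :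
    fderiv ℝ τ x (fderiv ℝ B x (A x) - fderiv ℝ A x (B x)) = 0 := by
  have hτ := h.contDiffAt_disc hx
  have hdτ : ContDiffAt ℝ ∞ (fderiv ℝ τ) x := hτ.fderiv_right (by simp)
  -- Differentiate `dτ (B) = 0` along the tangent field `A`. In the difference with the roles
  -- exchanged, the Hessian of `τ` cancels by symmetry.
  have key : ∀ {A B : E → E}, ContDiffAt ℝ ∞ A x → ContDiffAt ℝ ∞ B x →
      (∀ᶠ y in 𝓝 x, τ y = 0 → fderiv ℝ τ y (A y) = 0) →
      (∀ᶠ y in 𝓝 x, τ y = 0 → fderiv ℝ τ y (B y) = 0) →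
      fderiv ℝ (fderiv ℝ τ) x (A x) (B x) + fderiv ℝ τ x (fderiv ℝ B x (A x)) = 0 := by
    intro A B hA hB hAt hBt
    have h1 := h.fderiv_eq_zero_of_tangent hx h0
      ((hdτ.clm_apply hB).of_le (by simp)) hBt (hAt.self_of_nhds h0)
    rw [((hdτ.differentiableAt (by simp)).hasFDerivAt.clm_apply
      (hB.differentiableAt (by simp)).hasFDerivAt).fderiv] at h1
    simpa [add_comm] using h1
  have hs : fderiv ℝ (fderiv ℝ τ) x (A x) (B x) = fderiv ℝ (fderiv ℝ τ) x (B x) (A x) :=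
    (hτ.isSymmSndFDerivAt (by
      rw [minSmoothness_of_isRCLikeNormedField]
      exact WithTop.coe_le_coe.2 (le_top : (2 : ℕ∞) ≤ ⊤))).eq _ _
  rw [map_sub]
  linarith [key hA hB hAt hBt, key hB hA hBt hAt]

/-- Existence of the main normal and of a main radical field. -/
lemma exists_main : ∃ W ⊆ Ω, x ∈ W ∧ ∃ N R : E → E, IsMainOn G τ W N R := by
  obtain ⟨r, hr0, hr⟩ := h.exists_radical x hx h0
  obtain ⟨κ, hκ, hK, hκd, -⟩ := h.radical x hx h0 r hr0 hr
  obtain ⟨α, hα⟩ : ∃ α : E →L[ℝ] ℝ, α r ≠ 0 := by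
    obtain ⟨α, -, hα⟩ := exists_dual_vector ℝ r (norm_ne_zero_iff.2 hr0)
    exact ⟨α, by rw [hα]; simpa using hr0⟩
  -- a radical field and the gradient of the discriminant
  have hdτ : ContDiffOn ℝ ∞ (fderiv ℝ τ) Ω := h.smooth_disc.fderiv_of_isOpen h.isOpen (by simp)
  -- Because the radical is tangent, `dτ` kills it and `K (dτ)` vanishes on the hypersurface. Its
  -- quotient by `τ` is the gradient of `τ`, smooth across the hypersurface.
  obtain ⟨W₁, hW₁Ω, hW₁, hxW₁, N₀, hN₀, hKN⟩ := exists_eq_smul_of_regular h.isOpen hx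
    (h.smooth_cof.clm_apply hdτ) h.smooth_disc h0 (h.regular x hx h0) (by
      intro y hy hy0
      obtain ⟨r', hr'0, hr'⟩ := h.exists_radical y hy hy0
      obtain ⟨κ', -, hK', -, -⟩ := h.radical y hy hy0 r' hr'0 hr'
      rw [hK', h.tangent y hy hy0 r' hr']
      simp)
  have hGN : ∀ y ∈ W₁, G y (N₀ y) = fderiv ℝ τ y := by
    have hne : ∀ y ∈ W₁, τ y ≠ 0 → G y (N₀ y) = fderiv ℝ τ y := by
      intro y hy hy0
      have := congrArg (G y) (hKN y hy)
      rw [h.self_cof, map_smul] at this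
      exact (smul_right_injective _ hy0 this).symm
    intro y hy
    by_cases hy0 : τ y = 0
    · refine h.eq_of_eventually (hW₁Ω hy) hy0 (f := fun y ↦ G y (N₀ y)) ?_ ?_ ?_
      · exact ((h.contDiffAt (hW₁Ω hy)).clm_apply
          (hN₀.contDiffAt (hW₁.mem_nhds hy))).continuousAt
      · exact (hdτ.contDiffAt (h.isOpen.mem_nhds (hW₁Ω hy))).continuousAt
      · filter_upwards [hW₁.mem_nhds hy] with z hz hz0 using hne z hz hz0
    · exact hne y hy hy0
  let R₀ : E → E := fun y ↦ K y α
  have hR₀ : ContDiffOn ℝ ∞ R₀ Ω := h.smooth_cof.clm_apply contDiffOn_const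
  have hGR : ∀ y, τ y = 0 → G y (R₀ y) = 0 := fun y hy ↦ by rw [h.self_cof, hy, zero_smul]
  have hR₀x : R₀ x ≠ 0 := by simp [R₀, hK, hκ, hα, hr0]
  let q : E → ℝ := fun y ↦ G y (N₀ y) (N₀ y)
  let c : E → ℝ := fun y ↦ christ G y (R₀ y) (N₀ y) (R₀ y)
  have hch := contDiffOn_christ h.isOpen h.smooth
  have hqs : ContDiffOn ℝ ∞ q W₁ := ((h.smooth.mono hW₁Ω).clm_apply hN₀).clm_apply hN₀
  have hcs : ContDiffOn ℝ ∞ c W₁ := (((hch.mono hW₁Ω).clm_apply (hR₀.mono hW₁Ω)).clm_apply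
    hN₀).clm_apply (hR₀.mono hW₁Ω)
  have hq : 0 < q x := by
    have h1 : 0 ≤ q x := h.nonneg x hx h0 _
    refine lt_of_le_of_ne h1 fun h2 ↦ h.regular x hx h0 ?_
    rw [← hGN x hxW₁]
    exact h.nonneg_eq_zero hx h0 h2.symm
  -- `dτ (N₀) = ⟨N₀, N₀⟩ > 0` is a multiple of the derivative of `G` along `N₀` on `(R₀, R₀)`, which
  -- is `2 c`.
  have hc : c x ≠ 0 := by
    obtain ⟨κ', hκ', -, hd, -⟩ := h.radical x hx h0 _ hR₀x (hGR x h0)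
    have h1 : fderiv ℝ τ x (N₀ x) = q x := by rw [← hGN x hxW₁]
    have h2 : c x = 1 / 2 * fderiv ℝ G x (N₀ x) (R₀ x) (R₀ x) := h.christ_right_left hx _ _
    rw [hd] at h1
    intro h3
    rw [h3] at h2
    have : fderiv ℝ G x (N₀ x) (R₀ x) (R₀ x) = 0 := by linarith
    rw [this, mul_zero] at h1
    exact hq.ne h1
  -- normalization
  let σ : ℝ := if 0 < c x then 1 else -1
  have hσ : σ * σ = 1 := by simp only [σ]; split_ifs <;> norm_num
  have hσc : 0 < σ * c x := by
    simp only [σ]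
    split_ifs with h'
    · linarith
    · have := lt_of_le_of_ne (not_lt.1 h') hc
      linarith
  let W := W₁ ∩ (fun y ↦ (q y, σ * c y)) ⁻¹' (Set.Ioi 0 ×ˢ Set.Ioi 0)
  have hWo : IsOpen W := (hqs.continuousOn.prodMk
    (continuousOn_const.mul hcs.continuousOn)).isOpen_inter_preimage hW₁ (isOpen_Ioi.prod isOpen_Ioi)
  have hWW : W ⊆ W₁ := fun y hy ↦ hy.1
  have hqp : ∀ y ∈ W, 0 < q y := fun y hy ↦ hy.2.1
  have hcp : ∀ y ∈ W, 0 < σ * c y := fun y hy ↦ hy.2.2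
  -- The sign `σ` orients the normal so that the value to be normalized to 1 is positive; its square
  -- root can then be absorbed in `R`.
  let N₂ : E → E := fun y ↦ (σ / √(q y)) • N₀ y
  let R : E → E := fun y ↦ (1 / √(σ * c y / √(q y))) • R₀ y
  have hsq : ContDiffOn ℝ ∞ (fun y ↦ √(q y)) W :=
    (hqs.mono hWW).sqrt fun y hy ↦ (hqp y hy).ne'
  have hsq0 : ∀ y ∈ W, √(q y) ≠ 0 := fun y hy ↦ (Real.sqrt_pos.2 (hqp y hy)).ne'
  have hN₂ : ContDiffOn ℝ ∞ N₂ W := (contDiffOn_const.div hsq hsq0).smul (hN₀.mono hWW)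
  have hdpos : ∀ y ∈ W, 0 < σ * c y / √(q y) := fun y hy ↦
    div_pos (hcp y hy) (Real.sqrt_pos.2 (hqp y hy))
  have hR : ContDiffOn ℝ ∞ R W := by
    refine (contDiffOn_const.div (ContDiffOn.sqrt ?_ fun y hy ↦ (hdpos y hy).ne')
      fun y hy ↦ (Real.sqrt_pos.2 (hdpos y hy)).ne').smul (hR₀.mono (hWW.trans hW₁Ω))
    exact (contDiffOn_const.mul (hcs.mono hWW)).div hsq hsq0
  -- With `Γ(N₂, R, R) = 1` and `Γ(R, R, R) = 0`, passing from `N₂` to `N₂ + a R` adds `2 a` to `II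
  -- (N₂, N₂)`. This value of `a` makes the normal isotropic.
  let a : E → ℝ := fun y ↦ -(1 / 2) * christ G y (N₂ y) (N₂ y) (R y)
  have ha : ContDiffOn ℝ ∞ a W := contDiffOn_const.mul
    ((((hch.mono (hWW.trans hW₁Ω)).clm_apply hN₂).clm_apply hN₂).clm_apply hR)
  refine ⟨W, hWW.trans hW₁Ω, ⟨hxW₁, hq, hσc⟩, fun y ↦ N₂ y + a y • R y, R, hWo,
    hN₂.add (ha.smul hR), hR, fun y hy hy0 ↦ ?_⟩
  have hyΩ : y ∈ Ω := hW₁Ω (hWW hy)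
  have hGRy : G y (R y) = 0 := by simp [R, hGR y hy0]
  have hRne : R y ≠ 0 := by
    intro hR0
    have hR₀y : R₀ y = 0 := (smul_eq_zero.1 hR0).resolve_left
      (one_div_ne_zero (Real.sqrt_pos.2 (hdpos y hy)).ne')
    have := hcp y hy
    simp [c, hR₀y] at this
  have hRR : ∀ w, G y w (R y) = 0 := fun w ↦ by rw [h.symm, hGRy]; rfl
  obtain ⟨κ', hκ', -, hd, -⟩ := h.radical y hyΩ hy0 _ hRne hGRy
  have hrrr : christ G y (R y) (R y) (R y) = 0 := by
    rw [h.christ_right_right hyΩ]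
    have := h.tangent y hyΩ hy0 _ hGRy
    rw [hd] at this
    rw [(mul_eq_zero.1 this).resolve_left hκ', mul_zero]
  have hrnr : christ G y (R y) (N₂ y) (R y) = 1 := by
    have hp := hdpos y hy
    have h1 : (1 / √(σ * c y / √(q y))) * (1 / √(σ * c y / √(q y))) = 1 / (σ * c y / √(q y)) := by
      rw [div_mul_div_comm, Real.mul_self_sqrt hp.le, one_mul]
    have h2 : christ G y (R y) (N₂ y) (R y) =
        (1 / √(σ * c y / √(q y)) * (1 / √(σ * c y / √(q y)))) * (σ / √(q y) * c y) := by
      simp only [R, N₂, c, map_smul, smul_apply, smul_eq_mul]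
      ring
    rw [h2, h1]
    have := hp.ne'
    rw [show σ / √(q y) * c y = σ * c y / √(q y) by ring]
    exact one_div_mul_cancel this
  have hnrr : christ G y (N₂ y) (R y) (R y) = 1 := by rw [h.christ_comm hyΩ, hrnr]
  refine ⟨hGRy, ?_, fun v hv ↦ ?_, ?_, ?_⟩
  · have h1 : G y (N₂ y) (N₂ y) = 1 := by
      have h1 : G y (N₂ y) (N₂ y) = (σ * σ) * q y / (√(q y) * √(q y)) := by
        simp only [N₂, q, map_smul, smul_apply, smul_eq_mul]
        ring
      rw [h1, hσ, Real.mul_self_sqrt (hqp y hy).le, one_mul, div_self (hqp y hy).ne']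
    simp [hGRy, hRR, h1]
  · have : G y (N₂ y) v = 0 := by simp [N₂, hGN y (hWW hy), hv]
    simp [this, hGRy]
  · simp only [map_add, map_smul, add_apply, smul_apply, smul_eq_mul, hrrr, hrnr, hnrr, a]
    ring
  · simp only [map_add, map_smul, add_apply, smul_apply, smul_eq_mul, hrrr, hrnr]
    ring

end IsSingularMetric
end LocalFields
end SingularMetric

namespace SingularMetric

/-! ### The value of the curvature on the hypersurface, and the second fundamental form -/

section LocalCurvature

set_option synthInstance.maxHeartbeats 400000
set_option maxHeartbeats 1000000

variable {E : Type} [NormedAddCommGroup E] [NormedSpace ℝ E]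

variable {G : E → E →L[ℝ] E →L[ℝ] ℝ} {τ : E → ℝ} {K : E → (E →L[ℝ] ℝ) →L[ℝ] E} {Ω : Set E}

/-- The component of the constant field `v` that is orthogonal to `N`. -/
noncomputable def orthField (G : E → E →L[ℝ] E →L[ℝ] ℝ) (N : E → E) (v y : E) : E :=
  v - G y v (N y) • N y

/-- The second fundamental form in coordinates. -/
noncomputable def secondForm (G : E → E →L[ℝ] E →L[ℝ] ℝ) (N : E → E) (x v w : E) : ℝ :=
  -(G x (fderiv ℝ N x v) w + christ G x v (N x) w)

lemma curvLin_add_left (x a a' b c d : E) :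
    curvLin G x (a + a') b c d = curvLin G x a b c d + curvLin G x a' b c d := by
  simp only [curvLin, map_add, add_apply]; ring

lemma curvLin_smul_left (t : ℝ) (x a b c d : E) :
    curvLin G x (t • a) b c d = t * curvLin G x a b c d := by
  simp only [curvLin, map_smul, smul_apply, smul_eq_mul]; ring

lemma curvLin_swap (x a b c d : E) : curvLin G x b a c d = -curvLin G x a b c d := by
  simp only [curvLin]; ring

lemma curvLin_add_third (x a b c c' d : E) :
    curvLin G x a b (c + c') d = curvLin G x a b c d + curvLin G x a b c' d := by
  simp only [curvLin, map_add, add_apply]; ring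

lemma curvLin_smul_third (t : ℝ) (x a b c d : E) :
    curvLin G x a b (t • c) d = t * curvLin G x a b c d := by
  simp only [curvLin, map_smul, smul_apply, smul_eq_mul]; ring

namespace IsSingularMetric

variable (h : IsSingularMetric G τ K Ω) {x : E} (hx : x ∈ Ω)

include h hx

lemma contDiffAt_christ : ContDiffAt ℝ ∞ (christ G) x :=
  (contDiffOn_christ h.isOpen h.smooth).contDiffAt (h.isOpen.mem_nhds hx)

lemma contDiffAt_curvLin {A B C D : E → E} (hA : ContDiffAt ℝ ∞ A x) (hB : ContDiffAt ℝ ∞ B x)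
    (hC : ContDiffAt ℝ ∞ C x) (hD : ContDiffAt ℝ ∞ D x) :
    ContDiffAt ℝ ∞ (fun y ↦ curvLin G y (A y) (B y) (C y) (D y)) x := by
  have h2 : ContDiffAt ℝ ∞ (fderiv ℝ (fderiv ℝ G)) x :=
    ((h.contDiffAt hx).fderiv_right (m := ∞) (by simp)).fderiv_right (by simp)
  have h3 : ∀ {A : E → E}, ContDiffAt ℝ ∞ A x →
      ContDiffAt ℝ ∞ (fun y ↦ koszulMap E (fderiv ℝ (fderiv ℝ G) y (A y))) x := fun hA ↦
    (koszulMap E).contDiff.contDiffAt.comp x (h2.clm_apply hA)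
  exact ((((h3 hA).clm_apply hB).clm_apply hC).clm_apply hD).sub
    ((((h3 hB).clm_apply hA).clm_apply hC).clm_apply hD)

lemma contDiffAt_curvNum {A B C D : E → E} (hA : ContDiffAt ℝ ∞ A x) (hB : ContDiffAt ℝ ∞ B x)
    (hC : ContDiffAt ℝ ∞ C x) (hD : ContDiffAt ℝ ∞ D x) :
    ContDiffAt ℝ ∞ (fun y ↦ curvNum G τ K y (A y) (B y) (C y) (D y)) x := by
  have hch := h.contDiffAt_christ hx
  have hK := h.contDiffAt_cof hx
  exact (((h.contDiffAt_disc hx).mul (h.contDiffAt_curvLin hx hA hB hC hD)).sub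
    (((hch.clm_apply hA).clm_apply hD).clm_apply
      (hK.clm_apply ((hch.clm_apply hB).clm_apply hC)))).add
    (((hch.clm_apply hB).clm_apply hD).clm_apply
      (hK.clm_apply ((hch.clm_apply hA).clm_apply hC)))

lemma second_comm (v w a b : E) :
    fderiv ℝ (fderiv ℝ G) x v w a b = fderiv ℝ (fderiv ℝ G) x w v a b := by
  have := ((h.contDiffAt hx).isSymmSndFDerivAt (by
    rw [minSmoothness_of_isRCLikeNormedField]
    exact WithTop.coe_le_coe.2 (le_top : (2 : ℕ∞) ≤ ⊤))).eq v w
  rw [this]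

/-- The second derivatives of `G` commute, so the terms symmetric in `c` and `d` cancel and the
remaining ones are skew. -/
lemma curvLin_flip (a b c d : E) : curvLin G x a b d c = -curvLin G x a b c d := by
  simp only [curvLin, koszulMap_apply]
  rw [h.second_comm hx b a c d, h.second_comm hx b a d c]
  ring

/-- The value on the plane spanned by `s` and `r`. -/
lemma curvLin_plane (a b a' b' : ℝ) (s r : E) :
    curvLin G x (a • s + b • r) (a' • s + b' • r) (a • s + b • r) (a' • s + b' • r) =
      (a * b' - a' * b) ^ 2 * curvLin G x s r s r := by
  have hss : ∀ c d, curvLin G x s s c d = 0 := fun c d ↦ by simp [curvLin]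
  have hrr : ∀ c d, curvLin G x r r c d = 0 := fun c d ↦ by simp [curvLin]
  have hc : ∀ a b c, curvLin G x a b c c = 0 := fun a b c ↦ by
    linarith [h.curvLin_flip hx a b c c]
  have hrs : ∀ c d, curvLin G x r s c d = -curvLin G x s r c d := fun c d ↦ curvLin_swap _ _ _ _ _
  have e2 : ∀ u c d, curvLin G x u (a' • s + b' • r) c d =
      a' * curvLin G x u s c d + b' * curvLin G x u r c d := fun u c d ↦ by
    rw [curvLin_swap, curvLin_add_left, curvLin_smul_left, curvLin_smul_left, curvLin_swap x u s,
      curvLin_swap x u r]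
    ring
  have e4 : ∀ u v c, curvLin G x u v c (a' • s + b' • r) =
      a' * curvLin G x u v c s + b' * curvLin G x u v c r := fun u v c ↦ by
    rw [h.curvLin_flip hx, curvLin_add_third, curvLin_smul_third, curvLin_smul_third,
      h.curvLin_flip hx u v c s, h.curvLin_flip hx u v c r]
    ring
  rw [curvLin_add_left, curvLin_smul_left, curvLin_smul_left, e2, e2, hss, hrr, hrs,
    e4, curvLin_add_third, curvLin_smul_third, curvLin_smul_third, curvLin_add_third,
    curvLin_smul_third, curvLin_smul_third, hc, hc, h.curvLin_flip hx s r s r]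
  ring

variable (h0 : τ x = 0)

include h0

/-- The value on the singular hypersurface of the extension of the curvature. -/
lemma curv_value {A B C D : E → E} (hA : ContDiffAt ℝ ∞ A x) (hB : ContDiffAt ℝ ∞ B x)
    (hC : ContDiffAt ℝ ∞ C x) (hD : ContDiffAt ℝ ∞ D x) {F : E → ℝ} (hF : DifferentiableAt ℝ F x)
    (hFτ : ∀ᶠ y in 𝓝 x, F y * τ y = curvNum G τ K y (A y) (B y) (C y) (D y))
    {z z' : E} (hz : G x z = christ G x (B x) (C x)) (hz' : G x z' = christ G x (A x) (C x))
    (had : ∀ r, G x r = 0 → christ G x (A x) (D x) r = 0)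
    (hbd : ∀ r, G x r = 0 → christ G x (B x) (D x) r = 0) :
    F x = curvLin G x (A x) (B x) (C x) (D x) - christ G x (A x) (D x) z
      + christ G x (B x) (D x) z' := by
  -- Both sides of `hFτ` are differentiated in a direction with `dτ (v) = 1`: the left side gives `F
  -- x`, and `fderiv_apply_cof` evaluates the two terms with `K`.
  obtain ⟨v, hv⟩ := h.exists_deriv_disc_eq_one hx h0
  have hτ := ((h.contDiffAt_disc hx).differentiableAt (by simp)).hasFDerivAt
  have hch := h.contDiffAt_christ hx
  have hL := ((h.contDiffAt_curvLin hx hA hB hC hD).differentiableAt (by simp)).hasFDerivAt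
  have hcov : ∀ {A B : E → E}, ContDiffAt ℝ ∞ A x → ContDiffAt ℝ ∞ B x →
      DifferentiableAt ℝ (fun y ↦ christ G y (A y) (B y)) x := fun hA hB ↦
    ((hch.clm_apply hA).clm_apply hB).differentiableAt (by simp)
  obtain ⟨h1, h1'⟩ := h.fderiv_apply_cof hx h0 (hcov hB hC) (hcov hA hD) hz had v
  obtain ⟨h2, h2'⟩ := h.fderiv_apply_cof hx h0 (hcov hA hC) (hcov hB hD) hz' hbd v
  have h3 := ((hτ.mul hL).sub h1).add h2
  have h4 : HasFDerivAt (fun y ↦ F y * τ y) _ x := HasFDerivAt.congr_of_eventuallyEq h3 hFτ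
  have h5 := congrArg (fun L ↦ L v) (h4.unique (hF.hasFDerivAt.mul hτ))
  simp only [add_apply, sub_apply, smul_apply, h1', h2', h0, hv, smul_eq_mul, zero_mul] at h5
  linarith

variable {N R : E → E} {W : Set E} (hN : IsMainOn G τ W N R) (hxW : x ∈ W) (hWΩ : W ⊆ Ω)

omit h hx h0 in
lemma _root_.SingularMetric.IsMainOn.contDiffAt_normal (hN : IsMainOn G τ W N R) (hxW : x ∈ W) :
    ContDiffAt ℝ ∞ N x := hN.smooth_normal.contDiffAt (hN.isOpen.mem_nhds hxW)

omit h hx h0 in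
lemma _root_.SingularMetric.IsMainOn.contDiffAt_radical (hN : IsMainOn G τ W N R) (hxW : x ∈ W) :
    ContDiffAt ℝ ∞ R x := hN.smooth_radical.contDiffAt (hN.isOpen.mem_nhds hxW)

include hN hxW

omit h0 in
lemma contDiffAt_orthField (v : E) : ContDiffAt ℝ ∞ (orthField G N v) x := by
  have hNx := hN.contDiffAt_normal hxW
  exact contDiffAt_const.sub ((((h.contDiffAt hx).clm_apply contDiffAt_const).clm_apply hNx).smul
    hNx)

omit hx in
lemma orthField_tangent (v : E) : fderiv ℝ τ x (orthField G N v x) = 0 := by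
  rw [h.tangent_iff (hN.main x hxW h0)]
  simp [orthField, (hN.main x hxW h0).unit]

omit hx in
lemma orthField_eq {v : E} (hv : fderiv ℝ τ x v = 0) : orthField G N v x = v := by
  rw [orthField, (h.tangent_iff (hN.main x hxW h0)).1 hv, zero_smul, sub_zero]

omit hx h0 in
lemma orthField_tangent_eventually (v : E) :
    ∀ᶠ y in 𝓝 x, τ y = 0 → fderiv ℝ τ y (orthField G N v y) = 0 := by
  filter_upwards [hN.isOpen.mem_nhds hxW] with y hy hy0
  exact h.orthField_tangent hy0 hN hy v

variable [FiniteDimensional ℝ E]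

/-- The normal component of the covariant derivative of a tangent field. -/
lemma normal_covariant_derivative {V : E → E} (hV : ContDiffAt ℝ ∞ V x)
    (hVt : ∀ᶠ y in 𝓝 x, τ y = 0 → fderiv ℝ τ y (V y) = 0) {v : E} (hv : fderiv ℝ τ x v = 0) :
    G x (fderiv ℝ V x v) (N x) + christ G x v (V x) (N x) = secondForm G N x v (V x) := by
  have hNx := hN.contDiffAt_normal hxW
  -- `⟨V, N⟩` vanishes along the hypersurface, so its tangential derivative does too; compatibility
  -- with the metric moves the derivative from `V` to `N`.
  have h1 := h.fderiv_eq_zero_of_tangent hx h0 (φ := fun y ↦ G y (V y) (N y))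
    ((((h.contDiffAt hx).clm_apply hV).clm_apply hNx).of_le (by simp)) (by
      filter_upwards [hVt, hN.isOpen.mem_nhds hxW] with y hy hyW hy0
      exact (h.tangent_iff (hN.main y hyW hy0)).1 (hy hy0)) hv
  rw [(((h.differentiableAt hx).hasFDerivAt.clm_apply
    (hV.differentiableAt (by simp)).hasFDerivAt).clm_apply
    (hNx.differentiableAt (by simp)).hasFDerivAt).fderiv] at h1
  simp at h1
  have h2 := h.christ_add_flip hx v (V x) (N x)
  rw [secondForm, h.symm x (fderiv ℝ N x v)]
  linarith

/-- Extended to tangent fields, `v` and `w` give the second form as a normal component of a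
covariant derivative. The difference of the two orders is the normal component of a bracket of
tangent fields, which is 0. -/
lemma secondForm_symm {v w : E} (hv : fderiv ℝ τ x v = 0) (hw : fderiv ℝ τ x w = 0) :
    secondForm G N x v w = secondForm G N x w v := by
  have hm := hN.main x hxW h0
  have e1 := h.normal_covariant_derivative hx h0 hN hxW (h.contDiffAt_orthField hx hN hxW w)
    (h.orthField_tangent_eventually hN hxW w) hv
  have e2 := h.normal_covariant_derivative hx h0 hN hxW (h.contDiffAt_orthField hx hN hxW v)
    (h.orthField_tangent_eventually hN hxW v) hw
  have e3 := h.bracket_tangent hx h0 (h.contDiffAt_orthField hx hN hxW v)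
    (h.contDiffAt_orthField hx hN hxW w) (h.orthField_tangent_eventually hN hxW v)
    (h.orthField_tangent_eventually hN hxW w)
  rw [h.tangent_iff hm, h.orthField_eq h0 hN hxW hv, h.orthField_eq h0 hN hxW hw, map_sub,
    sub_apply] at e3
  rw [h.orthField_eq h0 hN hxW hv] at e2
  rw [h.orthField_eq h0 hN hxW hw] at e1
  rw [← e1, ← e2, h.christ_comm hx v w]
  linarith

/-- The curvature of the planes spanned by a screen vector and the main radical vector. -/
lemma curv_screen
    (hII : ∀ y ∈ W, τ y = 0 → ∀ a b, fderiv ℝ τ y a = 0 → fderiv ℝ τ y b = 0 →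
      christ G y a b (R y) = 0) {s : E} (hs : fderiv ℝ τ x s = 0)
    (hsn : christ G x s (N x) (R x) = 0) {z z' : E} (hz : G x z = christ G x (R x) s)
    (hz' : G x z' = christ G x s s) :
    curvLin G x s (R x) s (R x) - christ G x s (R x) z + christ G x (R x) (R x) z' =
      -secondForm G N x s s := by
  have hm := hN.main x hxW h0
  have hNx := hN.contDiffAt_normal hxW
  have hRx := hN.contDiffAt_radical hxW
  have hch := hasFDerivAt_christ (h.contDiffAt hx)
  have hch' := h.contDiffAt_christ hx
  have hrt := h.radical_tangent hx h0 hm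
  have hRt : ∀ᶠ y in 𝓝 x, τ y = 0 → fderiv ℝ τ y (R y) = 0 := by
    filter_upwards [hN.isOpen.mem_nhds hxW, h.isOpen.mem_nhds hx] with y hy hyΩ hy0
    exact h.radical_tangent hyΩ hy0 (hN.main y hy hy0)
  set S := orthField G N s with hSdef
  have hS : ContDiffAt ℝ ∞ S x := h.contDiffAt_orthField hx hN hxW s
  have hSx : S x = s := h.orthField_eq h0 hN hxW hs
  have hSt := h.orthField_tangent_eventually hN hxW s
  have dS := (hS.differentiableAt (by simp)).hasFDerivAt
  have dR := (hRx.differentiableAt (by simp)).hasFDerivAt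
  -- derivatives of `II` along the hypersurface
  have hev : ∀ᶠ y in 𝓝 x, y ∈ W := hN.isOpen.mem_nhds hxW
  have e1 := h.fderiv_eq_zero_of_tangent hx h0 (φ := fun y ↦ christ G y (R y) (S y) (R y))
    ((((hch'.clm_apply hRx).clm_apply hS).clm_apply hRx).of_le (by simp)) (by
      filter_upwards [hRt, hSt, hev] with y h1 h2 h3 h4
      exact hII y h3 h4 _ _ (h1 h4) (h2 h4)) hs
  rw [(((hch.clm_apply dR).clm_apply dS).clm_apply dR).fderiv] at e1
  have e2 := h.fderiv_eq_zero_of_tangent hx h0 (φ := fun y ↦ christ G y (S y) (S y) (R y))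
    ((((hch'.clm_apply hS).clm_apply hS).clm_apply hRx).of_le (by simp)) (by
      filter_upwards [hSt, hev] with y h2 h3 h4
      exact hII y h3 h4 _ _ (h2 h4) (h2 h4)) hrt
  rw [(((hch.clm_apply dS).clm_apply dS).clm_apply dR).fderiv] at e2
  simp [hSx] at e1 e2
  -- the covariant derivatives of `R`
  have hcov : ∀ v w, fderiv ℝ τ x v = 0 → fderiv ℝ τ x w = 0 ∨ w = N x →
      G x (fderiv ℝ R x v) w + christ G x v (R x) w = -christ G x v w (R x) := by
    intro v w hv _
    have e := h.fderiv_eq_zero_of_tangent hx h0 (φ := fun y ↦ G y (R y) w)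
      ((((h.contDiffAt hx).clm_apply hRx).clm_apply contDiffAt_const).of_le (by simp)) (by
        filter_upwards [hev] with y hy hy0
        rw [(hN.main y hy hy0).radical]
        rfl) hv
    rw [(((h.differentiableAt hx).hasFDerivAt.clm_apply dR).clm_apply
      (hasFDerivAt_const w x)).fderiv] at e
    simp at e
    have := h.christ_add_flip hx v (R x) w
    linarith
  obtain ⟨y', hy'⟩ := h.exists_repr hx h0 (α := christ G x (R x) (R x)) (by
    intro r hr
    obtain ⟨c, rfl⟩ := h.radical_span hx h0 hm hr
    rw [map_smul, hII x hxW h0 _ _ hrt hrt, smul_zero])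
  -- `fderiv ℝ R x s + z` represents the covariant derivative of `R` along `s`. It is orthogonal to
  -- tangent vectors because `II` vanishes there, and to `N` because `s` is in the screen; hence it
  -- is radical.
  have hsr : G x (fderiv ℝ R x s + z) = 0 := by
    refine hm.clm_ext (fun w hw ↦ ?_) ?_
    · rw [map_add, add_apply, hz, h.christ_comm hx, hcov s w hs (.inl hw),
        hII x hxW h0 _ _ hs hw]
      simp
    · rw [map_add, add_apply, hz, h.christ_comm hx, hcov s _ hs (.inr rfl), hsn]
      simp
  -- The same argument along `R`, except that the normalization leaves −1 on the normal: the
  -- covariant derivative of `R` along itself is `-N` modulo the radical.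
  have hrr : G x (fderiv ℝ R x (R x) + y' + N x) = 0 := by
    refine hm.clm_ext (fun w hw ↦ ?_) ?_
    · rw [map_add, map_add, add_apply, add_apply, hy', hcov _ w hrt (.inl hw),
        hII x hxW h0 _ _ hrt hw, hm.normal w hw]
      simp
    · rw [map_add, map_add, add_apply, add_apply, hy', hcov _ _ hrt (.inr rfl), hm.normalized,
        hm.unit]
      simp
  obtain ⟨c₁, hc₁⟩ := h.radical_span hx h0 hm hsr
  obtain ⟨c₂, hc₂⟩ := h.radical_span hx h0 hm hrr
  have f1 : christ G x s (R x) z = -christ G x s (R x) (fderiv ℝ R x s) := by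
    rw [show z = c₁ • R x - fderiv ℝ R x s by rw [← hc₁]; abel, map_sub, map_smul,
      hII x hxW h0 _ _ hs hrt, smul_zero, zero_sub]
  have f2 : christ G x (R x) (R x) z' =
      -christ G x s s (N x) - christ G x s s (fderiv ℝ R x (R x)) := by
    rw [← hy', h.symm, hz', show y' = c₂ • R x - fderiv ℝ R x (R x) - N x by rw [← hc₂]; abel,
      map_sub, map_sub, map_smul, hII x hxW h0 _ _ hs hs]
    simp
    ring
  -- the bracket of `S` and `R`
  have f3 : christ G x (fderiv ℝ R x s) s (R x) - christ G x (fderiv ℝ S x (R x)) s (R x) = 0 := by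
    have := h.bracket_tangent hx h0 hS hRx hSt hRt
    rw [hSx] at this
    have := hII x hxW h0 _ s this hs
    simpa using this
  -- This contributes `⟨D_s S, N⟩`, which together with the term `Γ(s, s, N)` of `f2` makes up the
  -- second fundamental form.
  have f4 : christ G x (R x) (fderiv ℝ S x s) (R x) = G x (fderiv ℝ S x s) (N x) :=
    h.christ_radical_radical' hx h0 hm _
  -- The derivative of `S` need not be tangent, but its normal part does not matter: `II (s, N) = 0`
  -- for `s` in the screen.
  have f5 : christ G x s (fderiv ℝ S x (R x)) (R x) = 0 := by
    have : fderiv ℝ τ x (fderiv ℝ S x (R x) - G x (fderiv ℝ S x (R x)) (N x) • N x) = 0 := by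
      rw [h.tangent_iff hm]
      simp [hm.unit]
    have := hII x hxW h0 s _ hs this
    rw [map_sub, map_smul] at this
    simpa [hsn] using this
  have f6 := h.normal_covariant_derivative hx h0 hN hxW hS hSt hs
  rw [hSx] at f6
  rw [f1, f2, ← f6, curvLin]
  rw [h.christ_comm hx (R x) s] at e1
  linarith [h.christ_comm hx (fderiv ℝ R x s) s (R x)]

end IsSingularMetric
end LocalCurvature
end SingularMetric

namespace SingularMetric

/-! ### The Koszul formula and the curvature tensor in coordinates -/

section CurvatureFormula

set_option synthInstance.maxHeartbeats 400000
set_option maxHeartbeats 1000000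

variable {E : Type} [NormedAddCommGroup E] [NormedSpace ℝ E]

variable {G : E → E →L[ℝ] E →L[ℝ] ℝ} {τ : E → ℝ} {K : E → (E →L[ℝ] ℝ) →L[ℝ] E} {Ω : Set E}

/-- The Koszul formula in coordinates. -/
lemma koszul_formula {x : E} (hG : ∀ y v w, G y v w = G y w v) (hd : DifferentiableAt ℝ G x)
    {A B C : E → E} (hA : DifferentiableAt ℝ A x) (hB : DifferentiableAt ℝ B x)
    (hC : DifferentiableAt ℝ C x) :
    (1 / 2) * (fderiv ℝ (fun y ↦ G y (B y) (C y)) x (A x)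
      + fderiv ℝ (fun y ↦ G y (C y) (A y)) x (B x) - fderiv ℝ (fun y ↦ G y (A y) (B y)) x (C x)
      + G x (fderiv ℝ B x (A x) - fderiv ℝ A x (B x)) (C x)
      - G x (fderiv ℝ C x (B x) - fderiv ℝ B x (C x)) (A x)
      + G x (fderiv ℝ A x (C x) - fderiv ℝ C x (A x)) (B x)) =
      G x (fderiv ℝ B x (A x)) (C x) + christ G x (A x) (B x) (C x) := by
  have key : ∀ {B C : E → E}, DifferentiableAt ℝ B x → DifferentiableAt ℝ C x → ∀ v,
      fderiv ℝ (fun y ↦ G y (B y) (C y)) x v =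
        fderiv ℝ G x v (B x) (C x) + G x (fderiv ℝ B x v) (C x) + G x (B x) (fderiv ℝ C x v) := by
    intro B C hB hC v
    rw [((hd.hasFDerivAt.clm_apply hB.hasFDerivAt).clm_apply hC.hasFDerivAt).fderiv]
    simp
    ring
  rw [key hB hC, key hC hA, key hA hB, christ_apply]
  simp only [map_sub, sub_apply, hG x (B x), hG x (C x), hG x (A x),
    fderiv_form_symm hG hd (B x) (C x)]
  ring

namespace IsSingularMetric

variable (h : IsSingularMetric G τ K Ω) {x : E} (hx : x ∈ Ω)

include h hx

/-- The covariant curvature in terms of Christoffel symbols. -/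
lemma curvature_formula {A B C : E → E} (hA : ContDiffAt ℝ ∞ A x) (hB : ContDiffAt ℝ ∞ B x)
    (hC : ContDiffAt ℝ ∞ C x) {Z Z' : E → E} (hZ : DifferentiableAt ℝ Z x)
    (hZ' : DifferentiableAt ℝ Z' x)
    (hBC : ∀ᶠ y in 𝓝 x, G y (Z y) = G y (fderiv ℝ C y (B y)) + christ G y (B y) (C y))
    (hAC : ∀ᶠ y in 𝓝 x, G y (Z' y) = G y (fderiv ℝ C y (A y)) + christ G y (A y) (C y)) (d : E) :
    ((G x (fderiv ℝ Z x (A x)) d + christ G x (A x) (Z x) d)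
      - (G x (fderiv ℝ Z' x (B x)) d + christ G x (B x) (Z' x) d)
      - (G x (fderiv ℝ C x (fderiv ℝ B x (A x) - fderiv ℝ A x (B x))) d
        + christ G x (fderiv ℝ B x (A x) - fderiv ℝ A x (B x)) (C x) d)) * τ x =
      curvNum G τ K x (A x) (B x) (C x) d := by
  have hG := (h.differentiableAt hx).hasFDerivAt
  have hch := hasFDerivAt_christ (h.contDiffAt hx)
  have dC : ContDiffAt ℝ ∞ (fderiv ℝ C) x := hC.fderiv_right (by simp)
  have dC' := (dC.differentiableAt (by simp)).hasFDerivAt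
  have cC := (hC.differentiableAt (by simp)).hasFDerivAt
  -- the second covariant derivative
  have key : ∀ {A B Z : E → E}, ContDiffAt ℝ ∞ A x → ContDiffAt ℝ ∞ B x →
      DifferentiableAt ℝ Z x →
      (∀ᶠ y in 𝓝 x, G y (Z y) = G y (fderiv ℝ C y (B y)) + christ G y (B y) (C y)) →
      (G x (fderiv ℝ Z x (A x)) d + christ G x (A x) (Z x) d) * τ x =
        (G x (fderiv ℝ (fderiv ℝ C) x (A x) (B x)) d + G x (fderiv ℝ C x (fderiv ℝ B x (A x))) d
          + koszulMap E (fderiv ℝ (fderiv ℝ G) x (A x)) (B x) (C x) d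
          + christ G x (fderiv ℝ B x (A x)) (C x) d + christ G x (B x) (fderiv ℝ C x (A x)) d
          + christ G x (A x) (fderiv ℝ C x (B x)) d) * τ x
          - christ G x (A x) d (K x (christ G x (B x) (C x))) := by
    intro A B Z hA hB hZ hBC
    have cB := (hB.differentiableAt (by simp)).hasFDerivAt
    have h1 := (hG.clm_apply hZ.hasFDerivAt).clm_apply (hasFDerivAt_const d x)
    have h2 := ((hG.clm_apply (dC'.clm_apply cB)).clm_apply (hasFDerivAt_const d x)).add
      (((hch.clm_apply cB).clm_apply cC).clm_apply (hasFDerivAt_const d x))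
    have h3 := congrArg (fun L ↦ L (A x)) (h1.unique (h2.congr_of_eventuallyEq (by
      filter_upwards [hBC] with y hy
      simp [hy])))
    simp at h3
    -- Applying `K` to the equation that defines `Z` gives `τ` times the Christoffel part of `Z`, so
    -- the quadratic term can be written without `Z` and without dividing by `τ`.
    have hw : K x (christ G x (B x) (C x)) = τ x • (Z x - fderiv ℝ C x (B x)) := by
      rw [← h.cof_self, map_sub, hBC.self_of_nhds, add_sub_cancel_left]
    have h4 := h.christ_add_flip hx (A x) (Z x) d
    have h5 := h.christ_add_flip hx (A x) (fderiv ℝ C x (B x)) d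
    rw [hw]
    simp only [map_smul, map_sub, smul_eq_mul]
    linear_combination τ x * h3 + τ x * h4 - τ x * h5
  have k1 := key hA hB hZ hBC
  have k2 := key hB hA hZ' hAC
  have hs : fderiv ℝ (fderiv ℝ C) x (A x) (B x) = fderiv ℝ (fderiv ℝ C) x (B x) (A x) :=
    (hC.isSymmSndFDerivAt (by
      rw [minSmoothness_of_isRCLikeNormedField]
      exact WithTop.coe_le_coe.2 (le_top : (2 : ℕ∞) ≤ ⊤))).eq _ _
  rw [sub_mul, sub_mul, k1, k2, hs, curvNum, curvLin]
  simp only [map_sub, sub_apply]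
  ring

end IsSingularMetric
end CurvatureFormula
end SingularMetric

namespace SingularMetric

section Link

set_option linter.unusedSectionVars false
set_option synthInstance.maxHeartbeats 400000
set_option maxHeartbeats 1000000

variable {m : ℕ} {M : Type*} [TopologicalSpace M] [ChartedSpace (EuclideanSpace ℝ (Fin m)) M]
  [IsManifold (𝓡 m) ∞ M] {e : OpenPartialHomeomorph M (EuclideanSpace ℝ (Fin m))}
  {g : SymTensor m M}

local notation "𝔼" => EuclideanSpace ℝ (Fin m)

/-! ### Geometric objects in coordinates -/

/-- The vector field `A` is smooth at `p`. -/
def FieldSmoothAt (A : Field m M) (p : M) : Prop :=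
  ContMDiffAt (𝓡 m) (𝓡 m).tangent ∞ (fun p ↦ (⟨p, A p⟩ : TangentBundle (𝓡 m) M)) p

lemma SmoothOn.fieldSmoothAt {U : Set M} {A : Field m M} (hA : SmoothOn U A) (hU : IsOpen U)
    {p : M} (hp : p ∈ U) : FieldSmoothAt A p :=
  ContMDiffOn.contMDiffAt hA (hU.mem_nhds hp)

lemma FieldSmoothAt.coordField {A : Field m M} (he : e ∈ IsManifold.maximalAtlas (𝓡 m) ∞ M)
    {x : 𝔼} (hx : x ∈ e.target) (hA : FieldSmoothAt A (e.symm x)) :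
    ContDiffAt ℝ ∞ (coordField e A) x := coordField_smoothAt he hx hA

lemma ofCoord_coordField (he : e ∈ IsManifold.maximalAtlas (𝓡 m) ∞ M) (A : Field m M) {p : M}
    (hp : p ∈ e.source) : ofCoord e (coordField e A) p = A p := by
  obtain ⟨x, hx, rfl⟩ : ∃ x ∈ e.target, e.symm x = p := ⟨e p, e.map_source hp, e.left_inv hp⟩
  rw [← frame_coordField he (ofCoord e (coordField e A)) hx, coordField_ofCoord he _ hx,
    frame_coordField he A hx]

lemma fieldSmoothAt_of_coordField (he : e ∈ IsManifold.maximalAtlas (𝓡 m) ∞ M) {A : Field m M}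
    {x : 𝔼} (hx : x ∈ e.target) (hA : ContDiffAt ℝ ∞ (coordField e A) x) :
    FieldSmoothAt A (e.symm x) := by
  have hp : e.symm x ∈ e.source := e.map_target hx
  have h1 := ofCoord_smoothAt he hp (a := coordField e A) (by rwa [e.right_inv hx])
  refine h1.congr_of_eventuallyEq ?_
  filter_upwards [e.open_source.mem_nhds hp] with q hq
  rw [ofCoord_coordField he A hq]

lemma localExt_smooth {p : M} (v : TangentSpace (𝓡 m) p) : FieldSmoothAt (localExt v) p :=
  FiberBundle.contMDiffAt_extend (𝓡 m) (EuclideanSpace ℝ (Fin m)) v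

lemma localExt_self {p : M} (v : TangentSpace (𝓡 m) p) : localExt v p = v :=
  FiberBundle.extend_apply_self _ v

lemma coordField_localExt (he : e ∈ IsManifold.maximalAtlas (𝓡 m) ∞ M) {x : 𝔼}
    (hx : x ∈ e.target) (a : 𝔼) : coordField e (localExt (frame e x a)) x = a := by
  apply frame_injective he hx
  rw [frame_coordField he _ hx, localExt_self]

lemma gramDet_eq (x : 𝔼) : gramDet g e x = (gram (coordMetric g e x)).det := rfl

lemma inner_smoothAt {A B : Field m M} {p : M} (hA : FieldSmoothAt A p) (hB : FieldSmoothAt B p) :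
    ContMDiffAt (𝓡 m) 𝓘(ℝ, ℝ) ∞ (fun q ↦ g.val q (A q) (B q)) p := by
  have := ContMDiffAt.clm_bundle_apply₂ (F₁ := 𝔼) (F₂ := 𝔼) (F₃ := ℝ)
    (E₁ := TangentSpace (𝓡 m)) (E₂ := TangentSpace (𝓡 m)) (E₃ := Bundle.Trivial M ℝ)
    (b := fun q : M ↦ q) (ψ := g.val) (g.smooth p) hA hB
  rw [Bundle.contMDiffAt_totalSpace] at this
  simpa using! this.2

variable (he : e ∈ IsManifold.maximalAtlas (𝓡 m) ∞ M) {x : EuclideanSpace ℝ (Fin m)}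
  (hx : x ∈ e.target)

include he hx

lemma coordMetric_contDiffAt : ContDiffAt ℝ ∞ (coordMetric g e) x :=
  (coordMetric_smoothOn g he).contDiffAt (e.open_target.mem_nhds hx)

lemma val_frame_right (A : Field m M) (b : 𝔼) :
    g.val (e.symm x) (A (e.symm x)) (frame e x b) = coordMetric g e x (coordField e A x) b := by
  rw [coordMetric_apply, frame_coordField he A hx]

lemma dInner_coord {A B C : Field m M} (hB : FieldSmoothAt B (e.symm x))
    (hC : FieldSmoothAt C (e.symm x)) :
    dInner g A B C (e.symm x) = fderiv ℝ
      (fun y ↦ coordMetric g e y (coordField e B y) (coordField e C y)) x (coordField e A x) := by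
  rw [dInner, ← frame_coordField he A hx,
    mvfderiv_frame he hx ((inner_smoothAt hB hC).mdifferentiableAt (by simp))]
  have : (fun q ↦ g.val q (B q) (C q)) ∘ e.symm =ᶠ[𝓝 x]
      fun y ↦ coordMetric g e y (coordField e B y) (coordField e C y) := by
    filter_upwards [e.open_target.mem_nhds hx] with y hy
    rw [coordMetric_coordField g he B C hy]
    rfl
  rw [this.fderiv_eq]

/-- The dual connection in coordinates. -/
lemma dual_coord {A B C : Field m M} (hA : FieldSmoothAt A (e.symm x))
    (hB : FieldSmoothAt B (e.symm x)) (hC : FieldSmoothAt C (e.symm x)) :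
    dual g A B C (e.symm x) =
      coordMetric g e x (fderiv ℝ (coordField e B) x (coordField e A x)) (coordField e C x) +
        christ (coordMetric g e) x (coordField e A x) (coordField e B x) (coordField e C x) := by
  rw [← koszul_formula (coordMetric_symm g e)
    ((coordMetric_contDiffAt he hx).differentiableAt (by simp))
    ((hA.coordField he hx).differentiableAt (by simp))
    ((hB.coordField he hx).differentiableAt (by simp))
    ((hC.coordField he hx).differentiableAt (by simp)), dual, dInner_coord he hx hB hC,
    dInner_coord he hx hC hA, dInner_coord he hx hA hB, ← coordField_mlieBracket he hx hA hB,
    ← coordField_mlieBracket he hx hB hC, ← coordField_mlieBracket he hx hC hA]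
  simp only [coordMetric_coordField g he _ _ hx]

lemma mem_rad_iff (a : 𝔼) : frame e x a ∈ rad g (e.symm x) ↔ coordMetric g e x a = 0 := by
  constructor
  · intro h
    ext b
    have h' : g.val (e.symm x) (frame e x a) = 0 := h
    rw [coordMetric_apply, h']
    rfl
  · intro h
    refine LinearMap.mem_ker.2 (ContinuousLinearMap.ext fun v ↦ ?_)
    obtain ⟨b, rfl⟩ := frame_surjective he hx v
    exact congrArg (fun L ↦ L b) h

lemma mem_sing_iff : e.symm x ∈ sing g ↔ gramDet g e x = 0 := by
  rw [gramDet_eq, ← not_iff_not, ← ne_eq, det_gram_ne_zero_iff (coordMetric_symm g e x)]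
  change ¬ ¬ rad g (e.symm x) = ⊥ ↔ _
  rw [not_not, Submodule.eq_bot_iff]
  constructor
  · intro h a ha
    have := h _ ((mem_rad_iff he hx a).2 ha)
    exact frame_injective he hx (this.trans (map_zero _).symm)
  · intro h v hv
    obtain ⟨a, rfl⟩ := frame_surjective he hx v
    rw [h a ((mem_rad_iff he hx a).1 hv), map_zero]

lemma smoothAt_comp_chart {f : 𝔼 → ℝ} (hf : ContDiffAt ℝ ∞ f x) :
    ContMDiffAt (𝓡 m) 𝓘(ℝ, ℝ) ∞ (fun p ↦ f (e p)) (e.symm x) := by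
  have hp : e.symm x ∈ e.source := e.map_target hx
  have h1 := (contMDiffOn_of_mem_maximalAtlas he).contMDiffAt (e.open_source.mem_nhds hp)
  have h2 : ContMDiffAt (𝓡 m) 𝓘(ℝ, ℝ) ∞ f (e (e.symm x)) := by
    rw [e.right_inv hx]
    exact contMDiffAt_iff_contDiffAt.2 hf
  exact h2.comp _ h1

lemma contDiffAt_comp_symm {f : M → ℝ} (hf : ContMDiffAt (𝓡 m) 𝓘(ℝ, ℝ) ∞ f (e.symm x)) :
    ContDiffAt ℝ ∞ (fun y ↦ f (e.symm y)) x := by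
  rw [← contMDiffAt_iff_contDiffAt]
  exact hf.comp x ((contMDiffOn_symm_of_mem_maximalAtlas he).contMDiffAt (e.open_target.mem_nhds hx))

omit hx in
lemma gramDet_smoothOn : ContDiffOn ℝ ∞ (gramDet g e) e.target :=
  contDiffOn_det fun k l ↦ contDiffOn_gram (coordMetric_smoothOn g he) k l

lemma eventually_symm {P : M → Prop} (hP : ∀ᶠ q in 𝓝 (e.symm x), P q) :
    ∀ᶠ y in 𝓝 x, P (e.symm y) :=
  (e.continuousAt_symm hx).eventually hP

/-- A tangent vector to the singular hypersurface annihilates the discriminant. -/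
lemma IsTangent.deriv_gramDet {a : 𝔼} (ha : IsTangent g (e.symm x) (frame e x a)) :
    fderiv ℝ (gramDet g e) x a = 0 := by
  have hp : e.symm x ∈ e.source := e.map_target hx
  have hs := (gramDet_smoothOn (g := g) he).contDiffAt (e.open_target.mem_nhds hx)
  have hf := smoothAt_comp_chart he hx hs
  have := ha _ hf (by
    filter_upwards [e.open_source.mem_nhds hp] with q hq hqs
    rw [← mem_sing_iff he (e.map_source hq), e.left_inv hq]
    exact hqs)
  rw [mvfderiv_frame he hx (hf.mdifferentiableAt (by simp))] at this
  rw [← this]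
  congr 1
  refine Filter.EventuallyEq.fderiv_eq ?_
  filter_upwards [e.open_target.mem_nhds hx] with y hy
  simp [e.right_inv hy]

omit hx in
/-- The coordinate representation of a transverse Riemann-Lorentz space with tangent radical. -/
lemma isSingularMetric_coord (hg : IsTransverseRiemannLorentz g) :
    IsSingularMetric (coordMetric g e) (gramDet g e) (fun x ↦ cof (coordMetric g e x))
      e.target := by
  have hrad : ∀ y ∈ e.target, gramDet g e y = 0 → fderiv ℝ (gramDet g e) y ≠ 0 := by
    intro y hy hy0
    have := hg.transverse e he (e.symm y) (e.map_target hy) ((mem_sing_iff he hy).2 hy0)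
    rwa [e.right_inv hy] at this
  refine ⟨e.open_target, coordMetric_smoothOn g he, gramDet_smoothOn he,
    contDiffOn_cof (coordMetric_smoothOn g he), coordMetric_symm g e,
    fun x ↦ cof_self _ (coordMetric_symm g e x),
    fun x ↦ self_cof _ (coordMetric_symm g e x), fun y hy hy0 ↦ ?_, fun y hy hy0 r hr0 hr ↦ ?_,
    hrad, fun y hy hy0 v ↦ ?_, fun y hy hy0 r hr ↦ ?_⟩
  · by_contra! hcon
    rw [gramDet_eq] at hy0
    refine (det_gram_ne_zero_iff (coordMetric_symm g e y)).2 (fun v hv ↦ ?_) hy0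
    by_contra hv0
    exact hcon v hv0 hv
  · exact radical_structure (coordMetric_symm g e y)
      ((coordMetric_contDiffAt he hy).differentiableAt (by simp)) hy0 (hrad y hy hy0) hr0 hr
  -- Negativity on the constant vector `v` is an open condition, and Riemannian points accumulate at
  -- every singular point.
  · by_contra! hneg
    have hc : ContinuousAt (fun z ↦ coordMetric g e z v v) y :=
      (((coordMetric_contDiffAt he hy).clm_apply contDiffAt_const).clm_apply
        contDiffAt_const).continuousAt
    have hv0 : v ≠ 0 := by rintro rfl; simp at hneg
    have h1 : ∀ᶠ z in 𝓝 y, coordMetric g e z v v < 0 ∧ z ∈ e.target :=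
      (hc.eventually (gt_mem_nhds hneg)).and (e.open_target.mem_nhds hy)
    have hp : e.symm y ∈ e.source := e.map_target hy
    have h2 : ∀ᶠ q in 𝓝 (e.symm y), (coordMetric g e (e q) v v < 0 ∧ e q ∈ e.target) ∧
        q ∈ e.source := by
      rw [← e.right_inv hy] at h1
      exact ((e.continuousAt hp).eventually h1).and (e.open_source.eventually_mem hp)
    obtain ⟨q, hq4, ⟨hq1, hq2⟩, hq3⟩ := ((mem_closure_iff_frequently.1
      (hg.crossing (e.symm y) ((mem_sing_iff he hy).2 hy0)).1).and_eventually h2).exists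
    have : IsRiemannAt g (e.symm (e q)) := by rw [e.left_inv hq3]; exact hq4
    have := this (frame e (e q) v) fun h ↦ hv0 (frame_injective he hq2 (h.trans (map_zero _).symm))
    rw [← coordMetric_apply] at this
    linarith
  · exact IsTangent.deriv_gramDet he hy (hg.tangent _ ((mem_sing_iff he hy).2 hy0) _
      ((mem_rad_iff he hy r).2 hr))

variable (hg : IsTransverseRiemannLorentz g)

include hg

/-- The definition of tangency tests against all functions that vanish on the hypersurface; by
Lagrange multipliers the discriminant alone suffices. -/
lemma isTangent_iff (hs : e.symm x ∈ sing g) (a : 𝔼) :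
    IsTangent g (e.symm x) (frame e x a) ↔ fderiv ℝ (gramDet g e) x a = 0 := by
  refine ⟨fun h ↦ h.deriv_gramDet he hx, fun h f hf hf0 ↦ ?_⟩
  rw [mvfderiv_frame he hx (hf.mdifferentiableAt (by simp))]
  refine (isSingularMetric_coord he hg).fderiv_eq_zero_of_tangent hx
    ((mem_sing_iff he hx).1 hs) ((contDiffAt_comp_symm he hx hf).of_le (by simp)) ?_ h
  filter_upwards [eventually_symm he hx hf0, e.open_target.mem_nhds hx] with y hy hye hy0
  exact hy ((mem_sing_iff he hye).2 hy0)

/-- The defining property of the Levi-Civita connection, in coordinates. -/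
lemma nabla_coord {A B : Field m M} (hs : e.symm x ∉ sing g) (hA : FieldSmoothAt A (e.symm x))
    (hB : FieldSmoothAt B (e.symm x)) :
    coordMetric g e x (coordField e (nabla g A B) x) =
      coordMetric g e x (fderiv ℝ (coordField e B) x (coordField e A x)) +
        christ (coordMetric g e) x (coordField e A x) (coordField e B x) := by
  have h := isSingularMetric_coord he hg
  have h0 : gramDet g e x ≠ 0 := fun h0 ↦ hs ((mem_sing_iff he hx).2 h0)
  have hd : ∀ c : 𝔼, dual g A B (localExt (frame e x c)) (e.symm x) =
      coordMetric g e x (fderiv ℝ (coordField e B) x (coordField e A x)) c +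
        christ (coordMetric g e) x (coordField e A x) (coordField e B x) c := by
    intro c
    rw [dual_coord he hx hA hB (localExt_smooth _), coordField_localExt he hx]
  -- Off the hypersurface `cof / τ` inverts the metric, which solves the equation in the definition
  -- of `nabla`, so its default value 0 does not occur.
  have hex : ∃ v : TangentSpace (𝓡 m) (e.symm x), ∀ c : TangentSpace (𝓡 m) (e.symm x),
      g.val (e.symm x) v c = dual g A B (localExt c) (e.symm x) := by
    refine ⟨frame e x (fderiv ℝ (coordField e B) x (coordField e A x) + (gramDet g e x)⁻¹ •
      cof (coordMetric g e x) (christ (coordMetric g e) x (coordField e A x) (coordField e B x))),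
      fun c ↦ ?_⟩
    obtain ⟨c, rfl⟩ := frame_surjective he hx c
    rw [hd, ← coordMetric_apply, map_add, map_smul, h.self_cof, smul_smul, inv_mul_cancel₀ h0,
      one_smul, add_apply]
  ext c
  rw [← val_frame_right he hx, nabla, dif_pos hex, hex.choose_spec, hd, add_apply]

lemma coordField_nabla {A B : Field m M} (hs : e.symm x ∉ sing g)
    (hA : FieldSmoothAt A (e.symm x)) (hB : FieldSmoothAt B (e.symm x)) :
    coordField e (nabla g A B) x = fderiv ℝ (coordField e B) x (coordField e A x) +
      (gramDet g e x)⁻¹ • cof (coordMetric g e x)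
        (christ (coordMetric g e) x (coordField e A x) (coordField e B x)) := by
  have h := isSingularMetric_coord he hg
  have h0 : gramDet g e x ≠ 0 := fun h0 ↦ hs ((mem_sing_iff he hx).2 h0)
  have := congrArg (cof (coordMetric g e x)) (nabla_coord he hx hg hs hA hB)
  rw [map_add, h.cof_self, h.cof_self] at this
  apply smul_right_injective _ h0
  simp only [smul_add, smul_smul, mul_inv_cancel₀ h0, one_smul]
  exact this

lemma eventually_notMem_sing (hs : e.symm x ∉ sing g) : ∀ᶠ y in 𝓝 x, e.symm y ∉ sing g := by
  have h0 : gramDet g e x ≠ 0 := fun h0 ↦ hs ((mem_sing_iff he hx).2 h0)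
  have hc := ((gramDet_smoothOn (g := g) he).contDiffAt (e.open_target.mem_nhds hx)).continuousAt
  filter_upwards [hc.eventually_ne h0, e.open_target.mem_nhds hx] with y hy hye hys
  exact hy ((mem_sing_iff he hye).1 hys)

lemma coordField_nabla_smooth {U : Set M} (hU : IsOpen U) (hxU : e.symm x ∈ U)
    {A B : Field m M} (hs : e.symm x ∉ sing g) (hA : SmoothOn U A) (hB : SmoothOn U B) :
    ContDiffAt ℝ ∞ (coordField e (nabla g A B)) x := by
  have h := isSingularMetric_coord he hg
  have h0 : gramDet g e x ≠ 0 := fun h0 ↦ hs ((mem_sing_iff he hx).2 h0)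
  have hev : coordField e (nabla g A B) =ᶠ[𝓝 x] fun y ↦
      fderiv ℝ (coordField e B) y (coordField e A y) + (gramDet g e y)⁻¹ •
        cof (coordMetric g e y)
          (christ (coordMetric g e) y (coordField e A y) (coordField e B y)) := by
    filter_upwards [e.open_target.mem_nhds hx, eventually_notMem_sing he hx hg hs,
      eventually_symm he hx (hU.eventually_mem hxU)] with y hy hys hyU
    exact coordField_nabla he hy hg hys (hA.fieldSmoothAt hU hyU) (hB.fieldSmoothAt hU hyU)
  refine ContDiffAt.congr_of_eventuallyEq ?_ hev
  have hA' := (hA.fieldSmoothAt hU hxU).coordField he hx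
  have hB' := (hB.fieldSmoothAt hU hxU).coordField he hx
  exact ((hB'.fderiv_right (m := ∞) (by simp)).clm_apply hA').add
    (((h.contDiffAt_disc hx).inv h0).smul ((h.contDiffAt_cof hx).clm_apply
      (((h.contDiffAt_christ hx).clm_apply hA').clm_apply hB')))

/-- The curvature in coordinates. -/
lemma curv_coord {U : Set M} (hU : IsOpen U) (hxU : e.symm x ∈ U) {A B C D : Field m M}
    (hs : e.symm x ∉ sing g) (hA : SmoothOn U A) (hB : SmoothOn U B) (hC : SmoothOn U C) :
    curv g A B C D (e.symm x) * gramDet g e x =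
      curvNum (coordMetric g e) (gramDet g e) (fun x ↦ cof (coordMetric g e x)) x
        (coordField e A x) (coordField e B x) (coordField e C x) (coordField e D x) := by
  have h := isSingularMetric_coord he hg
  have hA' := hA.fieldSmoothAt hU hxU
  have hB' := hB.fieldSmoothAt hU hxU
  have hC' := hC.fieldSmoothAt hU hxU
  have cA := hA'.coordField he hx
  have cB := hB'.coordField he hx
  have cC := hC'.coordField he hx
  have hZ := coordField_nabla_smooth he hx hg hU hxU hs hB hC
  have hZ' := coordField_nabla_smooth he hx hg hU hxU hs hA hC
  have hev : ∀ {A : Field m M}, SmoothOn U A → ∀ᶠ y in 𝓝 x,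
      coordMetric g e y (coordField e (nabla g A C) y) =
      coordMetric g e y (fderiv ℝ (coordField e C) y (coordField e A y)) +
        christ (coordMetric g e) y (coordField e A y) (coordField e C y) := by
    intro A hA
    filter_upwards [e.open_target.mem_nhds hx, eventually_notMem_sing he hx hg hs,
      eventually_symm he hx (hU.eventually_mem hxU)] with y hy hys hyU
    exact nabla_coord he hy hg hys (hA.fieldSmoothAt hU hyU) (hC.fieldSmoothAt hU hyU)
  have hbr : FieldSmoothAt (VectorField.mlieBracket (𝓡 m) A B) (e.symm x) := by
    apply fieldSmoothAt_of_coordField he hx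
    have : coordField e (VectorField.mlieBracket (𝓡 m) A B) =ᶠ[𝓝 x] fun y ↦
        fderiv ℝ (coordField e B) y (coordField e A y) -
          fderiv ℝ (coordField e A) y (coordField e B y) := by
      filter_upwards [e.open_target.mem_nhds hx,
        eventually_symm he hx (hU.eventually_mem hxU)] with y hy hyU
      exact coordField_mlieBracket he hy (hA.fieldSmoothAt hU hyU) (hB.fieldSmoothAt hU hyU)
    refine ContDiffAt.congr_of_eventuallyEq ?_ this
    exact ((cB.fderiv_right (m := ∞) (by simp)).clm_apply cA).sub
      ((cA.fderiv_right (m := ∞) (by simp)).clm_apply cB)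
  rw [← h.curvature_formula hx cA cB cC (hZ.differentiableAt (by simp))
    (hZ'.differentiableAt (by simp)) (hev hB) (hev hA)]
  congr 1
  have key : ∀ {A Y : Field m M}, FieldSmoothAt A (e.symm x) → FieldSmoothAt Y (e.symm x) →
      g.val (e.symm x) (nabla g A Y (e.symm x)) (D (e.symm x)) =
      coordMetric g e x (fderiv ℝ (coordField e Y) x (coordField e A x)) (coordField e D x) +
        christ (coordMetric g e) x (coordField e A x) (coordField e Y x) (coordField e D x) := by
    intro A Y hA hY
    rw [← coordMetric_coordField g he _ _ hx, nabla_coord he hx hg hs hA hY, add_apply]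
  rw [curv, map_sub, map_sub, sub_apply, sub_apply,
    key hA' (fieldSmoothAt_of_coordField he hx hZ),
    key hB' (fieldSmoothAt_of_coordField he hx hZ'), key hbr hC',
    coordField_mlieBracket he hx hA' hB']

end Link
end SingularMetric

namespace SingularMetric

section MainPair

set_option linter.unusedSectionVars false
set_option synthInstance.maxHeartbeats 400000
set_option maxHeartbeats 1000000

variable {m : ℕ} {M : Type*} [TopologicalSpace M] [ChartedSpace (EuclideanSpace ℝ (Fin m)) M]
  [IsManifold (𝓡 m) ∞ M] {e : OpenPartialHomeomorph M (EuclideanSpace ℝ (Fin m))}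
  {g : SymTensor m M}

local notation "𝔼" => EuclideanSpace ℝ (Fin m)

/-! ### The main normal and the main radical field -/

variable (he : e ∈ IsManifold.maximalAtlas (𝓡 m) ∞ M) {x : EuclideanSpace ℝ (Fin m)}
  (hx : x ∈ e.target) (hg : IsTransverseRiemannLorentz g)

include he in
lemma smoothOn_ofCoord {W : Set 𝔼} {a : 𝔼 → 𝔼} (hW : IsOpen W) (ha : ContDiffOn ℝ ∞ a W) :
    SmoothOn (e.source ∩ e ⁻¹' W) (ofCoord e a) := fun _ hp ↦
  (ofCoord_smoothAt he hp.1 (ha.contDiffAt (hW.mem_nhds hp.2))).contMDiffWithinAt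

include he in
lemma SmoothOn.coordField {U : Set M} (hU : IsOpen U) {A : Field m M} (hA : SmoothOn U A) :
    ContDiffOn ℝ ∞ (coordField e A) (e.target ∩ e.symm ⁻¹' U) := fun _ hx ↦
  ((hA.fieldSmoothAt hU hx.2).coordField he hx.1).contDiffWithinAt

include he hx in
lemma ofCoord_symm (a : 𝔼 → 𝔼) : ofCoord e a (e.symm x) = frame e x (a x) := by
  rw [← frame_coordField he (ofCoord e a) hx, coordField_ofCoord he _ hx]

include he hx hg

lemma isMainAt_coordField {U : Set M} (hU : IsOpen U) {N R : Field m M} (h : IsMainPair g U N R)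
    (hxU : e.symm x ∈ U) (hs : e.symm x ∈ sing g) :
    IsMainAt (coordMetric g e) (gramDet g e) x (coordField e N x) (coordField e R x) := by
  have hN := h.smooth_normal.fieldSmoothAt hU hxU
  have hR := h.smooth_radical.fieldSmoothAt hU hxU
  have hrad : coordMetric g e x (coordField e R x) = 0 := by
    rw [← mem_rad_iff he hx, frame_coordField he _ hx]
    exact h.radical _ ⟨hxU, hs⟩
  have hrad' : ∀ a, coordMetric g e x a (coordField e R x) = 0 := fun a ↦ by
    rw [coordMetric_symm, hrad]; rfl
  refine ⟨hrad, ?_, fun v hv ↦ ?_, ?_, ?_⟩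
  · rw [coordMetric_coordField g he _ _ hx]
    exact h.unit _ ⟨hxU, hs⟩
  · rw [← val_frame_right he hx]
    exact h.normal _ ⟨hxU, hs⟩ _ ((isTangent_iff he hx hg hs v).2 hv)
  · have := h.isotropic _ ⟨hxU, hs⟩
    rwa [dual_coord he hx hN hN hR, hrad', zero_add] at this
  · have := h.normalized _ ⟨hxU, hs⟩
    rw [dual_coord he hx hR hN hR, hrad', zero_add] at this
    linarith

omit hx in
lemma isMainPair_ofCoord {W : Set 𝔼} {N R : 𝔼 → 𝔼} (hW : W ⊆ e.target)
    (h : IsMainOn (coordMetric g e) (gramDet g e) W N R) :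
    IsMainPair g (e.source ∩ e ⁻¹' W) (ofCoord e N) (ofCoord e R) := by
  have hsm := isSingularMetric_coord he hg
  have key : ∀ p ∈ (e.source ∩ e ⁻¹' W) ∩ sing g, ∃ y ∈ W, e.symm y = p ∧
      IsMainAt (coordMetric g e) (gramDet g e) y (N y) (R y) := by
    rintro p ⟨⟨hp, hpW⟩, hps⟩
    refine ⟨e p, hpW, e.left_inv hp, h.main _ hpW ?_⟩
    rw [← mem_sing_iff he (hW hpW), e.left_inv hp]
    exact hps
  have hsN := smoothOn_ofCoord he h.isOpen h.smooth_normal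
  have hsR := smoothOn_ofCoord he h.isOpen h.smooth_radical
  have hopen : IsOpen (e.source ∩ e ⁻¹' W) := e.isOpen_inter_preimage h.isOpen
  refine ⟨hsN, hsR, fun p hp v hv ↦ ?_, fun p hp ↦ ?_, fun p hp ↦ ?_, fun p hp ↦ ?_, fun p hp ↦ ?_⟩
  · obtain ⟨y, hy, rfl, hm⟩ := key p hp
    obtain ⟨a, rfl⟩ := frame_surjective he (hW hy) v
    rw [ofCoord_symm he (hW hy), ← coordMetric_apply]
    exact hm.normal a ((isTangent_iff he (hW hy) hg hp.2 a).1 hv)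
  · obtain ⟨y, hy, rfl, hm⟩ := key p hp
    rw [ofCoord_symm he (hW hy), ← coordMetric_apply]
    exact hm.unit
  · obtain ⟨y, hy, rfl, hm⟩ := key p hp
    rw [ofCoord_symm he (hW hy), mem_rad_iff he (hW hy)]
    exact hm.radical
  · obtain ⟨y, hy, rfl, hm⟩ := key p hp
    rw [dual_coord he (hW hy) (hsN.fieldSmoothAt hopen hp.1) (hsN.fieldSmoothAt hopen hp.1)
      (hsR.fieldSmoothAt hopen hp.1), coordField_ofCoord he _ (hW hy),
      coordField_ofCoord he _ (hW hy), coordMetric_symm, hm.radical, hm.isotropic]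
    simp
  · obtain ⟨y, hy, rfl, hm⟩ := key p hp
    rw [dual_coord he (hW hy) (hsR.fieldSmoothAt hopen hp.1) (hsN.fieldSmoothAt hopen hp.1)
      (hsR.fieldSmoothAt hopen hp.1), coordField_ofCoord he _ (hW hy),
      coordField_ofCoord he _ (hW hy), coordMetric_symm, hm.radical, hm.normalized]
    simp

-- The fields constructed in a chart transport to the manifold, so on the hypersurface the choice in
-- `mainPair` is genuine and not the default 0.
omit he hx in
lemma mainPair_spec {p : M} (hp : p ∈ sing g) :
    ∃ U : Set M, IsOpen U ∧ p ∈ U ∧ IsMainPair g U (mainPair g p).1 (mainPair g p).2 := by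
  have hex : ∃ F : Field m M × Field m M, ∃ U : Set M, IsOpen U ∧ p ∈ U ∧
      IsMainPair g U F.1 F.2 := by
    have he := IsManifold.chart_mem_maximalAtlas (I := 𝓡 m) (n := ∞) p
    have hps := mem_chart_source 𝔼 p
    have hpt := mem_chart_target 𝔼 p
    obtain ⟨W, hW, hxW, N, R, hNR⟩ := (isSingularMetric_coord he hg).exists_main hpt
      ((mem_sing_iff he hpt).1 (by rwa [(chartAt 𝔼 p).left_inv hps]))
    exact ⟨(ofCoord _ N, ofCoord _ R), _, (chartAt 𝔼 p).isOpen_inter_preimage hNR.isOpen,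
      ⟨hps, hxW⟩, isMainPair_ofCoord he hg hW hNR⟩
  rw [mainPair, dif_pos hex]
  exact hex.choose_spec

/-- The main pair in coordinates. -/
lemma isMainOn_mainPair (hs : e.symm x ∈ sing g) : ∃ W ⊆ e.target, x ∈ W ∧
    IsMainOn (coordMetric g e) (gramDet g e) W (coordField e (mainPair g (e.symm x)).1)
      (coordField e (mainPair g (e.symm x)).2) := by
  obtain ⟨U, hU, hxU, h⟩ := mainPair_spec hg hs
  refine ⟨e.target ∩ e.symm ⁻¹' U, Set.inter_subset_left, ⟨hx, hxU⟩,
    e.symm.isOpen_inter_preimage hU, h.smooth_normal.coordField he hU,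
    h.smooth_radical.coordField he hU, fun y hy hy0 ↦ ?_⟩
  exact isMainAt_coordField he hy.1 hg hU h hy.2 ((mem_sing_iff he hy.1).2 hy0)

omit hx hg he in
/-- The main normal in coordinates. -/
noncomputable def coordNormal (g : SymTensor m M)
    (e : OpenPartialHomeomorph M (EuclideanSpace ℝ (Fin m)))
    (x : EuclideanSpace ℝ (Fin m)) : EuclideanSpace ℝ (Fin m) :=
  coordField e (mainPair g (e.symm x)).1 x

omit hx hg he in
/-- The main radical vector in coordinates. -/
noncomputable def coordRadical (g : SymTensor m M)
    (e : OpenPartialHomeomorph M (EuclideanSpace ℝ (Fin m)))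
    (x : EuclideanSpace ℝ (Fin m)) : EuclideanSpace ℝ (Fin m) :=
  coordField e (mainPair g (e.symm x)).2 x

lemma isMainAt_coord (hs : e.symm x ∈ sing g) :
    IsMainAt (coordMetric g e) (gramDet g e) x (coordNormal g e x) (coordRadical g e x) := by
  obtain ⟨W, -, hxW, h⟩ := isMainOn_mainPair he hx hg hs
  exact h.main x hxW ((mem_sing_iff he hx).1 hs)

omit hg in
lemma frame_coordNormal : frame e x (coordNormal g e x) = mainNormal g (e.symm x) :=
  frame_coordField he _ hx

omit hg in
lemma frame_coordRadical : frame e x (coordRadical g e x) = mainRadical g (e.symm x) :=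
  frame_coordField he _ hx

/-- The derivative of the extension of the second argument is paired with a radical vector and drops
out. This is why `II` is tensorial. -/
lemma formII_coord (hs : e.symm x ∈ sing g) (a b : 𝔼) :
    formII g (e.symm x) (frame e x a) (frame e x b) =
      christ (coordMetric g e) x a b (coordRadical g e x) := by
  obtain ⟨U, hU, hxU, h⟩ := mainPair_spec hg hs
  have hm := isMainAt_coord he hx hg hs
  rw [formII, dual_coord he hx (localExt_smooth _) (localExt_smooth _)
    (h.smooth_radical.fieldSmoothAt hU hxU), coordField_localExt he hx, coordField_localExt he hx]
  change coordMetric g e x _ (coordRadical g e x) + _ = _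
  rw [coordMetric_symm, hm.radical]
  exact zero_add _

lemma formH_coord (hs : e.symm x ∈ sing g) (a b : 𝔼) :
    formH g (e.symm x) (frame e x a) (frame e x b) =
      secondForm (coordMetric g e) (coordField e (mainPair g (e.symm x)).1) x a b := by
  obtain ⟨U, hU, hxU, h⟩ := mainPair_spec hg hs
  rw [formH, dual_coord he hx (localExt_smooth _) (h.smooth_normal.fieldSmoothAt hU hxU)
    (localExt_smooth _), coordField_localExt he hx, coordField_localExt he hx]
  rfl

lemma formH_radical_coord (hs : e.symm x ∈ sing g) (a : 𝔼) :
    formH g (e.symm x) (frame e x a) (mainRadical g (e.symm x)) =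
      -christ (coordMetric g e) x a (coordNormal g e x) (coordRadical g e x) := by
  have hm := isMainAt_coord he hx hg hs
  rw [← frame_coordRadical he hx, formH_coord he hx hg hs, secondForm, coordMetric_symm,
    hm.radical]
  simp [coordNormal]

lemma isScreen_coord (hs : e.symm x ∈ sing g) (a : 𝔼) :
    IsScreen g (e.symm x) (frame e x a) ↔ fderiv ℝ (gramDet g e) x a = 0 ∧
      christ (coordMetric g e) x a (coordNormal g e x) (coordRadical g e x) = 0 := by
  rw [IsScreen, isTangent_iff he hx hg hs, formH_radical_coord he hx hg hs, neg_eq_zero]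

omit hg in
lemma nu_coord (a : 𝔼) : nu g (e.symm x) (frame e x a) =
    coordMetric g e x a (coordNormal g e x) := by
  rw [nu, ← frame_coordNormal he hx, coordMetric_apply]

lemma rho_coord (hs : e.symm x ∈ sing g) (a : 𝔼) : rho g (e.symm x) (frame e x a) =
    christ (coordMetric g e) x a (coordNormal g e x) (coordRadical g e x) := by
  have hm := isMainAt_coord he hx hg hs
  rw [rho, ← frame_coordNormal he hx, ← map_smul, ← map_sub, formH_radical_coord he hx hg hs,
    map_sub, map_smul, sub_apply, sub_apply, smul_apply, smul_apply, hm.isotropic]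
  simp

lemma screenPart_coord (hs : e.symm x ∈ sing g) (a : 𝔼) :
    screenPart g (e.symm x) (frame e x a) = frame e x (a -
      coordMetric g e x a (coordNormal g e x) • coordNormal g e x -
      christ (coordMetric g e) x a (coordNormal g e x) (coordRadical g e x) •
        coordRadical g e x) := by
  rw [screenPart, rho_coord he hx hg hs, nu_coord he hx, ← frame_coordNormal he hx,
    ← frame_coordRadical he hx, ← map_smul, ← map_smul, ← map_sub, ← map_sub]

end MainPair
end SingularMetric

namespace SingularMetric

section DegeneratePlanes

set_option synthInstance.maxHeartbeats 400000
set_option maxHeartbeats 1000000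

/-! ### Degenerate planes in coordinates -/

lemma rank_eq_two_iff (A : Matrix (Fin 2) (Fin 2) ℝ) : A.rank = 2 ↔ A.det ≠ 0 := by
  rw [← isUnit_iff_ne_zero, ← Matrix.isUnit_iff_isUnit_det]
  refine ⟨fun h ↦ ?_, fun h ↦ by simpa using Matrix.rank_of_isUnit A h⟩
  rw [← Matrix.mulVec_surjective_iff_isUnit]
  have : LinearMap.range A.mulVecLin = ⊤ := Submodule.eq_top_of_finrank_eq (by
    change A.rank = _
    simp [h])
  exact LinearMap.range_eq_top.1 this

lemma rank_eq_one_iff_two (A : Matrix (Fin 2) (Fin 2) ℝ) : A.rank = 1 ↔ A.det = 0 ∧ A ≠ 0 := by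
  have h2 : A.rank ≤ 2 := by simpa using A.rank_le_card_width
  have h0 : A.rank = 0 ↔ A = 0 := by
    rw [Matrix.rank, Submodule.finrank_eq_zero, LinearMap.range_eq_bot]
    refine ⟨fun h ↦ Matrix.ext fun i j ↦ ?_, fun h ↦ by rw [h]; exact Matrix.mulVecLin_zero⟩
    simpa using congrFun (LinearMap.congr_fun h (Pi.single j 1)) i
  have h3 := (rank_eq_two_iff A).not
  rw [not_not] at h3
  rw [← h3, ne_eq, ← h0]
  omega

lemma finrank_span_pair {V : Type*} [AddCommGroup V] [Module ℝ V] {u v : V} {α β : ℝ}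
    (h : α • u + β • v = 0) (hαβ : α ≠ 0 ∨ β ≠ 0) (huv : u ≠ 0 ∨ v ≠ 0) :
    Module.finrank ℝ (Submodule.span ℝ {u, v}) = 1 := by
  wlog hα : α ≠ 0 generalizing u v α β
  · rw [Set.pair_comm]
    exact this (by rwa [add_comm]) hαβ.symm huv.symm (hαβ.resolve_left hα)
  have hu : u = (-(β / α)) • v := by
    have : α⁻¹ • (α • u + β • v) = 0 := by rw [h, smul_zero]
    rw [smul_add, smul_smul, smul_smul, inv_mul_cancel₀ hα, one_smul] at this
    rw [neg_smul, ← add_eq_zero_iff_eq_neg, ← this, div_eq_inv_mul]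
  have hv : v ≠ 0 := by
    rintro rfl
    simp at hu
    simp [hu] at huv
  rw [Submodule.span_insert_eq_span (by
    rw [hu]
    exact Submodule.smul_mem _ _ (Submodule.mem_span_singleton_self v))]
  exact finrank_span_singleton hv

variable {E : Type} [NormedAddCommGroup E] [NormedSpace ℝ E]

variable {G : E → E →L[ℝ] E →L[ℝ] ℝ} {τ : E → ℝ} {K : E → (E →L[ℝ] ℝ) →L[ℝ] E} {Ω : Set E}

/-- The component of `v` in the screen. -/
noncomputable def screenProj (G : E → E →L[ℝ] E →L[ℝ] ℝ) (x n r v : E) : E :=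
  v - G x v n • n - christ G x v n r • r

namespace IsSingularMetric

variable (h : IsSingularMetric G τ K Ω) {x : E} (hx : x ∈ Ω) (h0 : τ x = 0) {n r : E}
  (hm : IsMainAt G τ x n r)

include h hx h0 hm

-- The projection is linear, and `r` has normal component 0 and radical component 1, so its screen
-- part is 0.
omit h hx h0 in
lemma _root_.SingularMetric.IsMainAt.screenProj_add_smul (a b : E) (α β : ℝ)
    (hr : r = α • a + β • b) :
    α • screenProj G x n r a + β • screenProj G x n r b = 0 := by
  have h1 : G x r n = 0 := by rw [hm.radical]; rfl
  have h2 := hm.normalized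
  have e1 : α * G x a n + β * G x b n = 0 := by
    rw [← h1, congrArg (fun v ↦ G x v n) hr]; simp
  have e2 : α * christ G x a n r + β * christ G x b n r = 1 := by
    rw [← h2, congrArg (fun v ↦ christ G x v n r) hr]; simp
  have : α • screenProj G x n r a + β • screenProj G x n r b = (α • a + β • b) -
      (α * G x a n + β * G x b n) • n - (α * christ G x a n r + β * christ G x b n r) • r := by
    simp only [screenProj]
    module
  rw [this, e1, e2, ← hr]
  simp

/-- The screen component of a vector that is orthogonal to the normal belongs to the screen. -/
lemma screenProj_mem {a : E} (ha : G x a n = 0) :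
    fderiv ℝ τ x (screenProj G x n r a) = 0 ∧
      christ G x (screenProj G x n r a) n r = 0 := by
  have hat := (h.tangent_iff hm).2 ha
  simp [screenProj, ha, h.radical_tangent hx h0 hm, hm.normalized, hat]

/-- If `II` vanishes on the screen, then it vanishes on all tangent vectors. -/
lemma christ_tangent_eq_zero (hII : ∀ s t, fderiv ℝ τ x s = 0 → christ G x s n r = 0 →
      fderiv ℝ τ x t = 0 → christ G x t n r = 0 → christ G x s t r = 0) {a b : E}
    (ha : fderiv ℝ τ x a = 0) (hb : fderiv ℝ τ x b = 0) : christ G x a b r = 0 := by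
  have ha' := (h.tangent_iff hm).1 ha
  have hb' := (h.tangent_iff hm).1 hb
  obtain ⟨h1, h2⟩ := h.screenProj_mem hx h0 hm ha'
  obtain ⟨h3, h4⟩ := h.screenProj_mem hx h0 hm hb'
  have := hII _ _ h1 h2 h3 h4
  -- Restoring the radical parts of `a` and `b` adds only values of `II (·, r)`, which are normal
  -- components and vanish on tangent vectors.
  have e1 := h.christ_radical_radical hx h0 hm a
  have e2 := h.christ_radical_radical' hx h0 hm b
  have e3 := h.christ_radical_radical hx h0 hm r
  have e4 : G x r n = 0 := by rw [hm.radical]; rfl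
  simp only [screenProj, ha', hb', zero_smul, sub_zero, map_sub, map_smul, sub_apply, smul_apply,
    smul_eq_mul, e1, e2, e3, e4] at this
  linarith

/-- If the curvature of a degenerate plane extends, then the plane is tangent. -/
lemma normal_eq_zero_of_curvNum {a b : E} {α β : ℝ} (hr : r = α • a + β • b)
    (hc : curvNum G τ K x a b a b = 0) : G x a n = 0 ∧ G x b n = 0 := by
  obtain ⟨κ, hκ, hN⟩ := h.curvNum_eq hx h0 hm.radical_ne_zero hm.radical
  rw [hN] at hc
  have hc' := (mul_eq_zero.1 hc).resolve_left hκ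
  rw [h.christ_comm hx b a] at hc'
  have e1 := h.christ_radical_radical hx h0 hm a
  have e2 := h.christ_radical_radical hx h0 hm b
  have e3 : G x r n = 0 := by rw [hm.radical]; rfl
  -- `hc'` says that `II` has zero determinant on the plane. Contracting with `r` turns rows of `II`
  -- into normal components, and `f3` says that `r` has none; these relations force the squares of
  -- both normal components to vanish.
  have f1 : α * christ G x a a r + β * christ G x a b r = G x a n := by
    rw [← e1, congrArg (fun v ↦ christ G x a v r) hr]; simp
  have f2 : α * christ G x a b r + β * christ G x b b r = G x b n := by
    rw [← e2, ← h.christ_comm hx b a, congrArg (fun v ↦ christ G x b v r) hr]; simp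
  have f3 : α * G x a n + β * G x b n = 0 := by
    rw [← e3, congrArg (fun v ↦ G x v n) hr]; simp
  set X := christ G x a a r
  set Y := christ G x a b r
  set Z := christ G x b b r
  set p := G x a n
  set q := G x b n
  have g1 : X * q = Y * p := by rw [← f1, ← f2]; linear_combination β * hc'
  have g2 : Y * q = Z * p := by rw [← f1, ← f2]; linear_combination -α * hc'
  refine ⟨pow_eq_zero_iff (two_ne_zero) |>.1 ?_, pow_eq_zero_iff (two_ne_zero) |>.1 ?_⟩
  · linear_combination (-p) * f1 + X * f3 - β * g1
  · linear_combination (-q) * f2 + Z * f3 + α * g2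

omit h0 in
/-- The determinant of a degenerate plane has a nonzero differential. -/
lemma fderiv_planeDet_ne_zero {A B : E → E} (hA : DifferentiableAt ℝ A x)
    (hB : DifferentiableAt ℝ B x) {α β : ℝ} (hr : r = α • A x + β • B x)
    (hne : ¬ (G x (A x) (A x) = 0 ∧ G x (A x) (B x) = 0 ∧ G x (B x) (B x) = 0)) :
    fderiv ℝ (fun y ↦ G y (A y) (A y) * G y (B y) (B y) - G y (A y) (B y) * G y (B y) (A y)) x
      ≠ 0 := by
  intro hD
  have dG := (h.differentiableAt hx).hasFDerivAt
  have hd : ∀ {A B : E → E}, DifferentiableAt ℝ A x → DifferentiableAt ℝ B x →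
      HasFDerivAt (fun y ↦ G y (A y) (B y)) (fderiv ℝ (fun y ↦ G y (A y) (B y)) x) x :=
    fun hA hB ↦ ((dG.clm_apply hA.hasFDerivAt).clm_apply
      hB.hasFDerivAt).differentiableAt.hasFDerivAt
  have hv : ∀ {A B : E → E}, DifferentiableAt ℝ A x → DifferentiableAt ℝ B x →
      fderiv ℝ (fun y ↦ G y (A y) (B y)) x n = fderiv ℝ G x n (A x) (B x) +
        G x (fderiv ℝ A x n) (B x) + G x (A x) (fderiv ℝ B x n) := fun hA hB ↦ by
    rw [((dG.clm_apply hA.hasFDerivAt).clm_apply hB.hasFDerivAt).fderiv]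
    simp
    ring
  have hsymm : fderiv ℝ (fun y ↦ G y (B y) (A y)) x = fderiv ℝ (fun y ↦ G y (A y) (B y)) x := by
    congr 1
    ext y
    exact h.symm _ _ _
  replace hD := (((hd hA hA).mul (hd hB hB)).sub ((hd hA hB).mul (hd hB hA))).fderiv.symm.trans hD
  rw [hsymm] at hD
  have hDn := congrArg (fun L ↦ L n) hD
  have hrad : ∀ w, α * G x (A x) w + β * G x (B x) w = 0 := fun w ↦ by
    have : G x r w = 0 := by rw [hm.radical]; rfl
    rw [← this, hr]; simp
  have e1 := hrad (A x)
  have e2 := hrad (B x)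
  have hS := h.symm x (B x) (A x)
  -- This is the derivative along `n` of the square of `α A + β B` with coefficients frozen at `x`.
  -- The field equals `r` at `x`, so terms differentiating it vanish, leaving the derivative of `G`
  -- on `(r, r)`, which is 2.
  have key : α ^ 2 * fderiv ℝ (fun y ↦ G y (A y) (A y)) x n +
      2 * α * β * fderiv ℝ (fun y ↦ G y (A y) (B y)) x n +
      β ^ 2 * fderiv ℝ (fun y ↦ G y (B y) (B y)) x n = 2 := by
    have h1 : fderiv ℝ G x n r r = 2 := by
      have := hm.normalized
      rw [h.christ_right_left hx] at this
      linarith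
    rw [hr] at h1
    simp only [map_add, map_smul, add_apply, smul_apply, smul_eq_mul] at h1
    rw [fderiv_form_symm h.symm (h.differentiableAt hx) n (B x) (A x)] at h1
    rw [hv hA hA, hv hA hB, hv hB hB]
    have g1 := hrad (fderiv ℝ A x n)
    have g2 := hrad (fderiv ℝ B x n)
    rw [h.symm x (fderiv ℝ A x n) (A x), h.symm x (fderiv ℝ A x n) (B x),
      h.symm x (fderiv ℝ B x n) (B x)]
    linear_combination (2 * α) * g1 + (2 * β) * g2 + h1
  simp only [add_apply, sub_apply, smul_apply, smul_eq_mul, zero_apply] at hDn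
  rw [hS] at e1 hDn
  set P := fderiv ℝ (fun y ↦ G y (A y) (A y)) x n
  set Q := fderiv ℝ (fun y ↦ G y (A y) (B y)) x n
  set T := fderiv ℝ (fun y ↦ G y (B y) (B y)) x n
  -- As `r` is radical, the Gram matrix is a multiple of the square of `(β, -α)`, and the derivative
  -- of its determinant is that multiple times the expression in `key`. If the derivative vanishes,
  -- so does the Gram matrix.
  have hbb : G x (B x) (B x) = 0 := by
    linear_combination (α ^ 2 / 2) * hDn - T / 2 * (α * e1 - β * e2) + Q * α * e2 -
      G x (B x) (B x) / 2 * key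
  have haa : G x (A x) (A x) = 0 := by
    linear_combination (β ^ 2 / 2) * hDn - P / 2 * (β * e2 - α * e1) + Q * β * e1 -
      G x (A x) (A x) / 2 * key
  refine hne ⟨haa, ?_, hbb⟩
  by_contra hab
  simp only [haa, hbb, mul_zero, zero_add, add_zero, mul_eq_zero, hab, or_false] at e1 e2
  exact hm.radical_ne_zero (by simp [hr, e1, e2])

-- The expression has the symmetries of a curvature tensor, so on a plane it scales by the squared
-- determinant of the change of basis; the symmetry of `G` identifies the mixed terms.
omit h0 hm in
lemma plane_value {s zss zsr zrr : E} (hss : G x zss = christ G x s s)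
    (hsr : G x zsr = christ G x s r) (hrr : G x zrr = christ G x r r) (a b a' b' : ℝ) :
    curvLin G x (a • s + b • r) (a' • s + b' • r) (a • s + b • r) (a' • s + b' • r) -
      christ G x (a • s + b • r) (a' • s + b' • r)
        ((a * a') • zss + (a * b' + b * a') • zsr + (b * b') • zrr) +
      christ G x (a' • s + b' • r) (a' • s + b' • r)
        ((a * a) • zss + (2 * a * b) • zsr + (b * b) • zrr) =
    (a * b' - a' * b) ^ 2 * (curvLin G x s r s r - christ G x s r zsr + christ G x r r zss) := by
  rw [h.curvLin_plane hx]
  have e1 : christ G x s s zrr = christ G x r r zss := by rw [← hss, ← hrr, h.symm]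
  have e2 : christ G x s r zss = christ G x s s zsr := by rw [← hss, ← hsr, h.symm]
  have e3 : christ G x s r zrr = christ G x r r zsr := by rw [← hsr, ← hrr, h.symm]
  simp only [map_add, map_smul, add_apply, smul_apply, smul_eq_mul, h.christ_comm hx r s, e1, e2, e3]
  ring

end IsSingularMetric

end DegeneratePlanes
end SingularMetric

namespace SingularMetric

section Extension

set_option linter.unusedSectionVars false
set_option synthInstance.maxHeartbeats 400000
set_option maxHeartbeats 1000000

variable {m : ℕ} {M : Type*} [TopologicalSpace M] [ChartedSpace (EuclideanSpace ℝ (Fin m)) M]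
  [IsManifold (𝓡 m) ∞ M] {e : OpenPartialHomeomorph M (EuclideanSpace ℝ (Fin m))}
  {g : SymTensor m M}

local notation "𝔼" => EuclideanSpace ℝ (Fin m)

/-! ### Extension of functions across the singular hypersurface -/

lemma exists_chart (p : M) : ∃ e : OpenPartialHomeomorph M 𝔼,
    e ∈ IsManifold.maximalAtlas (𝓡 m) ∞ M ∧ ∃ x ∈ e.target, e.symm x = p :=
  ⟨chartAt 𝔼 p, IsManifold.chart_mem_maximalAtlas p, chartAt 𝔼 p p, mem_chart_target 𝔼 p,
    (chartAt 𝔼 p).left_inv (mem_chart_source 𝔼 p)⟩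

variable (hg : IsTransverseRiemannLorentz g)

/-- A smooth extension is unique. -/
lemma IsSmoothExt.unique (hg : IsTransverseRiemannLorentz g) {f F F' : M → ℝ} {V V' : Set M}
    (hV : IsOpen V) (hV' : IsOpen V')
    (hF : IsSmoothExt g V f F) (hF' : IsSmoothExt g V' f F') {p : M} (hp : p ∈ V) (hp' : p ∈ V') :
    F p = F' p := by
  by_cases hs : p ∈ sing g
  · obtain ⟨e, he, x, hx, rfl⟩ := exists_chart (m := m) p
    have h := isSingularMetric_coord he hg
    have hc := contDiffAt_comp_symm he hx (hF.1.contMDiffAt (hV.mem_nhds hp))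
    have hc' := contDiffAt_comp_symm he hx (hF'.1.contMDiffAt (hV'.mem_nhds hp'))
    refine h.eq_of_eventually (f := fun y ↦ F (e.symm y)) (g := fun y ↦ F' (e.symm y)) hx
      ((mem_sing_iff he hx).1 hs) hc.continuousAt hc'.continuousAt ?_
    filter_upwards [e.open_target.mem_nhds hx, eventually_symm he hx (hV.eventually_mem hp),
      eventually_symm he hx (hV'.eventually_mem hp')] with y hy hyV hyV' hy0
    have hys : e.symm y ∉ sing g := fun hs ↦ hy0 ((mem_sing_iff he hy).1 hs)
    rw [hF.2 _ ⟨hyV, hys⟩, hF'.2 _ ⟨hyV', hys⟩]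
  · rw [hF.2 _ ⟨hp, hs⟩, hF'.2 _ ⟨hp', hs⟩]

/-- Local smooth extensions can be glued. -/
lemma hasGoodLimit_of_local (hg : IsTransverseRiemannLorentz g) {f : M → ℝ} {U : Set M}
    (H : ∀ p ∈ U, ∃ V, IsOpen V ∧ p ∈ V ∧ HasGoodLimit g V f) : HasGoodLimit g U f := by
  classical
  choose! V hV hpV F hF using H
  have key : ∀ p ∈ U, ∀ q ∈ U, q ∈ V p → F q q = F p q := fun p hp q hq hqp ↦
    (hF q hq).unique hg (hV q hq) (hV p hp) (hF p hp) (hpV q hq) hqp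
  -- The diagonal choice is smooth because, by uniqueness, it agrees near `p` with the single
  -- function `F p`.
  refine ⟨fun p ↦ F p p, fun p hp ↦ ?_, fun p hp ↦ (hF p hp.1).2 p ⟨hpV p hp.1, hp.2⟩⟩
  have h1 := ((hF p hp).1.contMDiffAt ((hV p hp).mem_nhds (hpV p hp))).contMDiffWithinAt (s := U)
  refine h1.congr_of_eventuallyEq ?_ rfl
  filter_upwards [self_mem_nhdsWithin, mem_nhdsWithin_of_mem_nhds ((hV p hp).mem_nhds (hpV p hp))]
    with q hq hqp using key p hp q hq hqp

/-- Extension by division. -/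
lemma exists_local_extension (he : e ∈ IsManifold.maximalAtlas (𝓡 m) ∞ M) {U : Set M}
    (hU : IsOpen U) {x : 𝔼} (hx : x ∈ e.target)
    (hxU : e.symm x ∈ U) {f : M → ℝ} {D φ : 𝔼 → ℝ}
    (hD : ContDiffOn ℝ ∞ D (e.target ∩ e.symm ⁻¹' U))
    (hφ : ContDiffOn ℝ ∞ φ (e.target ∩ e.symm ⁻¹' U))
    (hfD : ∀ y ∈ e.target, e.symm y ∈ U → e.symm y ∉ sing g → f (e.symm y) * D y = φ y)
    (hD0 : ∀ y ∈ e.target, e.symm y ∈ U → (D y = 0 ↔ e.symm y ∈ sing g))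
    (hφ0 : ∀ y ∈ e.target, e.symm y ∈ U → e.symm y ∈ sing g → φ y = 0)
    (hdD : e.symm x ∈ sing g → fderiv ℝ D x ≠ 0) :
    ∃ V, IsOpen V ∧ e.symm x ∈ V ∧ HasGoodLimit g V f := by
  have hO : IsOpen (e.target ∩ e.symm ⁻¹' U) := e.symm.isOpen_inter_preimage hU
  obtain ⟨W, hWO, hW, hxW, h, hh, hDh⟩ : ∃ W ⊆ e.target ∩ e.symm ⁻¹' U, IsOpen W ∧ x ∈ W ∧
      ∃ h : 𝔼 → ℝ, ContDiffOn ℝ ∞ h W ∧ ∀ y ∈ W, φ y = D y • h y := by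
    -- At singular points Hadamard's lemma gives the quotient; elsewhere `D` is nonzero and division
    -- is direct.
    by_cases hs : e.symm x ∈ sing g
    · exact exists_eq_smul_of_regular hO ⟨hx, hxU⟩ hφ hD ((hD0 x hx hxU).2 hs) (hdD hs)
        fun y hy hy0 ↦ hφ0 y hy.1 hy.2 ((hD0 y hy.1 hy.2).1 hy0)
    · refine ⟨(e.target ∩ e.symm ⁻¹' U) ∩ D ⁻¹' {0}ᶜ, Set.inter_subset_left,
        hD.continuousOn.isOpen_inter_preimage hO isOpen_compl_singleton,
        ⟨⟨hx, hxU⟩, fun h ↦ hs ((hD0 x hx hxU).1 h)⟩, fun y ↦ φ y / D y,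
        (hφ.mono Set.inter_subset_left).div (hD.mono Set.inter_subset_left) fun y hy ↦ hy.2,
        fun y hy ↦ ?_⟩
      rw [smul_eq_mul, mul_div_cancel₀ _ hy.2]
  refine ⟨e.source ∩ e ⁻¹' W, e.isOpen_inter_preimage hW, ⟨e.map_target hx, ?_⟩,
    fun p ↦ h (e p), fun p hp ↦ ?_, fun p hp ↦ ?_⟩
  · rwa [Set.mem_preimage, e.right_inv hx]
  · obtain ⟨hpe, hpW⟩ := hp
    have := smoothAt_comp_chart he (hWO hpW).1 (hh.contDiffAt (hW.mem_nhds hpW))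
    rw [e.left_inv hpe] at this
    exact this.contMDiffWithinAt
  · obtain ⟨⟨hpe, hpW⟩, hps⟩ := hp
    obtain ⟨hpt, hpU⟩ := hWO hpW
    have hl := e.left_inv hpe
    have h1 := hfD _ hpt hpU (by rwa [hl])
    have h2 := hDh _ hpW
    rw [← h1, hl, smul_eq_mul, mul_comm] at h2
    refine (mul_left_cancel₀ (fun h ↦ hps ?_) h2).symm
    have := (hD0 _ hpt hpU).1 h
    rwa [hl] at this

/-! ### The curvature near the singular hypersurface -/

/-- The coordinate representation of `⟨R(A, B) C, D⟩`, multiplied by the discriminant. -/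
noncomputable def coordCurv (g : SymTensor m M)
    (e : OpenPartialHomeomorph M (EuclideanSpace ℝ (Fin m))) (A B C D : Field m M)
    (x : EuclideanSpace ℝ (Fin m)) : ℝ :=
  curvNum (coordMetric g e) (gramDet g e) (fun x ↦ cof (coordMetric g e x)) x
    (coordField e A x) (coordField e B x) (coordField e C x) (coordField e D x)

variable (he : e ∈ IsManifold.maximalAtlas (𝓡 m) ∞ M) {x : EuclideanSpace ℝ (Fin m)}
  (hx : x ∈ e.target) {U : Set M} (hU : IsOpen U) (hxU : e.symm x ∈ U)
  {A B C D : Field m M} (hA : SmoothOn U A) (hB : SmoothOn U B) (hC : SmoothOn U C)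
  (hD : SmoothOn U D)

include hg he hx hU hxU hA hB hC hD

lemma coordCurv_smoothAt : ContDiffAt ℝ ∞ (coordCurv g e A B C D) x :=
  (isSingularMetric_coord he hg).contDiffAt_curvNum hx ((hA.fieldSmoothAt hU hxU).coordField he hx)
    ((hB.fieldSmoothAt hU hxU).coordField he hx) ((hC.fieldSmoothAt hU hxU).coordField he hx)
    ((hD.fieldSmoothAt hU hxU).coordField he hx)

/-- The identity extends to the hypersurface by density. There it forces the numerator to vanish
whenever the curvature extends. -/
lemma IsSmoothExt.mul_gramDet {F : M → ℝ} (hF : IsSmoothExt g U (curv g A B C D) F) :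
    F (e.symm x) * gramDet g e x = coordCurv g e A B C D x := by
  have h := isSingularMetric_coord he hg
  by_cases hs : e.symm x ∈ sing g
  · have hc := contDiffAt_comp_symm he hx (hF.1.contMDiffAt (hU.mem_nhds hxU))
    refine h.eq_of_eventually (f := fun y ↦ F (e.symm y) * gramDet g e y) hx
      ((mem_sing_iff he hx).1 hs) (hc.continuousAt.mul (h.contDiffAt_disc hx).continuousAt)
      (coordCurv_smoothAt hg he hx hU hxU hA hB hC hD).continuousAt ?_
    filter_upwards [e.open_target.mem_nhds hx, eventually_symm he hx (hU.eventually_mem hxU)]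
      with y hy hyU hy0
    have hys : e.symm y ∉ sing g := fun hs ↦ hy0 ((mem_sing_iff he hy).1 hs)
    rw [hF.2 _ ⟨hyU, hys⟩, curv_coord he hy hg hU hyU hys hA hB hC, coordCurv]
  · rw [hF.2 _ ⟨hxU, hs⟩, curv_coord he hx hg hU hxU hs hA hB hC, coordCurv]

-- The curvature is a smooth numerator over a regular defining function, so local quotients exist
-- and glue.
omit hx hxU he in
lemma hasGoodLimit_curv (H : ∀ (e : OpenPartialHomeomorph M 𝔼),
    e ∈ IsManifold.maximalAtlas (𝓡 m) ∞ M → ∀ y ∈ e.target, e.symm y ∈ U → e.symm y ∈ sing g →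
      coordCurv g e A B C D y = 0) : HasGoodLimit g U (curv g A B C D) := by
  refine hasGoodLimit_of_local hg fun p hp ↦ ?_
  obtain ⟨e, he, x, hx, rfl⟩ := exists_chart (m := m) p
  have h := isSingularMetric_coord he hg
  refine exists_local_extension he hU hx hp (D := gramDet g e) (φ := coordCurv g e A B C D)
    (h.smooth_disc.mono Set.inter_subset_left) (fun y hy ↦ ?_) (fun y hy hyU hys ↦ ?_)
    (fun y hy _ ↦ (mem_sing_iff he hy).symm) (H e he) fun hs ↦
      h.regular x hx ((mem_sing_iff he hx).1 hs)
  · exact (coordCurv_smoothAt hg he hy.1 hU hy.2 hA hB hC hD).contDiffWithinAt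
  · exact curv_coord he hy hg hU hyU hys hA hB hC

/-- The value of the extended curvature on the singular hypersurface. -/
lemma IsSmoothExt.value (hs : e.symm x ∈ sing g) {F : M → ℝ}
    (hF : IsSmoothExt g U (curv g A B C D) F) {a b c d : 𝔼} (ha : coordField e A x = a)
    (hb : coordField e B x = b) (hc : coordField e C x = c) (hd : coordField e D x = d) {z z' : 𝔼}
    (hz : coordMetric g e x z = christ (coordMetric g e) x b c)
    (hz' : coordMetric g e x z' = christ (coordMetric g e) x a c)
    (had : ∀ r, coordMetric g e x r = 0 → christ (coordMetric g e) x a d r = 0)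
    (hbd : ∀ r, coordMetric g e x r = 0 → christ (coordMetric g e) x b d r = 0) :
    F (e.symm x) = curvLin (coordMetric g e) x a b c d - christ (coordMetric g e) x a d z +
      christ (coordMetric g e) x b d z' := by
  subst ha hb hc hd
  refine (isSingularMetric_coord he hg).curv_value (F := fun y ↦ F (e.symm y)) hx
    ((mem_sing_iff he hx).1 hs)
    ((hA.fieldSmoothAt hU hxU).coordField he hx) ((hB.fieldSmoothAt hU hxU).coordField he hx)
    ((hC.fieldSmoothAt hU hxU).coordField he hx) ((hD.fieldSmoothAt hU hxU).coordField he hx)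
    ((contDiffAt_comp_symm he hx (hF.1.contMDiffAt (hU.mem_nhds hxU))).differentiableAt (by simp))
    ?_ hz hz' had hbd
  filter_upwards [e.open_target.mem_nhds hx, eventually_symm he hx (hU.eventually_mem hxU)]
    with y hy hyU
  exact hF.mul_gramDet hg he hy hU hyU hA hB hC hD

end Extension

section Planes

set_option linter.unusedSectionVars false
set_option synthInstance.maxHeartbeats 400000
set_option maxHeartbeats 1000000

variable {m : ℕ} {M : Type*} [TopologicalSpace M] [ChartedSpace (EuclideanSpace ℝ (Fin m)) M]
  [IsManifold (𝓡 m) ∞ M] {e : OpenPartialHomeomorph M (EuclideanSpace ℝ (Fin m))}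
  {g : SymTensor m M}

local notation "𝔼" => EuclideanSpace ℝ (Fin m)

/-! ### Degenerate planes -/

variable (he : e ∈ IsManifold.maximalAtlas (𝓡 m) ∞ M) {x : EuclideanSpace ℝ (Fin m)}
  (hx : x ∈ e.target) (hg : IsTransverseRiemannLorentz g) {U : Set M} {A B : Field m M}

include he hx in
lemma planeGram_coord : planeGram g A B (e.symm x) =
    !![coordMetric g e x (coordField e A x) (coordField e A x),
      coordMetric g e x (coordField e A x) (coordField e B x);
      coordMetric g e x (coordField e B x) (coordField e A x),
      coordMetric g e x (coordField e B x) (coordField e B x)] := by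
  simp only [planeGram, coordMetric_coordField g he _ _ hx]

include he hx in
lemma planeGram_det_coord : (planeGram g A B (e.symm x)).det =
    coordMetric g e x (coordField e A x) (coordField e A x) *
      coordMetric g e x (coordField e B x) (coordField e B x) -
    coordMetric g e x (coordField e A x) (coordField e B x) *
      coordMetric g e x (coordField e B x) (coordField e A x) := by
  rw [planeGram_coord he hx, Matrix.det_fin_two_of]

include he hx in
lemma DegenerateAlong.exists_radical_eq (hAB : DegenerateAlong g U A B) (hxU : e.symm x ∈ U)
    (hs : e.symm x ∈ sing g) :
    ∃ α β : ℝ, coordRadical g e x = α • coordField e A x + β • coordField e B x := by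
  obtain ⟨α, β, h⟩ := Submodule.mem_span_pair.1 (hAB.radical_mem _ ⟨hxU, hs⟩)
  refine ⟨α, β, frame_injective he hx ?_⟩
  rw [frame_coordRadical he hx, map_add, map_smul, map_smul, frame_coordField he _ hx,
    frame_coordField he _ hx, h]

include he hx in
lemma DegenerateAlong.gram_ne_zero (hAB : DegenerateAlong g U A B) (hxU : e.symm x ∈ U)
    (hs : e.symm x ∈ sing g) :
    ¬ (coordMetric g e x (coordField e A x) (coordField e A x) = 0 ∧
      coordMetric g e x (coordField e A x) (coordField e B x) = 0 ∧
      coordMetric g e x (coordField e B x) (coordField e B x) = 0) := by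
  rintro ⟨h1, h2, h3⟩
  refine ((rank_eq_one_iff_two _).1 (hAB.rank_one _ ⟨hxU, hs⟩)).2 ?_
  rw [planeGram_coord he hx, h1, h2, coordMetric_symm, h2, h3]
  ext i j
  fin_cases i <;> fin_cases j <;> rfl

lemma DegenerateAlong.det_eq_zero (hAB : DegenerateAlong g U A B) {p : M} (hp : p ∈ U)
    (hs : p ∈ sing g) : (planeGram g A B p).det = 0 :=
  ((rank_eq_one_iff_two _).1 (hAB.rank_one _ ⟨hp, hs⟩)).1

include he hx in
lemma NuVanish.coord (hν : NuVanish g U A B) (hxU : e.symm x ∈ U)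
    (hs : e.symm x ∈ sing g) :
    coordMetric g e x (coordField e A x) (coordNormal g e x) = 0 ∧
      coordMetric g e x (coordField e B x) (coordNormal g e x) = 0 := by
  rw [← nu_coord he hx, ← nu_coord he hx, frame_coordField he _ hx, frame_coordField he _ hx]
  exact hν _ ⟨hxU, hs⟩

lemma planeGram_det_smooth (hU : IsOpen U) (hA : SmoothOn U A) (hB : SmoothOn U B) :
    ContMDiffOn (𝓡 m) 𝓘(ℝ, ℝ) ∞ (fun p ↦ (planeGram g A B p).det) U := by
  intro p hp
  have hA' := hA.fieldSmoothAt hU hp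
  have hB' := hB.fieldSmoothAt hU hp
  simp only [planeGram, Matrix.det_fin_two_of]
  exact (((inner_smoothAt hA' hA').mul (inner_smoothAt hB' hB')).sub
    ((inner_smoothAt hA' hB').mul (inner_smoothAt hB' hA'))).contMDiffWithinAt

include hg

/-- The sectional curvature extends if and only if the curvature extends by zero. -/
lemma hasGoodLimit_sec_iff (hU : IsOpen U) (hAB : DegenerateAlong g U A B)
    (hr : ∀ p ∈ U \ sing g, (planeGram g A B p).rank = 2) :
    HasGoodLimit g U (sec g A B) ↔ CurvVanishes g U A B A B := by
  have hdet := planeGram_det_smooth (g := g) hU hAB.smooth_left hAB.smooth_right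
  have hne : ∀ p ∈ U, p ∉ sing g → (planeGram g A B p).det ≠ 0 := fun p hp hs ↦
    (rank_eq_two_iff _).1 (hr p ⟨hp, hs⟩)
  constructor
  · rintro ⟨F, hF, hFs⟩
    refine ⟨fun p ↦ F p * (planeGram g A B p).det, ⟨hF.mul hdet, fun p hp ↦ ?_⟩, fun p hp ↦ ?_⟩
    · change F p * (planeGram g A B p).det = _
      rw [hFs p hp, sec, div_mul_cancel₀ _ (hne p hp.1 hp.2)]
    · simp only [hAB.det_eq_zero hp.1 hp.2, mul_zero]
  · rintro ⟨F, ⟨hF, hFc⟩, hF0⟩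
    refine hasGoodLimit_of_local hg fun p hp ↦ ?_
    obtain ⟨e, he, x, hx, rfl⟩ := exists_chart (m := m) p
    refine exists_local_extension he hU hx hp
      (D := fun y ↦ (planeGram g A B (e.symm y)).det) (φ := fun y ↦ F (e.symm y))
      (fun y hy ↦ ?_) (fun y hy ↦ ?_) (fun y hy hyU hys ↦ ?_) (fun y hy hyU ↦ ?_)
      (fun y _ hyU hys ↦ hF0 _ ⟨hyU, hys⟩) fun hs ↦ ?_
    · exact (contDiffAt_comp_symm he hy.1
        (hdet.contMDiffAt (hU.mem_nhds hy.2))).contDiffWithinAt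
    · exact (contDiffAt_comp_symm he hy.1 (hF.contMDiffAt (hU.mem_nhds hy.2))).contDiffWithinAt
    · rw [hFc _ ⟨hyU, hys⟩, sec, div_mul_cancel₀ _ (hne _ hyU hys)]
    · exact ⟨fun h ↦ by_contra fun hs ↦ hne _ hyU hs h, fun hs ↦ hAB.det_eq_zero hyU hs⟩
    · obtain ⟨α, β, hrad⟩ := hAB.exists_radical_eq he hx hp hs
      have h := isSingularMetric_coord he hg
      have := h.fderiv_planeDet_ne_zero hx (isMainAt_coord he hx hg hs)
        (((hAB.smooth_left.fieldSmoothAt hU hp).coordField he hx).differentiableAt (by simp))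
        (((hAB.smooth_right.fieldSmoothAt hU hp).coordField he hx).differentiableAt (by simp))
        hrad (hAB.gram_ne_zero he hx hp hs)
      refine fun h0 ↦ this ?_
      rw [← h0]
      refine Filter.EventuallyEq.fderiv_eq ?_
      filter_upwards [e.open_target.mem_nhds hx] with y hy
      rw [planeGram_det_coord he hy]

/-- An extension makes the numerator vanish, so `II` has zero determinant on a plane that contains
the radical; such a plane is tangent. -/
lemma nuVanish_of_curvVanishes (hU : IsOpen U) (hAB : DegenerateAlong g U A B)
    (hc : CurvVanishes g U A B A B) : NuVanish g U A B := by
  rintro p ⟨hp, hs⟩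
  obtain ⟨e, he, x, hx, rfl⟩ := exists_chart (m := m) p
  obtain ⟨F, hF, -⟩ := hc
  have h1 := hF.mul_gramDet hg he hx hU hp hAB.smooth_left hAB.smooth_right hAB.smooth_left
    hAB.smooth_right
  have h0 := (mem_sing_iff he hx).1 hs
  rw [h0, mul_zero] at h1
  obtain ⟨α, β, hrad⟩ := hAB.exists_radical_eq he hx hp hs
  have := (isSingularMetric_coord he hg).normal_eq_zero_of_curvNum hx h0
    (isMainAt_coord he hx hg hs) hrad h1.symm
  rwa [← nu_coord he hx, ← nu_coord he hx, frame_coordField he _ hx,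
    frame_coordField he _ hx] at this

/-- The screen components of a tangent degenerate plane span a line. -/
lemma finrank_span_screenPart (hAB : DegenerateAlong g U A B) (hν : NuVanish g U A B) {p : M}
    (hp : p ∈ U ∩ sing g) : Module.finrank ℝ
      (Submodule.span ℝ {screenPart g p (A p), screenPart g p (B p)}) = 1 := by
  obtain ⟨hp, hs⟩ := hp
  obtain ⟨e, he, x, hx, rfl⟩ := exists_chart (m := m) p
  have h0 := (mem_sing_iff he hx).1 hs
  have hm := isMainAt_coord he hx hg hs
  obtain ⟨α, β, hrad⟩ := hAB.exists_radical_eq he hx hp hs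
  obtain ⟨hνA, hνB⟩ := hν.coord he hx hp hs
  have hAp := screenPart_coord he hx hg hs (coordField e A x)
  have hBp := screenPart_coord he hx hg hs (coordField e B x)
  rw [frame_coordField he _ hx] at hAp hBp
  -- The relation `α A^S + β B^S = 0` comes from `R^S = 0`. If both screen parts were 0, the two
  -- fields would be radical and the Gram matrix would vanish.
  refine finrank_span_pair (α := α) (β := β) ?_ ?_ ?_
  · rw [hAp, hBp, ← map_smul, ← map_smul, ← map_add]
    have := hm.screenProj_add_smul _ _ α β hrad
    rw [screenProj, screenProj] at this
    rw [this, map_zero]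
  · by_contra! hcon
    exact hm.radical_ne_zero (by rw [hrad, hcon.1, hcon.2]; simp)
  · by_contra! hcon
    rw [hAp, hBp, hνA, hνB, zero_smul, sub_zero, sub_zero] at hcon
    have key : ∀ (a : 𝔼) (c : ℝ), frame e x (a - c • coordRadical g e x) = 0 →
        coordMetric g e x a = 0 := fun a c h ↦ by
      rw [sub_eq_zero.1 (frame_injective he hx (h.trans (map_zero _).symm)), map_smul, hm.radical,
        smul_zero]
    have kA := key _ _ hcon.1
    have kB := key _ _ hcon.2
    exact hAB.gram_ne_zero he hx hp hs ⟨by rw [kA]; rfl, by rw [kA]; rfl, by rw [kB]; rfl⟩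

end Planes
end SingularMetric

namespace SingularMetric

section Flatness

set_option linter.unusedSectionVars false
set_option synthInstance.maxHeartbeats 400000
set_option maxHeartbeats 1000000

variable {m : ℕ} {M : Type*} [TopologicalSpace M] [ChartedSpace (EuclideanSpace ℝ (Fin m)) M]
  [IsManifold (𝓡 m) ∞ M] {e : OpenPartialHomeomorph M (EuclideanSpace ℝ (Fin m))}
  {g : SymTensor m M}

local notation "𝔼" => EuclideanSpace ℝ (Fin m)

/-! ### `II`-flatness -/

variable (he : e ∈ IsManifold.maximalAtlas (𝓡 m) ∞ M) {x : EuclideanSpace ℝ (Fin m)}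
  (hx : x ∈ e.target) (hg : IsTransverseRiemannLorentz g) {U : Set M} {A B C D : Field m M}

include he hx hg

/-- On a `II`-flat hypersurface, `II` vanishes on all tangent vectors. -/
lemma IsIIFlat.christ_eq_zero (hII : IsIIFlat g) (h0 : gramDet g e x = 0) {a b r : 𝔼}
    (ha : fderiv ℝ (gramDet g e) x a = 0) (hb : fderiv ℝ (gramDet g e) x b = 0)
    (hr : coordMetric g e x r = 0) : christ (coordMetric g e) x a b r = 0 := by
  have h := isSingularMetric_coord he hg
  have hs := (mem_sing_iff he hx).2 h0
  have hm := isMainAt_coord he hx hg hs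
  obtain ⟨c, rfl⟩ := h.radical_span hx h0 hm hr
  rw [map_smul, h.christ_tangent_eq_zero hx h0 hm (fun s t h1 h2 h3 h4 ↦ ?_) ha hb, smul_zero]
  rw [← formII_coord he hx hg hs]
  exact hII _ hs _ _ ((isScreen_coord he hx hg hs s).2 ⟨h1, h2⟩)
    ((isScreen_coord he hx hg hs t).2 ⟨h3, h4⟩)

omit he hx in
/-- `II`-flatness is a condition on the quadratic form of `II`. -/
lemma isIIFlat_of_quadratic (H : ∀ (e : OpenPartialHomeomorph M 𝔼),
    e ∈ IsManifold.maximalAtlas (𝓡 m) ∞ M → ∀ x ∈ e.target, gramDet g e x = 0 →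
    ∀ s, fderiv ℝ (gramDet g e) x s = 0 →
      christ (coordMetric g e) x s (coordNormal g e x) (coordRadical g e x) = 0 →
      christ (coordMetric g e) x s s (coordRadical g e x) = 0) : IsIIFlat g := by
  intro p hs v w hv hw
  obtain ⟨e, he, x, hx, rfl⟩ := exists_chart (m := m) p
  have h := isSingularMetric_coord he hg
  have h0 := (mem_sing_iff he hx).1 hs
  obtain ⟨s, rfl⟩ := frame_surjective he hx v
  obtain ⟨t, rfl⟩ := frame_surjective he hx w
  rw [isScreen_coord he hx hg hs] at hv hw
  rw [formII_coord he hx hg hs]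
  have h1 := H e he x hx h0 s hv.1 hv.2
  have h2 := H e he x hx h0 t hw.1 hw.2
  -- Polarization.
  have h3 := H e he x hx h0 (s + t) (by simp [hv.1, hw.1]) (by simp [hv.2, hw.2])
  simp only [map_add, add_apply, h.christ_comm hx t s, h1, h2] at h3
  linarith

/-- The plane spanned by a spacelike tangent vector and the main radical vector. -/
lemma exists_degenerateAlong (h0 : gramDet g e x = 0) {W : Set 𝔼} {N R : 𝔼 → 𝔼}
    (hW : W ⊆ e.target) (hN : IsMainOn (coordMetric g e) (gramDet g e) W N R) (hxW : x ∈ W)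
    {s : 𝔼} (hs : fderiv ℝ (gramDet g e) x s = 0) (hss : coordMetric g e x s s ≠ 0) :
    ∃ V ⊆ e.source ∩ e ⁻¹' W, IsOpen V ∧ e.symm x ∈ V ∧
      DegenerateAlong g V (ofCoord e (orthField (coordMetric g e) N s)) (ofCoord e R) ∧
      NuVanish g V (ofCoord e (orthField (coordMetric g e) N s)) (ofCoord e R) := by
  have h := isSingularMetric_coord he hg
  set S := orthField (coordMetric g e) N s with hSdef
  have hSx : S x = s := h.orthField_eq h0 hN hxW hs
  have hS : ContDiffOn ℝ ∞ S W := fun y hy ↦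
    (h.contDiffAt_orthField (hW hy) hN hy s).contDiffWithinAt
  have hq : ContDiffOn ℝ ∞ (fun y ↦ coordMetric g e y (S y) (S y)) W :=
    ((h.smooth.mono hW).clm_apply hS).clm_apply hS
  -- Where `S` is not isotropic, the Gram matrix of `S` and the radical field has rank one.
  set W' := W ∩ (fun y ↦ coordMetric g e y (S y) (S y)) ⁻¹' {0}ᶜ
  have hW' : IsOpen W' := hq.continuousOn.isOpen_inter_preimage hN.isOpen isOpen_compl_singleton
  have hW'W : W' ⊆ W := Set.inter_subset_left
  have key : ∀ p ∈ (e.source ∩ e ⁻¹' W') ∩ sing g, ∃ y ∈ W', e.symm y = p := by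
    rintro p ⟨⟨hp, hpW⟩, -⟩
    exact ⟨e p, hpW, e.left_inv hp⟩
  refine ⟨e.source ∩ e ⁻¹' W', fun p hp ↦ ⟨hp.1, hW'W hp.2⟩, e.isOpen_inter_preimage hW',
    ⟨e.map_target hx, ?_⟩, ⟨smoothOn_ofCoord he hW' (hS.mono hW'W),
    smoothOn_ofCoord he hW' (hN.smooth_radical.mono hW'W), fun p hp ↦ ?_, fun p hp ↦ ?_⟩,
    fun p hp ↦ ?_⟩
  · rw [Set.mem_preimage, e.right_inv hx]
    exact ⟨hxW, by simpa [hSx] using hss⟩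
  all_goals
    obtain ⟨y, hy, rfl⟩ := key p hp
    have hyt := hW hy.1
    have hy0 := (mem_sing_iff he hyt).1 hp.2
    have hmy := hN.main y hy.1 hy0
    have hrad : ∀ v, coordMetric g e y v (R y) = 0 := fun v ↦ by
      rw [coordMetric_symm, hmy.radical]; rfl
  · rw [rank_eq_one_iff_two, planeGram_det_coord he hyt, planeGram_coord he hyt,
      coordField_ofCoord he _ hyt, coordField_ofCoord he _ hyt, hmy.radical, hrad]
    refine ⟨by simp, fun hcon ↦ hy.2 ?_⟩
    exact congrFun (congrFun hcon 0) 0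
  -- The pair in `mainPair` is chosen separately at each point, so it agrees with the given radical
  -- field only up to sign.
  · obtain ⟨-, hR⟩ := h.main_unique hyt hy0 hmy (isMainAt_coord he hyt hg hp.2)
    rw [← frame_coordRadical he hyt, ofCoord_symm he hyt, ofCoord_symm he hyt]
    have hmem : frame e y (R y) ∈ Submodule.span ℝ {frame e y (S y), frame e y (R y)} :=
      Submodule.subset_span (by simp)
    rcases hR with hR | hR
    · rwa [hR]
    · rw [hR, map_neg]
      exact Submodule.neg_mem _ hmem
  · obtain ⟨hn, -⟩ := h.main_unique hyt hy0 hmy (isMainAt_coord he hyt hg hp.2)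
    rw [ofCoord_symm he hyt, ofCoord_symm he hyt, nu_coord he hyt, nu_coord he hyt, hn,
      hmy.radical]
    exact ⟨(h.tangent_iff hmy).1 (h.orthField_tangent hy0 hN hy.1 s), rfl⟩

omit he hx in
/-- If the curvature of the tangent degenerate planes is well-defined, then the hypersurface is
`II`-flat. -/
lemma isIIFlat_of_wellDefined (H : ∀ (U : Set M) (A B : Field m M), IsOpen U →
    DegenerateAlong g U A B → NuVanish g U A B → CurvAlongWellDefined g U A B A B) :
    IsIIFlat g := by
  refine isIIFlat_of_quadratic hg fun e he x hx h0 s hs hsn ↦ ?_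
  have h := isSingularMetric_coord he hg
  have hsing := (mem_sing_iff he hx).2 h0
  have hm := isMainAt_coord he hx hg hsing
  by_cases hss : coordMetric g e x s s = 0
  · rw [h.screen_eq_zero hx h0 hm hsn hss]; simp
  obtain ⟨W, hW, hxW, hN⟩ := isMainOn_mainPair he hx hg hsing
  set N := coordField e (mainPair g (e.symm x)).1
  set R := coordField e (mainPair g (e.symm x)).2
  obtain ⟨V, hVW, hV, hxV, hAB, hν⟩ := exists_degenerateAlong he hx hg h0 hW hN hxW hs hss
  set S := orthField (coordMetric g e) N s with hSdef
  have hSx : S x = s := h.orthField_eq h0 hN hxW hs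
  obtain ⟨f, hf⟩ := H V _ _ hV hAB hν
  -- A second extension of the same field along the hypersurface. Adding `τ N` in the last argument
  -- changes the curvature by `curvNum` on `(S, R, S, N)`, since the factor `τ` cancels.
  have hsN : SmoothOn V (ofCoord e fun y ↦ R y + gramDet g e y • N y) :=
    (smoothOn_ofCoord he hN.isOpen (hN.smooth_radical.add
      ((h.smooth_disc.mono hW).smul hN.smooth_normal))).mono hVW
  obtain ⟨F, hF, hFf⟩ := hf _ _ _ _ hAB.smooth_left hAB.smooth_right hAB.smooth_left
    hAB.smooth_right fun p _ ↦ ⟨rfl, rfl, rfl, rfl⟩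
  obtain ⟨F', hF', hFf'⟩ := hf _ _ _ _ hAB.smooth_left hAB.smooth_right hAB.smooth_left hsN
    fun p hp ↦ ⟨rfl, rfl, rfl, by
      obtain ⟨hpe, hpW⟩ := hVW hp.1
      have : gramDet g e (e p) = 0 := by
        rw [← mem_sing_iff he (hW hpW), e.left_inv hpe]
        exact hp.2
      simp only [ofCoord, this, zero_smul, add_zero]⟩
  have hNx := hN.contDiffAt_normal hxW
  have hRx := hN.contDiffAt_radical hxW
  have hS := h.contDiffAt_orthField hx hN hxW s
  have hcF := contDiffAt_comp_symm he hx (hF.1.contMDiffAt (hV.mem_nhds hxV))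
  have hcF' := contDiffAt_comp_symm he hx (hF'.1.contMDiffAt (hV.mem_nhds hxV))
  have hc := h.contDiffAt_curvNum hx hS hRx hS hNx
  have key := h.eq_of_eventually (f := fun y ↦ F' (e.symm y)) (g := fun y ↦ F (e.symm y) +
      curvNum (coordMetric g e) (gramDet g e) (fun x ↦ cof (coordMetric g e x)) y
        (S y) (R y) (S y) (N y)) hx h0 hcF'.continuousAt (hcF.add hc).continuousAt (by
    filter_upwards [e.open_target.mem_nhds hx, eventually_symm he hx (hV.eventually_mem hxV)]
      with y hy hyV hy0
    have e1 := hF.mul_gramDet hg he hy hV hyV hAB.smooth_left hAB.smooth_right hAB.smooth_left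
      hAB.smooth_right
    have e2 := hF'.mul_gramDet hg he hy hV hyV hAB.smooth_left hAB.smooth_right hAB.smooth_left hsN
    simp only [coordCurv, coordField_ofCoord he _ hy] at e1 e2
    apply mul_right_cancel₀ hy0
    rw [e2, add_mul, e1]
    simp only [curvNum, curvLin, map_add, map_smul, add_apply, smul_apply, smul_eq_mul]
    ring)
  have hxs : e.symm x ∈ V ∩ sing g := ⟨hxV, hsing⟩
  simp only [hFf _ hxs, hFf' _ hxs] at key
  -- The change equals `κ (II (s, s) II (R, N) - II (R, s) II (s, N))`, and `II (R, N) = 1`, `II (s,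
  -- N) = 0`; its vanishing gives `II (s, s) = 0`.
  obtain ⟨κ, hκ, hN'⟩ := h.curvNum_eq hx h0 hm.radical_ne_zero hm.radical
  rw [left_eq_add, hN', hSx] at key
  have key := (mul_eq_zero.1 key).resolve_left hκ
  have e1 : christ (coordMetric g e) x (R x) (N x) (coordRadical g e x) = 1 := hm.normalized
  have e2 : christ (coordMetric g e) x s (N x) (coordRadical g e x) = 0 := hsn
  rw [e1, e2] at key
  linarith

/-! ### The curvature of tangent degenerate planes of a `II`-flat hypersurface -/

end Flatness
end SingularMetric

namespace SingularMetric

section CurvatureValues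

set_option linter.unusedSectionVars false
set_option synthInstance.maxHeartbeats 400000
set_option maxHeartbeats 1000000

variable {m : ℕ} {M : Type*} [TopologicalSpace M] [ChartedSpace (EuclideanSpace ℝ (Fin m)) M]
  [IsManifold (𝓡 m) ∞ M] {e : OpenPartialHomeomorph M (EuclideanSpace ℝ (Fin m))}
  {g : SymTensor m M}

local notation "𝔼" => EuclideanSpace ℝ (Fin m)

/-! ### The curvature of tangent degenerate planes of a `II`-flat hypersurface -/

variable (he : e ∈ IsManifold.maximalAtlas (𝓡 m) ∞ M) {x : EuclideanSpace ℝ (Fin m)}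
  (hx : x ∈ e.target) (hg : IsTransverseRiemannLorentz g) {U : Set M} {A B A' B' C' D' : Field m M}

include he hx hg

lemma NuVanish.tangent (hν : NuVanish g U A B) (hxU : e.symm x ∈ U) (hs : e.symm x ∈ sing g) :
    fderiv ℝ (gramDet g e) x (coordField e A x) = 0 ∧
      fderiv ℝ (gramDet g e) x (coordField e B x) = 0 := by
  have h := isSingularMetric_coord he hg
  have hm := isMainAt_coord he hx hg hs
  rw [h.tangent_iff hm, h.tangent_iff hm]
  exact hν.coord he hx hxU hs

/-- The covectors `II`, as represented by vectors. -/
lemma IsIIFlat.exists_repr (hII : IsIIFlat g) (h0 : gramDet g e x = 0) {a b : 𝔼}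
    (ha : fderiv ℝ (gramDet g e) x a = 0) (hb : fderiv ℝ (gramDet g e) x b = 0) :
    ∃ z, coordMetric g e x z = christ (coordMetric g e) x a b :=
  (isSingularMetric_coord he hg).exists_repr hx h0 fun _ hr ↦
    hII.christ_eq_zero he hx hg h0 ha hb hr

variable (hU : IsOpen U) (hν : NuVanish g U A B) (hA : SmoothOn U A') (hB : SmoothOn U B')
  (hC : SmoothOn U C') (hD : SmoothOn U D')
  (hval : ∀ p ∈ U ∩ sing g, A' p = A p ∧ B' p = B p ∧ C' p = A p ∧ D' p = B p)

include hU hν hA hB hC hD hval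

-- On the hypersurface the numerator is quadratic in values of `II` on tangent vectors, all of which
-- vanish.
omit he hx in
lemma IsIIFlat.hasGoodLimit (hII : IsIIFlat g) : HasGoodLimit g U (curv g A' B' C' D') := by
  refine hasGoodLimit_curv hg hU hA hB hC hD fun e he y hy hyU hys ↦ ?_
  have h := isSingularMetric_coord he hg
  have h0 := (mem_sing_iff he hy).1 hys
  have hm := isMainAt_coord he hy hg hys
  obtain ⟨hAt, hBt⟩ := hν.tangent he hy hg hyU hys
  obtain ⟨e1, e2, e3, e4⟩ := hval _ ⟨hyU, hys⟩
  obtain ⟨κ, -, hκ⟩ := h.curvNum_eq hy h0 hm.radical_ne_zero hm.radical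
  rw [coordCurv, hκ, coordField_congr e1, coordField_congr e2, coordField_congr e3,
    coordField_congr e4, hII.christ_eq_zero he hy hg h0 hAt hAt hm.radical,
    hII.christ_eq_zero he hy hg h0 hBt hAt hm.radical]
  ring

/-- Only the values of the fields at the point occur on the right, which makes the result
independent of the chosen extensions. -/
lemma IsIIFlat.curv_value (hII : IsIIFlat g) (hxU : e.symm x ∈ U) (hs : e.symm x ∈ sing g)
    {F : M → ℝ} (hF : IsSmoothExt g U (curv g A' B' C' D') F) {z z' : 𝔼}
    (hz : coordMetric g e x z =
      christ (coordMetric g e) x (coordField e A x) (coordField e B x))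
    (hz' : coordMetric g e x z' =
      christ (coordMetric g e) x (coordField e A x) (coordField e A x)) :
    F (e.symm x) =
      curvLin (coordMetric g e) x (coordField e A x) (coordField e B x) (coordField e A x)
        (coordField e B x) -
      christ (coordMetric g e) x (coordField e A x) (coordField e B x) z +
      christ (coordMetric g e) x (coordField e B x) (coordField e B x) z' := by
  have h0 := (mem_sing_iff he hx).1 hs
  obtain ⟨hAt, hBt⟩ := hν.tangent he hx hg hxU hs
  obtain ⟨e1, e2, e3, e4⟩ := hval _ ⟨hxU, hs⟩
  refine hF.value hg he hx hU hxU hA hB hC hD hs (coordField_congr e1) (coordField_congr e2)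
    (coordField_congr e3) (coordField_congr e4) ?_ hz' (fun r hr ↦ ?_) fun r hr ↦ ?_
  · rw [hz]
    ext c
    exact (isSingularMetric_coord he hg).christ_comm hx _ _ _
  · exact hII.christ_eq_zero he hx hg h0 hAt hBt hr
  · exact hII.christ_eq_zero he hx hg h0 hBt hBt hr

omit he hx hA hB hC hD hval in
/-- On a `II`-flat hypersurface the curvature of tangent planes is well-defined. -/
lemma IsIIFlat.curvAlongWellDefined (hII : IsIIFlat g) (hA : SmoothOn U A) (hB : SmoothOn U B) :
    CurvAlongWellDefined g U A B A B := by
  have hself : ∀ p ∈ U ∩ sing g, A p = A p ∧ B p = B p ∧ A p = A p ∧ B p = B p :=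
    fun p _ ↦ ⟨rfl, rfl, rfl, rfl⟩
  obtain ⟨F₀, hF₀⟩ := hII.hasGoodLimit hg hU hν hA hB hA hB hself
  refine ⟨F₀, fun A' B' C' D' hA' hB' hC' hD' hval ↦ ?_⟩
  obtain ⟨F, hF⟩ := hII.hasGoodLimit hg hU hν hA' hB' hC' hD' hval
  refine ⟨F, hF, fun p hp ↦ ?_⟩
  obtain ⟨hp, hs⟩ := hp
  obtain ⟨e, he, x, hx, rfl⟩ := exists_chart (m := m) p
  have h0 := (mem_sing_iff he hx).1 hs
  obtain ⟨hAt, hBt⟩ := hν.tangent he hx hg hp hs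
  obtain ⟨z, hz⟩ := hII.exists_repr he hx hg h0 hAt hBt
  obtain ⟨z', hz'⟩ := hII.exists_repr he hx hg h0 hAt hAt
  rw [hII.curv_value he hx hg hU hν hA' hB' hC' hD' hval hp hs hF hz hz',
    hII.curv_value he hx hg hU hν hA hB hA hB hself hp hs hF₀ hz hz']

/-! ### `III`-flatness -/

omit hU hν hA hB hC hD hval

/-- On a `II`-flat hypersurface, the curvature of the plane spanned by a screen vector and the
radical is the second fundamental form. -/
lemma IsIIFlat.curvLin_screen (hII : IsIIFlat g) (hs : e.symm x ∈ sing g) {s : 𝔼}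
    (hst : fderiv ℝ (gramDet g e) x s = 0)
    (hsn : christ (coordMetric g e) x s (coordNormal g e x) (coordRadical g e x) = 0) {z z' : 𝔼}
    (hz : coordMetric g e x z = christ (coordMetric g e) x s (coordRadical g e x))
    (hz' : coordMetric g e x z' = christ (coordMetric g e) x s s) :
    curvLin (coordMetric g e) x s (coordRadical g e x) s (coordRadical g e x) -
      christ (coordMetric g e) x s (coordRadical g e x) z +
      christ (coordMetric g e) x (coordRadical g e x) (coordRadical g e x) z' =
    -secondForm (coordMetric g e) (coordField e (mainPair g (e.symm x)).1) x s s := by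
  obtain ⟨W, hW, hxW, hN⟩ := isMainOn_mainPair he hx hg hs
  have h := isSingularMetric_coord he hg
  refine h.curv_screen hx ((mem_sing_iff he hx).1 hs) hN hxW (fun y hy hy0 a b ha hb ↦ ?_) hst hsn
    ?_ hz'
  · exact hII.christ_eq_zero he (hW hy) hg hy0 ha hb (hN.main y hy hy0).radical
  · rw [hz]
    ext c
    exact h.christ_comm hx _ _ _

/-- The value of `III` in terms of the second fundamental form. -/
lemma formII_nablaExt {V W Z : Field m M} (hU : IsOpen U) (hV : SmoothOn U V) (hW : SmoothOn U W)
    (hWs : ∀ p ∈ U ∩ sing g, IsScreen g p (W p)) (hZ : IsNablaExt g U V W Z)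
    (hxU : e.symm x ∈ U) (hs : e.symm x ∈ sing g) (hVs : IsScreen g (e.symm x) (V (e.symm x))) :
    formII g (e.symm x) (Z (e.symm x)) (mainRadical g (e.symm x)) =
      secondForm (coordMetric g e) (coordField e (mainPair g (e.symm x)).1) x
        (coordField e V x) (coordField e W x) := by
  have h := isSingularMetric_coord he hg
  have h0 := (mem_sing_iff he hx).1 hs
  have hm := isMainAt_coord he hx hg hs
  obtain ⟨W₀, hW₀, hxW, hN⟩ := isMainOn_mainPair he hx hg hs
  have cV := (hV.fieldSmoothAt hU hxU).coordField he hx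
  have cW := (hW.fieldSmoothAt hU hxU).coordField he hx
  have cZ := (hZ.1.fieldSmoothAt hU hxU).coordField he hx
  -- Lowering the index of the covariant derivative gives an expression that is smooth across the
  -- hypersurface, so the identity passes to the limit.
  have key := h.eq_of_eventually (f := fun y ↦ coordMetric g e y (coordField e Z y))
    (g := fun y ↦ coordMetric g e y (fderiv ℝ (coordField e W) y (coordField e V y)) +
      christ (coordMetric g e) y (coordField e V y) (coordField e W y)) hx h0
    ((h.contDiffAt hx).clm_apply cZ).continuousAt
    (((h.contDiffAt hx).clm_apply ((cW.fderiv_right (m := ∞) (by simp)).clm_apply cV)).add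
      (((h.contDiffAt_christ hx).clm_apply cV).clm_apply cW)).continuousAt (by
    filter_upwards [e.open_target.mem_nhds hx, eventually_symm he hx (hU.eventually_mem hxU)]
      with y hy hyU hy0
    have hys : e.symm y ∉ sing g := fun hs ↦ hy0 ((mem_sing_iff he hy).1 hs)
    rw [coordField_congr (hZ.2 _ ⟨hyU, hys⟩)]
    exact nabla_coord he hy hg hys (hV.fieldSmoothAt hU hyU) (hW.fieldSmoothAt hU hyU))
  have hVt : fderiv ℝ (gramDet g e) x (coordField e V x) = 0 := by
    rw [← isTangent_iff he hx hg hs, frame_coordField he _ hx]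
    exact hVs.1
  have e1 := h.normal_covariant_derivative hx h0 hN hxW cW (by
    filter_upwards [e.open_target.mem_nhds hx, eventually_symm he hx (hU.eventually_mem hxU)]
      with y hy hyU hy0
    have hys := (mem_sing_iff he hy).2 hy0
    rw [← isTangent_iff he hy hg hys, frame_coordField he _ hy]
    exact (hWs _ ⟨hyU, hys⟩).1) hVt
  -- `II (Z, R)` is the normal component of `Z`, and that of the covariant derivative of a tangent
  -- field is the second fundamental form.
  rw [← frame_coordField he Z hx, ← frame_coordRadical he hx, formII_coord he hx hg hs,
    h.christ_radical_radical hx h0 hm, ← e1, key]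
  rfl

omit he hx in
/-- If the second fundamental form of the screen vanishes, so does `III`. -/
lemma isIIIFlat_of_secondForm (hII : IsIIFlat g) (H : ∀ (e : OpenPartialHomeomorph M 𝔼),
    e ∈ IsManifold.maximalAtlas (𝓡 m) ∞ M → ∀ x ∈ e.target, e.symm x ∈ sing g →
    ∀ s, fderiv ℝ (gramDet g e) x s = 0 →
      christ (coordMetric g e) x s (coordNormal g e x) (coordRadical g e x) = 0 →
      secondForm (coordMetric g e) (coordField e (mainPair g (e.symm x)).1) x s s = 0) :
    IsIIIFlat g := by
  refine ⟨hII, fun U V W Z hU hV hW hVW hZ p hp ↦ ?_⟩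
  obtain ⟨hp, hs⟩ := hp
  obtain ⟨e, he, x, hx, rfl⟩ := exists_chart (m := m) p
  obtain ⟨W₀, hW₀, hxW, hN⟩ := isMainOn_mainPair he hx hg hs
  rw [formII_nablaExt he hx hg hU hV hW (fun q hq ↦ (hVW q hq).2) hZ hp hs (hVW _ ⟨hp, hs⟩).1]
  have h := isSingularMetric_coord he hg
  obtain ⟨hv, hw⟩ := hVW _ ⟨hp, hs⟩
  rw [← frame_coordField he V hx, isScreen_coord he hx hg hs] at hv
  rw [← frame_coordField he W hx, isScreen_coord he hx hg hs] at hw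
  have h1 := H e he x hx hs _ hv.1 hv.2
  have h2 := H e he x hx hs _ hw.1 hw.2
  have h3 := H e he x hx hs (coordField e V x + coordField e W x) (by simp [hv.1, hw.1])
    (by simp [hv.2, hw.2])
  have h4 := h.secondForm_symm hx ((mem_sing_iff he hx).1 hs) hN hxW hv.1 hw.1
  simp only [secondForm, map_add, add_apply] at h1 h2 h3 h4 ⊢
  linarith

/-- On a `III`-flat hypersurface the second fundamental form of the screen vanishes. -/
lemma IsIIIFlat.secondForm_eq_zero (hIII : IsIIIFlat g) (hs : e.symm x ∈ sing g) {s : 𝔼}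
    (hst : fderiv ℝ (gramDet g e) x s = 0)
    (hsn : christ (coordMetric g e) x s (coordNormal g e x) (coordRadical g e x) = 0) :
    secondForm (coordMetric g e) (coordField e (mainPair g (e.symm x)).1) x s s = 0 := by
  have h := isSingularMetric_coord he hg
  have h0 := (mem_sing_iff he hx).1 hs
  obtain ⟨W, hW, hxW, hN⟩ := isMainOn_mainPair he hx hg hs
  set N := coordField e (mainPair g (e.symm x)).1
  set R := coordField e (mainPair g (e.symm x)).2
  set S := orthField (coordMetric g e) N s with hSdef
  have hSx : S x = s := h.orthField_eq h0 hN hxW hst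
  have hS : ContDiffOn ℝ ∞ S W := fun y hy ↦
    (h.contDiffAt_orthField (hW hy) hN hy s).contDiffWithinAt
  have hG := h.smooth.mono hW
  have hch := (contDiffOn_christ h.isOpen h.smooth).mono hW
  -- Subtracting the radical component brings `S` into the screen along the hypersurface and keeps
  -- the value `s` at `x`.
  let V : 𝔼 → 𝔼 := fun y ↦ S y - christ (coordMetric g e) y (S y) (N y) (R y) • R y
  have hV : ContDiffOn ℝ ∞ V W := hS.sub ((((hch.clm_apply hS).clm_apply hN.smooth_normal).clm_apply
    hN.smooth_radical).smul hN.smooth_radical)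
  have hVx : V x = s := by
    have : christ (coordMetric g e) x s (N x) (R x) = 0 := hsn
    simp only [V, hSx, this, zero_smul, sub_zero]
  have hVt : ∀ y ∈ W, gramDet g e y = 0 → fderiv ℝ (gramDet g e) y (V y) = 0 ∧
      christ (coordMetric g e) y (V y) (N y) (R y) = 0 := by
    intro y hy hy0
    have hmy := hN.main y hy hy0
    simp [V, h.orthField_tangent hy0 hN hy s, S, h.radical_tangent (hW hy) hy0 hmy, hmy.normalized]
  -- `II (V, V) = 0`, so `K Γ(V, V)` is divisible by `τ`. The quotient `k` completes the derivative
  -- of `V` to a smooth extension of its covariant derivative.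
  obtain ⟨W', hW'W, hW', hxW', k, hk, hKk⟩ := exists_eq_smul_of_regular hN.isOpen hxW
    ((h.smooth_cof.mono hW).clm_apply ((hch.clm_apply hV).clm_apply hV)) (h.smooth_disc.mono hW) h0
    (h.regular x hx h0) (fun y hy hy0 ↦ by
      have hmy := hN.main y hy hy0
      obtain ⟨κ, -, hK, -⟩ := h.radical y (hW hy) hy0 _ hmy.radical_ne_zero hmy.radical
      rw [hK, hIII.1.christ_eq_zero he (hW hy) hg hy0 (hVt y hy hy0).1 (hVt y hy hy0).1
        hmy.radical]
      simp)
  have hopen : IsOpen (e.source ∩ e ⁻¹' W') := e.isOpen_inter_preimage hW'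
  have hVW' := hV.mono hW'W
  have hsV := smoothOn_ofCoord he hW' hVW'
  have hsZ := smoothOn_ofCoord he hW'
    (((hVW'.fderiv_of_isOpen hW' (m := ∞) (by simp)).clm_apply hVW').add hk)
  have hxU : e.symm x ∈ e.source ∩ e ⁻¹' W' := by
    refine ⟨e.map_target hx, ?_⟩
    rwa [Set.mem_preimage, e.right_inv hx]
  have key : ∀ p ∈ e.source ∩ e ⁻¹' W', ∃ y ∈ W', e.symm y = p := fun p hp ↦
    ⟨e p, hp.2, e.left_inv hp.1⟩
  have hscr : ∀ p ∈ (e.source ∩ e ⁻¹' W') ∩ sing g, IsScreen g p (ofCoord e V p) := by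
    rintro p ⟨hp, hps⟩
    obtain ⟨y, hy, rfl⟩ := key p hp
    have hyt := hW (hW'W hy)
    have hy0 := (mem_sing_iff he hyt).1 hps
    obtain ⟨e1, e2⟩ := hVt y (hW'W hy) hy0
    obtain ⟨hn, hr⟩ := h.main_unique hyt hy0 (hN.main y (hW'W hy) hy0)
      (isMainAt_coord he hyt hg hps)
    rw [ofCoord_symm he hyt, isScreen_coord he hyt hg hps, hn]
    refine ⟨e1, ?_⟩
    rcases hr with hr | hr
    · rw [hr, e2]
    · rw [hr, map_neg, e2, neg_zero]
  have hZ : IsNablaExt g (e.source ∩ e ⁻¹' W') (ofCoord e V) (ofCoord e V)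
      (ofCoord e fun y ↦ fderiv ℝ V y (V y) + k y) := by
    refine ⟨hsZ, ?_⟩
    rintro p ⟨hp, hps⟩
    obtain ⟨y, hy, rfl⟩ := key p hp
    have hyt := hW (hW'W hy)
    have hy0 : gramDet g e y ≠ 0 := fun hy0 ↦ hps ((mem_sing_iff he hyt).2 hy0)
    have hsy := hsV.fieldSmoothAt hopen hp
    have hev : coordField e (ofCoord e V) =ᶠ[𝓝 y] V := by
      filter_upwards [e.open_target.mem_nhds hyt] with z hz
      exact coordField_ofCoord he V hz
    rw [← frame_coordField he (nabla g _ _) hyt, coordField_nabla he hyt hg hps hsy hsy,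
      hev.fderiv_eq, hev.self_of_nhds, hKk y hy, smul_smul, inv_mul_cancel₀ hy0, one_smul,
      ofCoord_symm he hyt]
  have := hIII.2 _ _ _ _ hopen hsV hsV (fun p hp ↦ ⟨hscr p hp, hscr p hp⟩) hZ _ ⟨hxU, hs⟩
  rw [formII_nablaExt he hx hg hopen hsV hsV hscr hZ hxU hs (hscr _ ⟨hxU, hs⟩),
    coordField_ofCoord he _ hx, hVx] at this
  exact this

omit he hx in
/-- If the curvature of tangent degenerate planes vanishes, the hypersurface is `III`-flat. -/
lemma isIIIFlat_of_curvAlongEq (H : ∀ (U : Set M) (A B : Field m M), IsOpen U →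
    DegenerateAlong g U A B → NuVanish g U A B → CurvAlongEq g U A B A B 0) : IsIIIFlat g := by
  have hII : IsIIFlat g := isIIFlat_of_wellDefined hg fun U A B hU hAB hν ↦ ⟨0, H U A B hU hAB hν⟩
  refine isIIIFlat_of_secondForm hg hII fun e he x hx hsing s hs hsn ↦ ?_
  have h := isSingularMetric_coord he hg
  have h0 := (mem_sing_iff he hx).1 hsing
  have hm := isMainAt_coord he hx hg hsing
  by_cases hss : coordMetric g e x s s = 0
  · rw [h.screen_eq_zero hx h0 hm hsn hss]; simp [secondForm]
  obtain ⟨W, hW, hxW, hN⟩ := isMainOn_mainPair he hx hg hsing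
  obtain ⟨V, hVW, hV, hxV, hAB, hν⟩ := exists_degenerateAlong he hx hg h0 hW hN hxW hs hss
  have hself : ∀ {A B : Field m M}, ∀ p ∈ V ∩ sing g,
      A p = A p ∧ B p = B p ∧ A p = A p ∧ B p = B p := fun p _ ↦ ⟨rfl, rfl, rfl, rfl⟩
  obtain ⟨F, hF, hF0⟩ := H V _ _ hV hAB hν _ _ _ _ hAB.smooth_left hAB.smooth_right
    hAB.smooth_left hAB.smooth_right hself
  have hrt := h.radical_tangent hx h0 hm
  obtain ⟨z, hz⟩ := hII.exists_repr he hx hg h0 hs hrt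
  obtain ⟨z', hz'⟩ := hII.exists_repr he hx hg h0 hs hs
  have hSx := h.orthField_eq h0 hN hxW hs
  have e1 := hII.curv_value he hx hg hV hν hAB.smooth_left hAB.smooth_right
    hAB.smooth_left hAB.smooth_right hself hxV hsing hF (z := z) (z' := z') (by
      rw [coordField_ofCoord he _ hx, coordField_ofCoord he _ hx, hSx]; exact hz) (by
      rw [coordField_ofCoord he _ hx, hSx]; exact hz')
  rw [hF0 _ ⟨hxV, hsing⟩, coordField_ofCoord he _ hx, coordField_ofCoord he _ hx, hSx] at e1
  have e2 := hII.curvLin_screen he hx hg hsing hs hsn hz hz'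
  have e3 : (0 : ℝ) = _ := e1.trans e2
  linarith

omit he hx in
/-- On a `III`-flat hypersurface the curvature of tangent degenerate planes vanishes. -/
lemma IsIIIFlat.curvAlongEq (hIII : IsIIIFlat g) (hU : IsOpen U) (hAB : DegenerateAlong g U A B)
    (hν : NuVanish g U A B) : CurvAlongEq g U A B A B 0 := by
  intro A' B' C' D' hA hB hC hD hval
  have hII := hIII.1
  obtain ⟨F, hF⟩ := hII.hasGoodLimit hg hU hν hA hB hC hD hval
  refine ⟨F, hF, fun p hp ↦ ?_⟩
  obtain ⟨hp, hs⟩ := hp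
  obtain ⟨e, he, x, hx, rfl⟩ := exists_chart (m := m) p
  have h := isSingularMetric_coord he hg
  have h0 := (mem_sing_iff he hx).1 hs
  have hm := isMainAt_coord he hx hg hs
  obtain ⟨hνA, hνB⟩ := hν.coord he hx hp hs
  obtain ⟨α, β, hrad⟩ := hAB.exists_radical_eq he hx hp hs
  set a := coordField e A x with ha
  set b := coordField e B x with hb
  set r := coordRadical g e x with hr
  -- The screen parts of `a` and `b` are proportional, because `α a + β b = r` has none. If `α = 0`,
  -- the screen part of `a` serves as `s`; otherwise that of `b` does.
  obtain ⟨s, lam, mu, ρ, σ, hst, hsn, has, hbs⟩ : ∃ (s : 𝔼) (lam mu ρ σ : ℝ),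
      fderiv ℝ (gramDet g e) x s = 0 ∧
      christ (coordMetric g e) x s (coordNormal g e x) r = 0 ∧
      a = lam • s + ρ • r ∧ b = mu • s + σ • r := by
    set n := coordNormal g e x
    have h1 := hm.screenProj_add_smul a b α β hrad
    have hdec : ∀ v, coordMetric g e x v n = 0 → v =
        screenProj (coordMetric g e) x n r v + christ (coordMetric g e) x v n r • r := by
      intro v hv
      rw [screenProj, hv]
      module
    by_cases hα : α = 0
    · have hβ : β ≠ 0 := by
        rintro rfl
        exact hm.radical_ne_zero (by rw [hrad, hα]; simp)
      rw [hα, zero_smul, zero_add, smul_eq_zero] at h1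
      obtain ⟨h2, h3⟩ := h.screenProj_mem hx h0 hm hνA
      have h4 := h1.resolve_left hβ
      refine ⟨_, 1, 0, _, christ (coordMetric g e) x b n r, h2, h3,
        by rw [one_smul]; exact hdec a hνA, ?_⟩
      rw [zero_smul, ← h4]
      exact hdec b hνB
    · obtain ⟨h2, h3⟩ := h.screenProj_mem hx h0 hm hνB
      refine ⟨_, -(α⁻¹ * β), 1, christ (coordMetric g e) x a n r, _, h2, h3, ?_,
        by rw [one_smul]; exact hdec b hνB⟩
      have h4 := congrArg (fun v ↦ α⁻¹ • v) h1
      simp only [smul_add, smul_smul, inv_mul_cancel₀ hα, one_smul, smul_zero] at h4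
      rw [neg_smul, ← eq_neg_of_add_eq_zero_left h4]
      exact hdec a hνA
  have hrt := h.radical_tangent hx h0 hm
  obtain ⟨zss, hss⟩ := hII.exists_repr he hx hg h0 hst hst
  obtain ⟨zsr, hsr⟩ := hII.exists_repr he hx hg h0 hst hrt
  obtain ⟨zrr, hrr⟩ := hII.exists_repr he hx hg h0 hrt hrt
  have hcomm : christ (coordMetric g e) x r s = christ (coordMetric g e) x s r :=
    ContinuousLinearMap.ext fun c ↦ h.christ_comm hx _ _ _
  have e1 := hII.curv_value he hx hg hU hν hA hB hC hD hval hp hs hF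
    (z := (lam * mu) • zss + (lam * σ + ρ * mu) • zsr + (ρ * σ) • zrr)
    (z' := (lam * lam) • zss + (2 * lam * ρ) • zsr + (ρ * ρ) • zrr) (by
      rw [← ha, ← hb, has, hbs]
      simp only [map_add, map_smul, add_apply, smul_apply, hss, hsr, hrr, hcomm]
      module) (by
      rw [← ha, has]
      simp only [map_add, map_smul, add_apply, smul_apply, hss, hsr, hrr, hcomm]
      module)
  -- The value is a squared determinant times the one for `(s, r)`, which is minus the second
  -- fundamental form on `s` and hence 0.
  have e2 := h.plane_value hx hss hsr hrr lam ρ mu σ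
  have e3 := hII.curvLin_screen he hx hg hs hst hsn hsr hss
  rw [hIII.secondForm_eq_zero he hx hg hs hst hsn, neg_zero, ← hr] at e3
  rw [← ha, ← hb, has, hbs] at e1
  rw [e1, e2, e3, mul_zero]
  rfl

end CurvatureValues
end SingularMetric

theorem mainTheorem8 {m : ℕ} (hm : 2 < m) {M : Type*} [TopologicalSpace M] [T2Space M]
    [SecondCountableTopology M] [ConnectedSpace M]
    [ChartedSpace (EuclideanSpace ℝ (Fin m)) M] [IsManifold (𝓡 m) ∞ M]
    (g : SingularMetric.SymTensor m M) (hg : SingularMetric.IsTransverseRiemannLorentz g) :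
    -- (a)
    (∀ (U : Set M) (A B : SingularMetric.Field m M), IsOpen U →
      SingularMetric.DegenerateAlong g U A B →
      (∀ p ∈ U \ SingularMetric.sing g, (SingularMetric.planeGram g A B p).rank = 2) →
      (SingularMetric.HasGoodLimit g U (SingularMetric.sec g A B) ↔
        SingularMetric.CurvVanishes g U A B A B) ∧
      (SingularMetric.CurvVanishes g U A B A B → SingularMetric.NuVanish g U A B)) ∧
    -- (b), (1) ⇔ (2)
    ((∀ (U : Set M) (A B : SingularMetric.Field m M), IsOpen U →
        SingularMetric.DegenerateAlong g U A B → SingularMetric.NuVanish g U A B →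
        SingularMetric.CurvAlongEq g U A B A B 0) ↔ SingularMetric.IsIIIFlat g) ∧
    -- (b), (2) ⇒ (3)
    (SingularMetric.IsIIIFlat g → SingularMetric.IsIIFlat g) ∧
    -- (b), (3) ⇔ (4)
    (SingularMetric.IsIIFlat g ↔
      ∀ (U : Set M) (A B : SingularMetric.Field m M), IsOpen U →
        SingularMetric.DegenerateAlong g U A B → SingularMetric.NuVanish g U A B →
        SingularMetric.CurvAlongWellDefined g U A B A B) ∧
    -- for such planes, `ν (A) = 0 = ν (B)` forces `dim Span (A^S, B^S) = 1`
    (∀ (U : Set M) (A B : SingularMetric.Field m M), IsOpen U →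
      SingularMetric.DegenerateAlong g U A B → SingularMetric.NuVanish g U A B →
      ∀ p ∈ U ∩ SingularMetric.sing g,
        Module.finrank ℝ (Submodule.span ℝ {SingularMetric.screenPart g p (A p),
          SingularMetric.screenPart g p (B p)}) = 1) := by
  have hr : ∀ (U : Set M) (A B : SingularMetric.Field m M), IsOpen U →
      SingularMetric.DegenerateAlong g U A B → SingularMetric.IsIIFlat g →
      SingularMetric.NuVanish g U A B → SingularMetric.CurvAlongWellDefined g U A B A B :=
    fun U A B hU hAB hII hν ↦
      hII.curvAlongWellDefined hg hU hν hAB.smooth_left hAB.smooth_right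
  refine ⟨fun U A B hU hAB hrank ↦ ⟨SingularMetric.hasGoodLimit_sec_iff hg hU hAB hrank,
      SingularMetric.nuVanish_of_curvVanishes hg hU hAB⟩,
    ⟨SingularMetric.isIIIFlat_of_curvAlongEq hg,
      fun hIII U A B hU hAB hν ↦ hIII.curvAlongEq hg hU hAB hν⟩,
    fun hIII ↦ hIII.1,
    ⟨fun hII U A B hU hAB hν ↦ hr U A B hU hAB hII hν,
      SingularMetric.isIIFlat_of_wellDefined hg⟩,
    fun U A B _ hAB hν p hp ↦ SingularMetric.finrank_span_screenPart hg hAB hν hp⟩
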